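/- **Setting.** Let $\vec i,\vec j,\vec k$ be the standard basis of $\mathbb R^3$, and $R a=\vec k\times a$. A map $u:\mathbb R^2\to\mathbb S^2\subset\mathbb R^3$ is 1-equivariant if $u(r,\theta)=e^{\theta R}\bar u(r)$ in polar coordinates. Consider continuous 1-equivariant maps $u\in\dot H^1$ with $u(0)=-\vec k$ and $u(x)\to-\vec k$ as $|x|\to\infty$, with energy $E(u)=\frac12\int_{\mathbb R^2}|\nabla u|^2\,dx$. Here $f\in\dot H^s$ means that all weak partial derivatives of $f$ of order exactly $s$ are in $L^2(\mathbb R^2)$, $\|f\|_{\dot H^s}$ is the $L^2$ norm of the tensor of these derivatives, and $\|u\|_{\dot H^1\cap\dot H^3}=\|u\|_{\dot H^1}+\|u\|_{\dot H^3}$. A Coulomb frame of $u$ is a pair $\bar v,\ \bar w=\bar u\times\bar v:(0,\infty)\to\mathbb R^3$ with $\bar v$ locally absolutely continuous, $|\bar v|=1$, $\bar v\cdot\bar u=0$, $\partial_r\bar v\cdot\bar w=0$ almost everywhere, and $\bar v\to\vec i$, $\bar w\to-\vec j$ as $r\to\infty$. Given it, set $$\psi_1=\partial_r\bar u\cdot\bar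 v+i\,\partial_r\bar u\cdot\bar w,\qquad \psi_2=R\bar u\cdot\bar v+i\,R\bar u\cdot\bar w,\qquad \psi^\pm=\psi_1\pm i\frac{\psi_2}{r},$$ and define the two-dimensional extensions $R_+\psi^+(r,\theta)=\psi^+(r)$ and $R_-\psi^-(r,\theta)=e^{2i\theta}\psi^-(r)$. **Proposition 2.1.** For every $E_0\ge 0$ there is a constant $C=C(E_0)$ such that every $u$ as above with $E(u)\le E_0$ has a Coulomb frame, and for every Coulomb frame of $u$ the following hold. 1. $u\in\dot H^3$ if and only if both $R_+\psi^+$ and $R_-\psi^-$ belong to $H^2(\mathbb R^2)$. 2. If $u\in\dot H^3$, then $$\|u\|_{\dot H^1\cap\dot H^3}\le C\big(\|R_+\psi^+\|_{H^2}+\|R_-\psi^-\|_{H^2}\big)\quad\text{and}\quad \|R_+\psi^+\|_{H^2}+\|R_-\psi^-\|_{H^2}\le C\,\|u\|_{\dot H^1\cap\dot H^3}.$$ -/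

import Mathlib

open MeasureTheory Set Filter Topology
open scoped ENNReal NNReal ContDiff Matrix

noncomputable section

namespace EquivMap

/-- The plane `ℝ²`. -/
abbrev Plane := EuclideanSpace ℝ (Fin 2)

/-- The ambient space `ℝ³` of the sphere `𝕊²`. -/
abbrev Space := EuclideanSpace ℝ (Fin 3)

/-! ### Weak derivatives and Sobolev norms on the plane -/

section Sobolev

variable {F : Type*} [NormedAddCommGroup F] [NormedSpace ℝ F]

/-- `g` is the weak derivative `∂_{w 0} ⋯ ∂_{w (k-1)} f` on `ℝ²`, where `w` lists the `k`
coordinate directions: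
`∫ (∂_w φ) f = (-1)^k ∫ φ g` for every real test function `φ ∈ C_c^∞(ℝ²)`. -/
def HasWeakDeriv {k : ℕ} (w : Fin k → Fin 2) (f g : Plane → F) : Prop :=
  LocallyIntegrable f volume ∧ LocallyIntegrable g volume ∧
    ∀ φ : Plane → ℝ, ContDiff ℝ ∞ φ → HasCompactSupport φ →
      ∫ x, (iteratedFDeriv ℝ k φ x fun j => EuclideanSpace.single (w j) (1 : ℝ)) • f x
        = (-1 : ℝ) ^ k • ∫ x, φ x • g x

/-- `f ∈ Ḣ^k(ℝ²)`: all weak partial derivatives of order exactly `k` exist and lie in `L²`.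
For `k = 0` this is `f ∈ L²`. -/
def MemHdot (k : ℕ) (f : Plane → F) : Prop :=
  ∀ w : Fin k → Fin 2, ∃ g : Plane → F, HasWeakDeriv w f g ∧ MemLp g 2 volume

/-- The `L²` norm of the weak derivative `∂_w f`, with value `∞` when that derivative does not
exist. Weak derivatives are unique up to null sets, so the infimum is over a single value. -/
def weakDerivNorm {k : ℕ} (w : Fin k → Fin 2) (f : Plane → F) : ℝ≥0∞ :=
  ⨅ (g : Plane → F) (_ : HasWeakDeriv w f g), eLpNorm g 2 volume

/-- `‖f‖_{Ḣ^k} = (∑_{|w| = k} ‖∂_w f‖_{L²}²)^{1/2}`, the `L²` norm of the full `k`-th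
derivative tensor. -/
def hdotNorm (k : ℕ) (f : Plane → F) : ℝ≥0∞ :=
  (∑ w : Fin k → Fin 2, weakDerivNorm w f ^ 2) ^ (1 / 2 : ℝ)

/-- `f ∈ H²(ℝ²)`: all weak derivatives of order at most two lie in `L²`. -/
def MemH2 (f : Plane → F) : Prop :=
  ∀ k : ℕ, k ≤ 2 → MemHdot k f

/-- `‖f‖_{H²} = (‖f‖_{L²}² + ‖∇f‖_{L²}² + ‖∇²f‖_{L²}²)^{1/2}`. -/
def h2Norm (f : Plane → F) : ℝ≥0∞ :=
  (∑ k ∈ Finset.range 3, hdotNorm k f ^ 2) ^ (1 / 2 : ℝ)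

/-- `‖f‖_{Ḣ¹ ∩ Ḣ³} = ‖f‖_{Ḣ¹} + ‖f‖_{Ḣ³}`. -/
def hdot13Norm (f : Plane → F) : ℝ≥0∞ :=
  hdotNorm 1 f + hdotNorm 3 f

end Sobolev

/-- The energy `E(u) = ½ ∫ |∇u|²`. -/
def energy (u : Plane → Space) : ℝ≥0∞ :=
  hdotNorm 1 u ^ 2 / 2

/-! ### Equivariant maps -/

/-- The point of the plane with polar coordinates `(r, θ)`. -/
def polar (r θ : ℝ) : Plane := !₂[r * Real.cos θ, r * Real.sin θ]

/-- The standard basis vector `i` of `ℝ³`. -/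
def vecI : Space := !₂[1, 0, 0]

/-- The standard basis vector `j` of `ℝ³`. -/
def vecJ : Space := !₂[0, 1, 0]

/-- The standard basis vector `k` of `ℝ³`. -/
def vecK : Space := !₂[0, 0, 1]

/-- The cross product of `ℝ³`. -/
def cross (a b : Space) : Space := WithLp.toLp 2 (crossProduct a.ofLp b.ofLp)

/-- The horizontal rotation `e^{θR}` of `ℝ³`, where `R a = k × a`. -/
def rot (θ : ℝ) (a : Space) : Space :=
  !₂[Real.cos θ * a 0 - Real.sin θ * a 1, Real.sin θ * a 0 + Real.cos θ * a 1, a 2]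

/-- The radial profile `ū(r)`, the restriction of `u` to the ray `θ = 0`. -/
def profile (u : Plane → Space) (r : ℝ) : Space := u (polar r 0)

/-- `u` is 1-equivariant: `u(r, θ) = e^{θR} ū(r)`. -/
def IsEquivariant (u : Plane → Space) : Prop :=
  ∀ r : ℝ, 0 < r → ∀ θ : ℝ, u (polar r θ) = rot θ (profile u r)

/-! ### The Coulomb gauge and the fields `ψ^±` -/

/-- The second vector `w̄ = ū × v̄` of the frame. -/
def frameW (u : Plane → Space) (v : ℝ → Space) (r : ℝ) : Space := cross (profile u r) (v r)

/-- `v̄ : (0, ∞) → ℝ³` generates the Coulomb frame `(v̄, w̄)`, `w̄ = ū × v̄`, of `u`: it is locally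
absolutely continuous, `v̄ ⋅ v̄ = 1`, `v̄ ⋅ ū = 0`, the connection coefficient
`A₁ = ∂_r v̄ ⋅ w̄` vanishes, and `v̄ → i`, `w̄ → -j` as `r → ∞`.
The values of `v̄` outside `(0, ∞)` play no role. -/
structure IsCoulombFrame (u : Plane → Space) (v : ℝ → Space) : Prop where
  ac : ∀ a b : ℝ, 0 < a → a ≤ b → AbsolutelyContinuousOnInterval v a b
  unit : ∀ r : ℝ, 0 < r → ‖v r‖ = 1
  tangent : ∀ r : ℝ, 0 < r → inner ℝ (v r) (profile u r) = 0
  gauge : ∀ᵐ r ∂(volume.restrict (Ioi (0 : ℝ))), inner ℝ (deriv v r) (frameW u v r) = 0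
  lim_v : Tendsto v atTop (𝓝 vecI)
  lim_w : Tendsto (frameW u v) atTop (𝓝 (-vecJ))

/-- The complex coordinate `X ⋅ v̄ + i X ⋅ w̄` at radius `r` of a vector `X`. -/
def frameCoord (u : Plane → Space) (v : ℝ → Space) (r : ℝ) (X : Space) : ℂ :=
  (inner ℝ X (v r) : ℝ) + Complex.I * (inner ℝ X (frameW u v r) : ℝ)

/-- `ψ₁ = ∂_r u ⋅ v + i ∂_r u ⋅ w`. -/
def psi1 (u : Plane → Space) (v : ℝ → Space) (r : ℝ) : ℂ :=
  frameCoord u v r (deriv (profile u) r)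

/-- `ψ₂ = ∂_θ u ⋅ v + i ∂_θ u ⋅ w`; for 1-equivariant `u` one has `∂_θ u = R u = k × u`. -/
def psi2 (u : Plane → Space) (v : ℝ → Space) (r : ℝ) : ℂ :=
  frameCoord u v r (cross vecK (profile u r))

/-- `ψ⁺ = ψ₁ + i ψ₂ / r`. -/
def psiPlus (u : Plane → Space) (v : ℝ → Space) (r : ℝ) : ℂ :=
  psi1 u v r + Complex.I * psi2 u v r / (r : ℂ)

/-- `ψ⁻ = ψ₁ - i ψ₂ / r`. -/
def psiMinus (u : Plane → Space) (v : ℝ → Space) (r : ℝ) : ℂ :=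
  psi1 u v r - Complex.I * psi2 u v r / (r : ℂ)

/-- The two-dimensional extension `R_m f (r, θ) = e^{imθ} f(r)`, where
`e^{iθ} = (x₁ + i x₂) / |x|`. -/
def ext2 (m : ℤ) (f : ℝ → ℂ) (x : Plane) : ℂ :=
  (((x 0 : ℂ) + Complex.I * (x 1 : ℂ)) / (‖x‖ : ℂ)) ^ m * f ‖x‖

/-- `R_+ ψ⁺ = R_0 ψ⁺`. -/
def extPsiPlus (u : Plane → Space) (v : ℝ → Space) : Plane → ℂ := ext2 0 (psiPlus u v)

/-- `R_- ψ⁻ = R_2 ψ⁻`. -/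
def extPsiMinus (u : Plane → Space) (v : ℝ → Space) : Plane → ℂ := ext2 2 (psiMinus u v)

end EquivMap

end

/-!
The singular part of the polar Coulomb frame can be removed by a rotation. Rotate `(v̄, w̄)`
about `k` by the angle `θ` and then turn it by `θ` inside the tangent plane. Near the origin, where
`u` is close to `-k`, the two rotations cancel. This gives a frame `e₀, e₁` of the pulled
back tangent bundle (`planeFrame`) which extends across the origin. Its structure equations are
`∂ₘ eₐ = -(∂ₘu ⋅ eₐ) u + Aₘ (J e)ₐ`, with connection form `A = -(1 + ū₃) dθ` (`conn`). In this frame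
`R_+ ψ⁺` is `(∂₀ + i ∂₁) u` and, after the reflection `θ ↦ -θ`, `R_- ψ⁻` is `(∂₀ - i ∂₁) u`
(`extPsiPlus_eq`, `extPsiMinus_reflect_eq`), so the claim compares the second derivatives of the
gradient of `u` with those of its coordinates `∂ₖu ⋅ eₐ`.

Let `M` bound `|∇u|`. The height satisfies `|ū₃'| ≤ |ū'| |k × ū| ≤ 2 M² r` and `ū₃(0) = -1`, hence
`1 + ū₃ ≤ M² r²`, which gives `|A| ≤ 2 M` and `|∂A| ≤ 10 M²` (`norm_conn_le`, `norm_connDeriv_le`).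
Differentiating twice in the frame then costs error terms of the form `M |∂f|` and `M² |f|`
(`MovingFrame.h2Bd_inner`, `MovingFrame.h2Bd_of_inner`). With `P = ‖∇u‖` and `K` the `L²` norm of the
second derivatives, interpolation bounds both `M` and the `L²` norm of the first derivatives by a
multiple of `√(P K)` (`SecondDerivs.interp`), so all errors are at most `C (P + P²) K`, that is, at
most a multiple of `K` that depends only on the energy.

Besides this, four facts are needed:
* the Leibniz rule for weak derivatives, by mollification (`WD.bilin`), and the removability of the
  origin (`WD.of_punctured`);
* interpolation on the plane: if `f` and its second weak derivatives are in `L²`, then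
  `‖∂f‖² ≤ ‖f‖ ‖∂²f‖` and `f` is bounded accordingly (`exists_weakDeriv_of_second`);
* a radial function is weakly differentiable off the origin exactly when its profile is locally
  absolutely continuous (`HasIntDeriv.wd_radial`, `locAC_of_wd_radial`), so that the profile of `u`
  is absolutely continuous and the gradient of `u` is given by `ū'` and `k × ū / r`;
* the Coulomb frame exists: parallel transport along `ū` is a linear differential equation with
  integrable coefficient (`exists_linear_ode`), and its horizontal part converges at infinity because
  `|ū'| |k × ū|` is integrable on `(1, ∞)` for finite energy (`exists_isCoulombFrame`).
-/

noncomputable section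

namespace EquivMap

/-! ### Weak derivatives of first order -/

section WeakDerivative

variable {F G H : Type*} [NormedAddCommGroup F] [NormedSpace ℝ F]
  [NormedAddCommGroup G] [NormedSpace ℝ G] [NormedAddCommGroup H] [NormedSpace ℝ H]

/-- The `i`-th coordinate vector of the plane. -/
abbrev bvec (i : Fin 2) : Plane := EuclideanSpace.single i (1 : ℝ)

/-- The classical partial derivative `∂_i f`. -/
def pd (i : Fin 2) (f : Plane → F) : Plane → F := fun x => fderiv ℝ f x (bvec i)

/-- Test functions on `Ω`: smooth, with compact support contained in `Ω`. -/
structure IsTest (Ω : Set Plane) (φ : Plane → ℝ) : Prop where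
  smooth : ContDiff ℝ ∞ φ
  compact : HasCompactSupport φ
  supp : tsupport φ ⊆ Ω

/-- `g` is the weak partial derivative `∂_i f` on the set `Ω`, which is open in all uses. -/
structure WD (Ω : Set Plane) (i : Fin 2) (f g : Plane → F) : Prop where
  lf : LocallyIntegrableOn f Ω volume
  lg : LocallyIntegrableOn g Ω volume
  parts : ∀ φ : Plane → ℝ, IsTest Ω φ → ∫ x, pd i φ x • f x = -∫ x, φ x • g x

lemma pd_add {f g : Plane → F} {i : Fin 2} {x : Plane} (hf : DifferentiableAt ℝ f x)
    (hg : DifferentiableAt ℝ g x) : pd i (fun y => f y + g y) x = pd i f x + pd i g x := by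
  unfold pd; rw [show (fun y => f y + g y) = f + g from rfl, fderiv_add hf hg]; rfl

lemma pd_smul {b : Plane → ℝ} {f : Plane → F} {i : Fin 2} {x : Plane}
    (hb : DifferentiableAt ℝ b x) (hf : DifferentiableAt ℝ f x) :
    pd i (fun y => b y • f y) x = b x • pd i f x + pd i b x • f x := by
  unfold pd; rw [fderiv_fun_smul hb hf]; simp

lemma pd_mul {b f : Plane → ℝ} {i : Fin 2} {x : Plane}
    (hb : DifferentiableAt ℝ b x) (hf : DifferentiableAt ℝ f x) :
    pd i (fun y => b y * f y) x = b x * pd i f x + pd i b x * f x := pd_smul hb hf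

lemma tsupport_pd_subset (i : Fin 2) (f : Plane → F) : tsupport (pd i f) ⊆ tsupport f := by
  refine closure_minimal (fun x hx => ?_) isClosed_closure
  by_contra h
  refine hx ?_
  have : fderiv ℝ f x = 0 := by
    by_contra h'
    exact h (support_fderiv_subset ℝ h')
  simp [pd, this]

lemma hasCompactSupport_pd {f : Plane → F} (hf : HasCompactSupport f) (i : Fin 2) :
    HasCompactSupport (pd i f) :=
  hf.mono' ((subset_tsupport _).trans (tsupport_pd_subset i f))

lemma contDiff_pd {f : Plane → F} (hf : ContDiff ℝ ∞ f) (i : Fin 2) : ContDiff ℝ ∞ (pd i f) :=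
  (hf.fderiv_right (m := ∞) (by simp)).clm_apply contDiff_const

lemma IsTest.pd {Ω : Set Plane} {φ : Plane → ℝ} (h : IsTest Ω φ) (i : Fin 2) :
    IsTest Ω (pd i φ) :=
  ⟨contDiff_pd h.smooth i, hasCompactSupport_pd h.compact i,
    (tsupport_pd_subset i φ).trans h.supp⟩

lemma IsTest.mono {Ω Ω' : Set Plane} (hΩ : Ω ⊆ Ω') {φ : Plane → ℝ} (h : IsTest Ω φ) :
    IsTest Ω' φ := ⟨h.smooth, h.compact, h.supp.trans hΩ⟩

/-- A function that is smooth on an open set becomes globally smooth after multiplication by a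
test function on that set. -/
lemma IsTest.contDiff_smul {Ω : Set Plane} (hΩ : IsOpen Ω) {φ : Plane → ℝ} (h : IsTest Ω φ)
    {n : ℕ∞} {b : Plane → F} (hb : ContDiffOn ℝ n b Ω) : ContDiff ℝ n (fun x => φ x • b x) := by
  rw [contDiff_iff_contDiffAt]
  intro x
  by_cases hx : x ∈ tsupport φ
  · exact (h.smooth.of_le (by exact_mod_cast le_top)).contDiffAt.smul
      (hb.contDiffAt (hΩ.mem_nhds (h.supp hx)))
  · have h0 : (fun y => φ y • b y) =ᶠ[𝓝 x] fun _ => 0 := by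
      filter_upwards [notMem_tsupport_iff_eventuallyEq.1 hx] with y hy
      simp [hy]
    exact contDiffAt_const.congr_of_eventuallyEq h0

lemma IsTest.mul {Ω : Set Plane} (hΩ : IsOpen Ω) {φ : Plane → ℝ} (h : IsTest Ω φ)
    {b : Plane → ℝ} (hb : ContDiffOn ℝ ∞ b Ω) : IsTest Ω (fun x => φ x * b x) :=
  ⟨h.contDiff_smul hΩ hb, h.compact.mul_right,
    (tsupport_mul_subset_left (f := φ) (g := b)).trans h.supp⟩

lemma integrable_smul_of_tsupport {Ω : Set Plane} {f : Plane → F}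
    (hf : LocallyIntegrableOn f Ω volume) {ψ : Plane → ℝ} (hψ : Continuous ψ)
    (hc : HasCompactSupport ψ) (hs : tsupport ψ ⊆ Ω) : Integrable (fun x => ψ x • f x) volume := by
  have h1 : IntegrableOn f (tsupport ψ) volume := hf.integrableOn_compact_subset hs hc
  have h2 : IntegrableOn (fun x => ψ x • f x) (tsupport ψ) volume :=
    h1.continuousOn_smul hψ.continuousOn hc
  refine (integrableOn_iff_integrable_of_support_subset ?_).1 h2
  intro x hx
  refine subset_tsupport _ ?_
  intro h0
  exact hx (by simp [h0])

lemma IsTest.integrable_smul {Ω : Set Plane} {φ : Plane → ℝ} (h : IsTest Ω φ) {f : Plane → F}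
    (hf : LocallyIntegrableOn f Ω volume) : Integrable (fun x => φ x • f x) volume :=
  integrable_smul_of_tsupport hf h.smooth.continuous h.compact h.supp

lemma locallyIntegrableOn_smul {Ω : Set Plane} (hΩ : IsOpen Ω) {f : Plane → F}
    (hf : LocallyIntegrableOn f Ω volume) {b : Plane → ℝ} (hb : ContinuousOn b Ω) :
    LocallyIntegrableOn (fun x => b x • f x) Ω volume :=
  hf.continuousOn_smul hΩ.isLocallyClosed hb

namespace WD

variable {Ω : Set Plane} {i : Fin 2} {f f' g g' : Plane → F}

lemma mono {Ω' : Set Plane} (hΩ : Ω' ⊆ Ω) (h : WD Ω i f g) : WD Ω' i f g :=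
  ⟨h.lf.mono_set hΩ, h.lg.mono_set hΩ, fun φ hφ => h.parts φ (hφ.mono hΩ)⟩

lemma congr (h : WD Ω i f g) (hf : f =ᵐ[volume] f') (hg : g =ᵐ[volume] g') : WD Ω i f' g' := by
  refine ⟨h.lf.congr (ae_restrict_of_ae hf), h.lg.congr (ae_restrict_of_ae hg), fun φ hφ => ?_⟩
  have h1 : ∫ x, pd i φ x • f' x = ∫ x, pd i φ x • f x :=
    integral_congr_ae (by filter_upwards [hf] with x hx; rw [hx])
  have h2 : ∫ x, φ x • g' x = ∫ x, φ x • g x :=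
    integral_congr_ae (by filter_upwards [hg] with x hx; rw [hx])
  rw [h1, h2, h.parts φ hφ]

lemma add (h : WD Ω i f g) (h' : WD Ω i f' g') :
    WD Ω i (fun x => f x + f' x) (fun x => g x + g' x) := by
  refine ⟨h.lf.add h'.lf, h.lg.add h'.lg, fun φ hφ => ?_⟩
  simp only [smul_add]
  rw [integral_add ((hφ.pd i).integrable_smul h.lf) ((hφ.pd i).integrable_smul h'.lf),
    integral_add (hφ.integrable_smul h.lg) (hφ.integrable_smul h'.lg), h.parts φ hφ,
    h'.parts φ hφ, neg_add]

lemma clm [CompleteSpace F] [CompleteSpace G] (L : F →L[ℝ] G) (h : WD Ω i f g) :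
    WD Ω i (fun x => L (f x)) (fun x => L (g x)) := by
  refine ⟨L.locallyIntegrableOn_comp h.lf, L.locallyIntegrableOn_comp h.lg, fun φ hφ => ?_⟩
  simp only [← map_smul]
  rw [L.integral_comp_comm ((hφ.pd i).integrable_smul h.lf),
    L.integral_comp_comm (hφ.integrable_smul h.lg), h.parts φ hφ, map_neg]

lemma neg (h : WD Ω i f g) : WD Ω i (fun x => -f x) (fun x => -g x) := by
  refine ⟨h.lf.neg, h.lg.neg, fun φ hφ => ?_⟩
  simp only [smul_neg, integral_neg, h.parts φ hφ]

lemma const_smul (c : ℝ) (h : WD Ω i f g) : WD Ω i (fun x => c • f x) (fun x => c • g x) := by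
  refine ⟨h.lf.smul c, h.lg.smul c, fun φ hφ => ?_⟩
  simp only [smul_comm _ c, integral_smul, h.parts φ hφ, smul_neg]

lemma sub (h : WD Ω i f g) (h' : WD Ω i f' g') :
    WD Ω i (fun x => f x - f' x) (fun x => g x - g' x) := by
  simpa only [sub_eq_add_neg] using h.add h'.neg

/-- Leibniz rule for a smooth scalar factor. -/
lemma smooth_smul (hΩ : IsOpen Ω) {b : Plane → ℝ} (hb : ContDiffOn ℝ ∞ b Ω) (h : WD Ω i f g) :
    WD Ω i (fun x => b x • f x) (fun x => b x • g x + pd i b x • f x) := by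
  have hpdc : ContinuousOn (pd i b) Ω :=
    (hb.continuousOn_fderiv_of_isOpen hΩ (by simp)).clm_apply continuousOn_const
  have hl1 := locallyIntegrableOn_smul hΩ h.lf hb.continuousOn
  have hl2 := locallyIntegrableOn_smul hΩ h.lg hb.continuousOn
  have hl3 := locallyIntegrableOn_smul hΩ h.lf hpdc
  refine ⟨hl1, hl2.add hl3, fun φ hφ => ?_⟩
  have key := h.parts _ (hφ.mul hΩ hb)
  have hp : ∀ x, pd i (fun y => φ y * b y) x = φ x * pd i b x + pd i φ x * b x := by
    intro x
    by_cases hx : x ∈ Ω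
    · exact pd_mul (hφ.smooth.differentiable (by simp) x)
        ((hb.contDiffAt (hΩ.mem_nhds hx)).differentiableAt (by simp))
    · have hx' : x ∉ tsupport φ := fun h' => hx (hφ.supp h')
      have h0 := notMem_tsupport_iff_eventuallyEq.1 hx'
      have h1 : (fun y => φ y * b y) =ᶠ[𝓝 x] fun _ => (0 : ℝ) := by
        filter_upwards [h0] with y hy
        simp [hy]
      have h2 : φ =ᶠ[𝓝 x] fun _ => (0 : ℝ) := h0
      simp [pd, h1.fderiv_eq, h2.fderiv_eq, h2.eq_of_nhds]
  simp only [hp, add_smul, mul_smul] at key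
  rw [integral_add (hφ.integrable_smul hl3) ((hφ.pd i).integrable_smul hl1)] at key
  simp only [smul_add]
  rw [integral_add (hφ.integrable_smul hl2) (hφ.integrable_smul hl3), neg_add, ← key]
  abel

lemma unique [CompleteSpace F] (hΩ : IsOpen Ω) (h : WD Ω i f g) (h' : WD Ω i f g') :
    ∀ᵐ x ∂volume, x ∈ Ω → g x = g' x := by
  have := hΩ.ae_eq_zero_of_integral_contDiff_smul_eq_zero (f := fun x => g x - g' x)
    (μ := volume) (h.lg.sub h'.lg) (fun φ h1 h2 h3 => ?_)
  · filter_upwards [this] with x hx hxΩ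
    exact sub_eq_zero.1 (hx hxΩ)
  · have hφ : IsTest Ω φ := ⟨h1, h2, h3⟩
    simp only [smul_sub]
    rw [integral_sub (hφ.integrable_smul h.lg) (hφ.integrable_smul h'.lg)]
    have e1 := h.parts φ hφ
    have e2 := h'.parts φ hφ
    rw [e1] at e2
    rw [neg_inj.1 e2, sub_self]

/-- A `C¹` function has its classical partial derivatives as weak derivatives. -/
lemma of_contDiffOn (hΩ : IsOpen Ω) (hf : ContDiffOn ℝ 1 f Ω) : WD Ω i f (pd i f) := by
  have hpdc : ContinuousOn (pd i f) Ω :=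
    (hf.continuousOn_fderiv_of_isOpen hΩ (by simp)).clm_apply continuousOn_const
  have hl1 := hf.continuousOn.locallyIntegrableOn (μ := volume) hΩ.measurableSet
  have hl2 := hpdc.locallyIntegrableOn (μ := volume) hΩ.measurableSet
  refine ⟨hl1, hl2, fun φ hφ => ?_⟩
  have hd : ∀ x ∈ tsupport φ, DifferentiableAt ℝ f x := fun x hx =>
    (hf.contDiffAt (hΩ.mem_nhds (hφ.supp hx))).differentiableAt (by simp)
  have := integral_smul_fderiv_eq_neg_fderiv_smul_of_integrable (μ := volume) (f := φ) (g := f)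
    (v := bvec i) ((hφ.pd i).integrable_smul hl1) (hφ.integrable_smul hl2)
    (hφ.integrable_smul hl1) (fun x _ => hφ.smooth.differentiable (by simp) x) hd
  simp only [pd] at this ⊢
  rw [this, neg_neg]

end WD

/-- Isolated points are removable for weak derivatives of bounded functions in the plane: cutting
off on the disc of radius `1/n` costs `O(n)` in the gradient and gains `O(n⁻²)` in area. -/
lemma WD.of_punctured {i : Fin 2} {f g : Plane → F} (h : WD {0}ᶜ i f g) {K : ℝ}
    (hf : AEStronglyMeasurable f volume) (hK : ∀ x, ‖f x‖ ≤ K) (hg : LocallyIntegrable g volume) :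
    WD univ i f g := by
  have hfl : LocallyIntegrable f volume :=
    (locallyIntegrable_const K).mono hf (.of_forall fun x => (hK x).trans (le_abs_self K))
  refine ⟨hfl.locallyIntegrableOn _, hg.locallyIntegrableOn _, fun φ hφ => ?_⟩
  let χ : ContDiffBump (0 : Plane) := ⟨1, 2, by norm_num, by norm_num⟩
  have hχs : ContDiff ℝ ∞ (χ : Plane → ℝ) := χ.contDiff
  obtain ⟨D, hD⟩ : ∃ D, ∀ x, ‖pd i χ x‖ ≤ D :=
    (contDiff_pd hχs i).continuous.bounded_above_of_compact_support
      (hasCompactSupport_pd χ.hasCompactSupport i)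
  obtain ⟨Φ, hΦ⟩ : ∃ D, ∀ x, ‖φ x‖ ≤ D :=
    hφ.smooth.continuous.bounded_above_of_compact_support hφ.compact
  have hD0 : 0 ≤ D := (norm_nonneg _).trans (hD 0)
  have hΦ0 : 0 ≤ Φ := (norm_nonneg _).trans (hΦ 0)
  have hK0 : 0 ≤ K := (norm_nonneg _).trans (hK 0)
  -- the cutoffs `1 - χ((n+1) x)`
  set η : ℕ → Plane → ℝ := fun n x => 1 - χ (((n : ℝ) + 1) • x) with hη
  have hηs : ∀ n, ContDiff ℝ ∞ (η n) := fun n =>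
    contDiff_const.sub (hχs.comp (contDiff_const_smul _))
  have hη0 : ∀ n x, 0 ≤ η n x := fun n x => sub_nonneg.2 χ.le_one
  have hη1 : ∀ n x, η n x ≤ 1 := fun n x => sub_le_self _ χ.nonneg
  have hηlim : ∀ x : Plane, x ≠ 0 → ∀ᶠ n : ℕ in atTop, η n x = 1 := by
    intro x hx
    have : Tendsto (fun n : ℕ => ((n : ℝ) + 1) * ‖x‖) atTop atTop :=
      (tendsto_atTop_add_const_right _ _ tendsto_natCast_atTop_atTop).atTop_mul_const
        (norm_pos_iff.2 hx)
    filter_upwards [this.eventually_ge_atTop 2] with n hn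
    have : χ (((n : ℝ) + 1) • x) = 0 := by
      refine χ.zero_of_le_dist ?_
      rw [dist_zero_right, norm_smul, Real.norm_of_nonneg (by positivity)]
      exact hn
    simp [hη, this]
  have hpdη : ∀ n x, pd i (η n) x = -(((n : ℝ) + 1) * pd i χ (((n : ℝ) + 1) • x)) := by
    intro n x
    have h1 : HasFDerivAt (fun y : Plane => ((n : ℝ) + 1) • y)
        (((n : ℝ) + 1) • ContinuousLinearMap.id ℝ Plane) x :=
      (hasFDerivAt_id (𝕜 := ℝ) x).const_smul ((n : ℝ) + 1)
    have h2 := ((hχs.differentiable (by simp) (((n : ℝ) + 1) • x)).hasFDerivAt.comp x h1)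
    have h3 := h2.const_sub 1
    have : fderiv ℝ (η n) x = _ := h3.fderiv
    simp [pd, this]
  have hpdη0 : ∀ (n : ℕ) (x : Plane), 2 < ((n : ℝ) + 1) * ‖x‖ → pd i χ (((n : ℝ) + 1) • x) = 0 := by
    intro n x hx
    have : ((n : ℝ) + 1) • x ∉ tsupport χ := by
      rw [χ.tsupport_eq, Metric.mem_closedBall, dist_zero_right, norm_smul,
        Real.norm_of_nonneg (by positivity)]
      exact not_le.2 hx
    exact image_eq_zero_of_notMem_tsupport fun h' => this (tsupport_pd_subset i _ h')
  have htest : ∀ n, IsTest {0}ᶜ (fun x => φ x * η n x) := by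
    intro n
    refine ⟨hφ.smooth.mul (hηs n), hφ.compact.mul_right, ?_⟩
    intro x hx
    by_contra hx0
    have hx0 : x = 0 := by simpa using hx0
    subst hx0
    have hnear : (fun x => φ x * η n x) =ᶠ[𝓝 0] 0 := by
      have hc : Tendsto (fun x : Plane => ((n : ℝ) + 1) • x) (𝓝 0) (𝓝 0) := by
        have : Continuous (fun x : Plane => ((n : ℝ) + 1) • x) := by fun_prop
        simpa using this.tendsto 0
      filter_upwards [hc.eventually χ.eventuallyEq_one] with x hx
      have : χ (((n : ℝ) + 1) • x) = 1 := hx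
      simp [hη, this]
    exact notMem_tsupport_iff_eventuallyEq.2 hnear hx
  have hparts : ∀ n, ∫ x, η n x • (pd i φ x • f x) + (φ x * pd i (η n) x) • f x
      = -∫ x, η n x • (φ x • g x) := by
    intro n
    have h1 := h.parts _ (htest n)
    have h2 : ∀ x, pd i (fun x => φ x * η n x) x = φ x * pd i (η n) x + pd i φ x * η n x :=
      fun x => pd_mul (hφ.smooth.differentiable (by simp) x)
        ((hηs n).differentiable (by simp) x)
    calc _ = ∫ x, pd i (fun x => φ x * η n x) x • f x :=
          integral_congr_ae (.of_forall fun x => by simp only [h2]; module)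
      _ = _ := h1
      _ = _ := by
          congr 1
          exact integral_congr_ae (.of_forall fun x => by simp only []; module)
  have hi1 : Integrable (fun x => pd i φ x • f x) volume :=
    (hφ.pd i).integrable_smul (hfl.locallyIntegrableOn _)
  have hi2 : Integrable (fun x => φ x • g x) volume :=
    hφ.integrable_smul (hg.locallyIntegrableOn _)
  have hae : ∀ᵐ x : Plane ∂volume, x ≠ 0 := by
    simp [ae_iff]
  have hDCT : ∀ w : Plane → F, Integrable w volume →
      Tendsto (fun n => ∫ x, η n x • w x) atTop (𝓝 (∫ x, w x)) := by
    intro w hw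
    refine tendsto_integral_of_dominated_convergence (fun x => ‖w x‖)
      (fun n => (hηs n).continuous.aestronglyMeasurable.smul hw.aestronglyMeasurable) hw.norm
      (fun n => .of_forall fun x => ?_) ?_
    · rw [norm_smul, Real.norm_of_nonneg (hη0 n x)]
      exact mul_le_of_le_one_left (norm_nonneg _) (hη1 n x)
    · filter_upwards [hae] with x hx
      refine tendsto_const_nhds.congr' ?_
      filter_upwards [hηlim x hx] with n hn
      simp [hn]
  have hi3 : ∀ n, Integrable (fun x => η n x • (pd i φ x • f x)) volume := fun n =>
    hi1.bdd_smul 1 (hηs n).continuous.aestronglyMeasurable (.of_forall fun x => by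
      rw [Real.norm_of_nonneg (hη0 n x)]; exact hη1 n x)
  -- the error term
  have hb : ∀ n x, ‖(φ x * pd i (η n) x) • f x‖ ≤
      (Metric.closedBall (0 : Plane) (2 / ((n : ℝ) + 1))).indicator
        (fun _ => Φ * (((n : ℝ) + 1) * D) * K) x := by
    intro n x
    have hn : (0 : ℝ) < (n : ℝ) + 1 := by positivity
    by_cases hx : x ∈ Metric.closedBall (0 : Plane) (2 / ((n : ℝ) + 1))
    · rw [indicator_of_mem hx, norm_smul, norm_mul, hpdη, norm_neg, norm_mul,
        Real.norm_of_nonneg hn.le]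
      gcongr
      · exact hΦ x
      · exact hD _
      · exact hK x
    · rw [indicator_of_notMem hx]
      rw [mem_closedBall_zero_iff, not_le, div_lt_iff₀ hn, mul_comm] at hx
      simp [hpdη, hpdη0 n x hx]
  have herr : Tendsto (fun n => ∫ x, (φ x * pd i (η n) x) • f x) atTop (𝓝 0) := by
    have hlim : Tendsto (fun n : ℕ => Φ * D * K * (4 * Real.pi) * (1 / ((n : ℝ) + 1))) atTop
        (𝓝 0) := by
      simpa using tendsto_one_div_add_atTop_nhds_zero_nat.const_mul (Φ * D * K * (4 * Real.pi))
    refine squeeze_zero_norm (fun n => ?_) hlim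
    have hn : (0 : ℝ) < (n : ℝ) + 1 := by positivity
    have hint : Integrable ((Metric.closedBall (0 : Plane) (2 / ((n : ℝ) + 1))).indicator
        (fun _ => Φ * (((n : ℝ) + 1) * D) * K)) volume :=
      (integrable_indicator_iff Metric.isClosed_closedBall.measurableSet).2
        (integrableOn_const measure_closedBall_lt_top.ne)
    refine (norm_integral_le_of_norm_le hint (.of_forall (hb n))).trans_eq ?_
    rw [integral_indicator Metric.isClosed_closedBall.measurableSet, setIntegral_const,
      Measure.real, EuclideanSpace.volume_closedBall_fin_two, ENNReal.toReal_mul,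
      ENNReal.toReal_pow, ENNReal.toReal_ofReal (by positivity)]
    simp only [smul_eq_mul, ENNReal.toReal_ofReal Real.pi_nonneg]
    field_simp
    ring
  have hi4 : ∀ n, Integrable (fun x => (φ x * pd i (η n) x) • f x) volume := fun n =>
    integrable_smul_of_tsupport (Ω := univ) (hfl.locallyIntegrableOn _)
      (hφ.smooth.continuous.mul (contDiff_pd (hηs n) i).continuous) hφ.compact.mul_right
      (subset_univ _)
  have hL : Tendsto (fun n => ∫ x, η n x • (pd i φ x • f x) + (φ x * pd i (η n) x) • f x) atTop
      (𝓝 (∫ x, pd i φ x • f x)) := by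
    have := (hDCT _ hi1).add herr
    rw [add_zero] at this
    refine this.congr fun n => ?_
    rw [integral_add (hi3 n) (hi4 n)]
  have hR : Tendsto (fun n => -∫ x, η n x • (φ x • g x)) atTop (𝓝 (-∫ x, φ x • g x)) :=
    (hDCT _ hi2).neg
  simp only [hparts] at hL
  exact tendsto_nhds_unique hL hR

/-! ### Iterated weak derivatives -/

lemma iteratedFDeriv_bvec_succ {k : ℕ} (w : Fin (k + 1) → Fin 2) {φ : Plane → ℝ}
    (hφ : ContDiff ℝ ∞ φ) (x : Plane) :
    (iteratedFDeriv ℝ (k + 1) φ x fun j => bvec (w j)) =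
      pd (w 0) (fun y => iteratedFDeriv ℝ k φ y fun j => bvec (Fin.tail w j)) x := by
  rw [iteratedFDeriv_succ_apply_left]
  have hd : DifferentiableAt ℝ (iteratedFDeriv ℝ k φ) x :=
    (hφ.differentiable_iteratedFDeriv (m := k) (by exact_mod_cast WithTop.coe_lt_top k)) x
  unfold pd
  rw [fderiv_continuousMultilinear_apply_const_apply hd]
  rfl

lemma isTest_iteratedFDeriv {k : ℕ} (w : Fin k → Fin 2) {φ : Plane → ℝ} (hφ : IsTest univ φ) :
    IsTest univ (fun y => iteratedFDeriv ℝ k φ y fun j => bvec (w j)) := by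
  induction k with
  | zero => simpa using hφ
  | succ k ih =>
    have : (fun y => iteratedFDeriv ℝ (k + 1) φ y fun j => bvec (w j)) =
        pd (w 0) (fun y => iteratedFDeriv ℝ k φ y fun j => bvec (Fin.tail w j)) :=
      funext fun x => iteratedFDeriv_bvec_succ w hφ.smooth x
    rw [this]
    exact (ih _).pd _

lemma hasWeakDeriv_succ_iff {k : ℕ} {w : Fin (k + 1) → Fin 2} {f g h : Plane → F}
    (hg : WD univ (w 0) f g) : HasWeakDeriv w f h ↔ HasWeakDeriv (Fin.tail w) g h := by
  have key : ∀ φ : Plane → ℝ, IsTest univ φ →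
      ∫ x, (iteratedFDeriv ℝ (k + 1) φ x fun j => bvec (w j)) • f x =
        -∫ x, (iteratedFDeriv ℝ k φ x fun j => bvec (Fin.tail w j)) • g x := by
    intro φ hφ
    rw [← hg.parts _ (isTest_iteratedFDeriv _ hφ)]
    simp only [iteratedFDeriv_bvec_succ w hφ.smooth]
  have hf := locallyIntegrableOn_univ.1 hg.lf
  have hg' := locallyIntegrableOn_univ.1 hg.lg
  constructor
  · rintro ⟨-, h2, h3⟩
    refine ⟨hg', h2, fun φ h4 h5 => ?_⟩
    have e := h3 φ h4 h5
    rw [key φ ⟨h4, h5, subset_univ _⟩, pow_succ, mul_neg_one, neg_smul] at e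
    exact neg_inj.1 e
  · rintro ⟨-, h2, h3⟩
    refine ⟨hf, h2, fun φ h4 h5 => ?_⟩
    rw [key φ ⟨h4, h5, subset_univ _⟩, pow_succ, mul_neg_one, neg_smul]
    exact congrArg _ (h3 φ h4 h5)

lemma hasWeakDeriv_zero_iff [CompleteSpace F] {w : Fin 0 → Fin 2} {f g : Plane → F} :
    HasWeakDeriv w f g ↔ LocallyIntegrable f volume ∧ f =ᵐ[volume] g := by
  constructor
  · rintro ⟨h1, h2, h3⟩
    refine ⟨h1, ae_eq_of_integral_contDiff_smul_eq h1 h2 fun φ h4 h5 => ?_⟩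
    simpa using h3 φ h4 h5
  · rintro ⟨h1, h2⟩
    refine ⟨h1, h1.congr h2, fun φ h4 h5 => ?_⟩
    simp only [iteratedFDeriv_zero_apply, pow_zero, one_smul]
    exact integral_congr_ae (by filter_upwards [h2] with x hx; rw [hx])

lemma hasWeakDeriv_one_iff {w : Fin 1 → Fin 2} {f g : Plane → F} :
    HasWeakDeriv w f g ↔ WD univ (w 0) f g := by
  constructor
  · rintro ⟨h1, h2, h3⟩
    refine ⟨h1.locallyIntegrableOn _, h2.locallyIntegrableOn _, fun φ hφ => ?_⟩
    have := h3 φ hφ.smooth hφ.compact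
    simp only [iteratedFDeriv_bvec_succ w hφ.smooth] at this
    simpa using this
  · intro h
    refine ⟨locallyIntegrableOn_univ.1 h.lf, locallyIntegrableOn_univ.1 h.lg, fun φ h4 h5 => ?_⟩
    have := h.parts φ ⟨h4, h5, subset_univ _⟩
    simp only [iteratedFDeriv_bvec_succ w h4]
    simpa using this

lemma HasWeakDeriv.unique [CompleteSpace F] {k : ℕ} {w : Fin k → Fin 2} {f g h : Plane → F}
    (hg : HasWeakDeriv w f g) (hh : HasWeakDeriv w f h) : g =ᵐ[volume] h := by
  refine ae_eq_of_integral_contDiff_smul_eq hg.2.1 hh.2.1 fun φ h4 h5 => ?_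
  have := (hg.2.2 φ h4 h5).symm.trans (hh.2.2 φ h4 h5)
  exact (isUnit_one.neg.pow k).smul_left_cancel.1 this

lemma HasWeakDeriv.weakDerivNorm_eq [CompleteSpace F] {k : ℕ} {w : Fin k → Fin 2}
    {f g : Plane → F} (hg : HasWeakDeriv w f g) : weakDerivNorm w f = eLpNorm g 2 volume := by
  refine le_antisymm (iInf₂_le g hg) (le_iInf₂ fun h hh => ?_)
  rw [eLpNorm_congr_ae (hg.unique hh)]

end WeakDerivative

/-! ### Mollification -/

section Mollification

variable {F G H : Type*} [NormedAddCommGroup F] [NormedSpace ℝ F]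
  [NormedAddCommGroup G] [NormedSpace ℝ G] [NormedAddCommGroup H] [NormedSpace ℝ H]

lemma eLpNorm_two_sq {α : Type*} {m : MeasurableSpace α} {μ : Measure α} {E : Type*}
    [NormedAddCommGroup E] (f : α → E) : eLpNorm f 2 μ ^ 2 = ∫⁻ x, ‖f x‖ₑ ^ 2 ∂μ := by
  rw [eLpNorm_eq_lintegral_rpow_enorm_toReal (by norm_num) (by norm_num)]
  simp only [ENNReal.toReal_ofNat, ENNReal.rpow_ofNat]
  rw [← ENNReal.rpow_natCast, ← ENNReal.rpow_mul]
  norm_num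

/-- Minkowski's integral inequality in `L²`, for a weighted superposition of functions with a
common bound. -/
lemma eLpNorm_integral_smul_le {w : Plane → ℝ} {K : Plane → Plane → F} {B : ℝ≥0∞}
    (hw : AEStronglyMeasurable w volume)
    (hK : AEStronglyMeasurable (Function.uncurry K) (volume.prod volume))
    (hB : ∀ t, w t ≠ 0 → eLpNorm (K t) 2 volume ≤ B) :
    eLpNorm (fun x => ∫ t, w t • K t x) 2 volume ≤ (∫⁻ t, ‖w t‖ₑ) * B := by
  refine (ENNReal.pow_le_pow_left_iff two_ne_zero).1 ?_
  rw [eLpNorm_two_sq]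
  set W := ∫⁻ t, ‖w t‖ₑ with hW
  have hKs : AEStronglyMeasurable (fun p : Plane × Plane => K p.2 p.1) (volume.prod volume) :=
    hK.prod_swap
  have hKx : ∀ᵐ x : Plane, AEStronglyMeasurable (fun t => K t x) volume := hKs.prodMk_left
  have step : ∀ᵐ x : Plane, ‖∫ t, w t • K t x‖ₑ ^ 2 ≤ W * ∫⁻ t, ‖w t‖ₑ * ‖K t x‖ₑ ^ 2 := by
    filter_upwards [hKx] with x hx
    have h1 : ‖∫ t, w t • K t x‖ₑ ≤
        ∫⁻ t, ‖w t‖ₑ ^ (1 / 2 : ℝ) * (‖w t‖ₑ ^ (1 / 2 : ℝ) * ‖K t x‖ₑ) := by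
      refine (enorm_integral_le_lintegral_enorm _).trans_eq (lintegral_congr fun t => ?_)
      rw [enorm_smul, ← mul_assoc, ← ENNReal.rpow_add_of_nonneg _ _ (by norm_num) (by norm_num)]
      norm_num
    have h2 := ENNReal.lintegral_mul_le_Lp_mul_Lq volume Real.HolderConjugate.two_two
      (f := fun t => ‖w t‖ₑ ^ (1 / 2 : ℝ)) (g := fun t => ‖w t‖ₑ ^ (1 / 2 : ℝ) * ‖K t x‖ₑ)
      (hw.enorm.pow_const _) ((hw.enorm.pow_const _).mul hx.enorm)
    refine (pow_le_pow_left' (h1.trans h2) 2).trans_eq ?_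
    rw [mul_pow, ← ENNReal.rpow_natCast, ← ENNReal.rpow_natCast, ← ENNReal.rpow_mul,
      ← ENNReal.rpow_mul]
    norm_num
    congr 1
    · refine lintegral_congr fun t => ?_
      rw [← ENNReal.rpow_natCast, ← ENNReal.rpow_mul]; norm_num
    · refine lintegral_congr fun t => ?_
      rw [mul_pow, ← ENNReal.rpow_natCast (_ ^ (_ : ℝ)), ← ENNReal.rpow_mul]; norm_num
  have hm : AEMeasurable (Function.uncurry fun x t : Plane => ‖w t‖ₑ * ‖K t x‖ₑ ^ 2)
      (volume.prod volume) :=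
    (hw.enorm.comp_quasiMeasurePreserving Measure.quasiMeasurePreserving_snd).mul
      (hKs.enorm.pow_const 2)
  calc ∫⁻ x, ‖∫ t, w t • K t x‖ₑ ^ 2 ≤ ∫⁻ x, W * ∫⁻ t, ‖w t‖ₑ * ‖K t x‖ₑ ^ 2 :=
        lintegral_mono_ae step
    _ = W * ∫⁻ x, ∫⁻ t, ‖w t‖ₑ * ‖K t x‖ₑ ^ 2 :=
        lintegral_const_mul'' _ hm.lintegral_prod_right'
    _ = W * ∫⁻ t, ∫⁻ x, ‖w t‖ₑ * ‖K t x‖ₑ ^ 2 := by rw [lintegral_lintegral_swap hm]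
    _ ≤ W * ∫⁻ t, ‖w t‖ₑ * B ^ 2 := by
        gcongr with t
        rw [lintegral_const_mul' _ _ (by simp)]
        by_cases ht : w t = 0
        · simp [ht]
        · rw [← eLpNorm_two_sq]
          gcongr
          exact hB t ht
    _ = (W * B) ^ 2 := by
        rw [lintegral_mul_const'' _ hw.enorm]
        ring

lemma aestronglyMeasurable_sub_snd {E : Type*} [NormedAddCommGroup E] {f : Plane → E}
    (hf : AEStronglyMeasurable f volume) :
    AEStronglyMeasurable (Function.uncurry fun t x : Plane => f (x - t))
      (volume.prod volume) := by
  have h1 : AEStronglyMeasurable (fun p : Plane × Plane => f (p.1 - p.2)) (volume.prod volume) :=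
    hf.comp_quasiMeasurePreserving (quasiMeasurePreserving_sub volume volume)
  exact h1.prod_swap

/-- Translations act continuously on `L²`. -/
lemma exists_translation_modulus {E : Type*} [NormedAddCommGroup E] {f : Plane → E}
    (hf : MemLp f 2 volume) {ε : ℝ≥0∞} (hε : 0 < ε) : ∃ δ > 0, ∀ t : Plane, ‖t‖ < δ →
      eLpNorm (fun x => f (x - t) - f x) 2 volume ≤ ε := by
  have : Fact ((2 : ℝ≥0∞) ≠ ⊤) := ⟨by norm_num⟩
  have hc : Continuous (fun t : Plane => (DomAddAct.mk (-t)) +ᵥ hf.toLp f) :=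
    ((DomAddAct.continuous_mk.comp continuous_neg).vadd continuous_const)
  have h0 := hc.tendsto 0
  have h1 : ∀ᶠ t : Plane in 𝓝 0, edist ((DomAddAct.mk (-t)) +ᵥ hf.toLp f)
      ((DomAddAct.mk (-(0 : Plane))) +ᵥ hf.toLp f) < ε := h0.eventually (Metric.eball_mem_nhds _ hε)
  obtain ⟨δ, hδ, h2⟩ := Metric.eventually_nhds_iff.1 h1
  refine ⟨δ, hδ, fun t ht => ?_⟩
  have h3 := h2 (y := t) (by simpa using ht)
  rw [DomAddAct.mk_vadd_toLp, DomAddAct.mk_vadd_toLp, Lp.edist_toLp_toLp] at h3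
  refine le_of_eq_of_le (eLpNorm_congr_ae (.of_forall fun x => ?_)) h3.le
  simp [sub_eq_neg_add]

/-- Convolution of a scalar kernel with a function on the plane. -/
def conv (ρ : Plane → ℝ) (f : Plane → F) : Plane → F := fun x => ∫ t, ρ t • f (x - t)

lemma conv_eq (ρ : Plane → ℝ) (f : Plane → F) :
    conv ρ f = convolution ρ f (ContinuousLinearMap.lsmul ℝ ℝ) volume := rfl

lemma conv_apply_swap (ρ : Plane → ℝ) (f : Plane → F) (x : Plane) :
    conv ρ f x = ∫ t, ρ (x - t) • f t := by
  rw [conv_eq, convolution_eq_swap]; rfl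

lemma eLpNorm_conv_le {ρ : Plane → ℝ} {f : Plane → F} (hρ : AEStronglyMeasurable ρ volume)
    (hf : AEStronglyMeasurable f volume) :
    eLpNorm (conv ρ f) 2 volume ≤ (∫⁻ t, ‖ρ t‖ₑ) * eLpNorm f 2 volume := by
  refine eLpNorm_integral_smul_le (K := fun t x => f (x - t)) hρ
    (aestronglyMeasurable_sub_snd hf) fun t _ => ?_
  exact (eLpNorm_comp_measurePreserving hf (measurePreserving_sub_right volume t)).le

lemma contDiff_conv {ρ : Plane → ℝ} {f : Plane → F} (hρ : ContDiff ℝ ∞ ρ)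
    (hc : HasCompactSupport ρ) (hf : LocallyIntegrable f volume) : ContDiff ℝ ∞ (conv ρ f) :=
  hc.contDiff_convolution_left (n := ⊤) (ContinuousLinearMap.lsmul ℝ ℝ) hρ hf

lemma pd_conv {ρ : Plane → ℝ} {f : Plane → F} (hρ : ContDiff ℝ ∞ ρ)
    (hc : HasCompactSupport ρ) (hf : LocallyIntegrable f volume) (i : Fin 2) :
    pd i (conv ρ f) = conv (pd i ρ) f := by
  ext x
  have h := hc.hasFDerivAt_convolution_left (ContinuousLinearMap.lsmul ℝ ℝ)
    (hρ.of_le (by simp)) hf x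
  rw [← conv_eq] at h
  rw [pd, h.fderiv]
  have hint := (hc.fderiv ℝ).convolutionExists_left
    (ContinuousLinearMap.precompL Plane (ContinuousLinearMap.lsmul ℝ ℝ (E := F)))
    (hρ.continuous_fderiv (by simp)) hf x
  rw [convolution_def]
  exact ContinuousLinearMap.integral_apply hint (bvec i)

/-- A convolution with a test kernel commutes with weak differentiation. -/
lemma conv_pd_eq {ρ : Plane → ℝ} {f g : Plane → F} (hρ : ContDiff ℝ ∞ ρ)
    (hc : HasCompactSupport ρ) {i : Fin 2} (h : WD univ i f g) : conv (pd i ρ) f = conv ρ g := by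
  ext x
  rw [conv_apply_swap, conv_apply_swap]
  have e : (fun t : Plane => ρ (x - t)) = ρ ∘ (Homeomorph.subLeft x) := rfl
  have ht : IsTest univ (fun t => ρ (x - t)) :=
    ⟨hρ.comp (contDiff_const.sub contDiff_id), by
      rw [e]; exact hc.comp_homeomorph _, subset_univ _⟩
  have := h.parts _ ht
  have hp : ∀ t, pd i (fun t => ρ (x - t)) t = -pd i ρ (x - t) := by
    intro t
    have h1 : HasFDerivAt (fun y : Plane => x - y) (-ContinuousLinearMap.id ℝ Plane) t :=
      (hasFDerivAt_id (𝕜 := ℝ) t).const_sub x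
    have h2 := ((hρ.differentiable (by simp) (x - t)).hasFDerivAt.comp t h1)
    have h3 : fderiv ℝ (fun t => ρ (x - t)) t = _ := h2.fderiv
    simp [pd, h3]
  simp only [hp, neg_smul, integral_neg, neg_inj] at this
  exact this

/-- A standard sequence of smooth kernels concentrating at the origin. -/
def bump (n : ℕ) : ContDiffBump (0 : Plane) :=
  ⟨1 / (2 * ((n : ℝ) + 1)), 1 / ((n : ℝ) + 1), by positivity, by
    rw [div_lt_div_iff₀ (by positivity) (by positivity)]
    have : (0 : ℝ) < (n : ℝ) + 1 := by positivity
    linarith⟩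

/-- The `L¹`-normalized kernel at scale `1/(n+1)`. -/
def kern (n : ℕ) : Plane → ℝ := (bump n).normed volume

/-- The standard mollification at scale `1/(n+1)`. -/
def moll (n : ℕ) (f : Plane → F) : Plane → F := conv (kern n) f

lemma contDiff_kern (n : ℕ) : ContDiff ℝ ∞ (kern n) := (bump n).contDiff_normed

lemma hasCompactSupport_kern (n : ℕ) : HasCompactSupport (kern n) :=
  (bump n).hasCompactSupport_normed

lemma lintegral_kern (n : ℕ) : ∫⁻ t, ‖kern n t‖ₑ = 1 := by
  have hi : Integrable (kern n) volume := (bump n).integrable_normed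
  rw [← ofReal_integral_norm_eq_lintegral_enorm hi]
  have : ∀ t, ‖kern n t‖ = kern n t := fun t =>
    Real.norm_of_nonneg ((bump n).nonneg_normed t)
  have h2 : ∫ t, ‖kern n t‖ = 1 := by
    rw [← (bump n).integral_normed (μ := volume)]
    exact integral_congr_ae (.of_forall this)
  rw [h2, ENNReal.ofReal_one]

lemma memLp_moll {f : Plane → F} (hf : MemLp f 2 volume) (n : ℕ) : MemLp (moll n f) 2 volume := by
  refine ⟨(contDiff_conv (contDiff_kern n) (hasCompactSupport_kern n)
    (hf.locallyIntegrable (by norm_num))).continuous.aestronglyMeasurable, ?_⟩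
  refine (eLpNorm_conv_le (contDiff_kern n).continuous.aestronglyMeasurable hf.1).trans_lt ?_
  rw [lintegral_kern, one_mul]
  exact hf.2

lemma tendsto_moll [CompleteSpace F] {f : Plane → F} (hf : MemLp f 2 volume) :
    Tendsto (fun n => eLpNorm (moll n f - f) 2 volume) atTop (𝓝 0) := by
  rw [ENNReal.tendsto_atTop_zero]
  intro ε hε
  obtain ⟨δ, hδ, h⟩ := exists_translation_modulus hf hε
  obtain ⟨N, hN⟩ := exists_nat_one_div_lt hδ
  refine ⟨N, fun n hn => ?_⟩
  have hK : AEStronglyMeasurable (Function.uncurry fun t x : Plane => f (x - t) - f x)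
      (volume.prod volume) :=
    (aestronglyMeasurable_sub_snd hf.1).sub
      (hf.1.comp_quasiMeasurePreserving Measure.quasiMeasurePreserving_snd)
  have key := eLpNorm_integral_smul_le (w := kern n) (B := ε)
    (contDiff_kern n).continuous.aestronglyMeasurable hK (fun t ht => h t ?_)
  · rw [lintegral_kern, one_mul] at key
    refine le_of_eq_of_le (eLpNorm_congr_ae (.of_forall fun x => ?_)) key
    have hi : Integrable (fun t => kern n t • f (x - t)) volume := by
      have := (hasCompactSupport_kern n).convolutionExists_left (ContinuousLinearMap.lsmul ℝ ℝ)
        (contDiff_kern n).continuous (hf.locallyIntegrable (by norm_num)) x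
      exact this
    have hi2 : Integrable (fun t => kern n t • f x) volume :=
      (bump n).integrable_normed.smul_const _
    simp only [smul_sub, Pi.sub_apply]
    rw [integral_sub hi hi2, integral_smul_const]
    have : ∫ t, kern n t = 1 := (bump n).integral_normed
    rw [this, one_smul]; rfl
  · have : t ∈ Function.support ((bump n).normed volume) := ht
    rw [(bump n).support_normed_eq, mem_ball_zero_iff] at this
    refine this.trans (lt_of_le_of_lt ?_ hN)
    show 1 / ((n : ℝ) + 1) ≤ 1 / ((N : ℝ) + 1)
    gcongr

/-! ### The Leibniz rule for weak derivatives -/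

lemma eLpNorm_bilin_le {α : Type*} {m : MeasurableSpace α} {μ : Measure α} (B : F →L[ℝ] G →L[ℝ] H)
    {a : α → F} {b : α → G} (ha : AEStronglyMeasurable a μ) (hb : AEStronglyMeasurable b μ) :
    eLpNorm (fun x => B (a x) (b x)) 1 μ ≤ ‖B‖₊ * eLpNorm a 2 μ * eLpNorm b 2 μ :=
  eLpNorm_le_eLpNorm_mul_eLpNorm_of_nnnorm ha hb (fun y z => B y z) ‖B‖₊
    (.of_forall fun x => B.le_opNorm₂ (a x) (b x))

lemma aestronglyMeasurable_bilin {α : Type*} {m : MeasurableSpace α} {μ : Measure α}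
    (B : F →L[ℝ] G →L[ℝ] H) {a : α → F} {b : α → G} (ha : AEStronglyMeasurable a μ)
    (hb : AEStronglyMeasurable b μ) : AEStronglyMeasurable (fun x => B (a x) (b x)) μ :=
  B.aestronglyMeasurable_comp₂ ha hb

lemma integrable_bilin {α : Type*} {m : MeasurableSpace α} {μ : Measure α}
    (B : F →L[ℝ] G →L[ℝ] H) {a : α → F} {b : α → G} (ha : MemLp a 2 μ) (hb : MemLp b 2 μ) :
    Integrable (fun x => B (a x) (b x)) μ := by
  rw [← memLp_one_iff_integrable]
  exact ⟨aestronglyMeasurable_bilin B ha.1 hb.1, (eLpNorm_bilin_le B ha.1 hb.1).trans_lt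
    (ENNReal.mul_lt_top (ENNReal.mul_lt_top (by simp) ha.2) hb.2)⟩

lemma eLpNorm_le_of_sub {α : Type*} {m : MeasurableSpace α} {μ : Measure α} {E : Type*}
    [NormedAddCommGroup E] {a a' : α → E}
    (ha : AEStronglyMeasurable a μ) (ha' : AEStronglyMeasurable a' μ) :
    eLpNorm a' 2 μ ≤ eLpNorm (a' - a) 2 μ + eLpNorm a 2 μ := by
  have := eLpNorm_add_le (ha'.sub ha) ha (p := 2) (by norm_num)
  simpa using this

/-- Products of `L²`-convergent sequences converge when integrated against bounded functions. -/
lemma tendsto_integral_bilin (B : F →L[ℝ] G →L[ℝ] H) {a : Plane → F} {b : Plane → G}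
    {a' : ℕ → Plane → F} {b' : ℕ → Plane → G} (ha : MemLp a 2 volume) (hb : MemLp b 2 volume)
    (ha' : ∀ n, MemLp (a' n) 2 volume) (hb' : ∀ n, MemLp (b' n) 2 volume)
    (hla : Tendsto (fun n => eLpNorm (a' n - a) 2 volume) atTop (𝓝 0))
    (hlb : Tendsto (fun n => eLpNorm (b' n - b) 2 volume) atTop (𝓝 0))
    {φ : Plane → ℝ} (hφ : Continuous φ) (hc : HasCompactSupport φ) :
    Tendsto (fun n => ∫ x, φ x • B (a' n x) (b' n x)) atTop (𝓝 (∫ x, φ x • B (a x) (b x))) := by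
  obtain ⟨C, hC⟩ := hφ.bounded_above_of_compact_support hc
  have hi : ∀ {p : Plane → F} {q : Plane → G}, MemLp p 2 volume → MemLp q 2 volume →
      Integrable (fun x => φ x • B (p x) (q x)) volume := fun hp hq =>
    (integrable_bilin B hp hq).bdd_smul C hφ.aestronglyMeasurable (.of_forall hC)
  refine tendsto_integral_of_L1 _ (hi ha hb).aestronglyMeasurable
    (.of_forall fun n => hi (ha' n) (hb' n)) ?_
  set A := eLpNorm a 2 volume
  set Bb := eLpNorm b 2 volume
  have hbound : ∀ n, ∫⁻ x, ‖φ x • B (a' n x) (b' n x) - φ x • B (a x) (b x)‖ₑ ≤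
      ENNReal.ofReal C * (‖B‖₊ * eLpNorm (a' n - a) 2 volume * (eLpNorm (b' n - b) 2 volume + Bb)
        + ‖B‖₊ * A * eLpNorm (b' n - b) 2 volume) := by
    intro n
    have m1 := aestronglyMeasurable_bilin B ((ha' n).1.sub ha.1) (hb' n).1
    have m2 := aestronglyMeasurable_bilin B ha.1 ((hb' n).1.sub hb.1)
    calc ∫⁻ x, ‖φ x • B (a' n x) (b' n x) - φ x • B (a x) (b x)‖ₑ
        ≤ ∫⁻ x, ENNReal.ofReal C *
          (‖B ((a' n - a) x) (b' n x)‖ₑ + ‖B (a x) ((b' n - b) x)‖ₑ) := by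
          refine lintegral_mono fun x => ?_
          rw [← smul_sub, enorm_smul]
          gcongr
          · rw [← ofReal_norm]
            exact ENNReal.ofReal_le_ofReal (hC x)
          · refine le_trans (le_of_eq ?_) (enorm_add_le _ _)
            simp
      _ = ENNReal.ofReal C * (eLpNorm (fun x => B ((a' n - a) x) (b' n x)) 1 volume +
            eLpNorm (fun x => B (a x) ((b' n - b) x)) 1 volume) := by
          rw [lintegral_const_mul' _ _ (by simp), lintegral_add_left' m1.enorm,
            eLpNorm_one_eq_lintegral_enorm, eLpNorm_one_eq_lintegral_enorm]
      _ ≤ _ := by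
          gcongr
          · refine (eLpNorm_bilin_le B ((ha' n).1.sub ha.1) (hb' n).1).trans ?_
            gcongr
            exact eLpNorm_le_of_sub hb.1 (hb' n).1
          · exact eLpNorm_bilin_le B ha.1 ((hb' n).1.sub hb.1)
  refine tendsto_of_tendsto_of_tendsto_of_le_of_le tendsto_const_nhds ?_ (fun n => zero_le)
    hbound
  have hBt : Bb ≠ ⊤ := hb.2.ne
  have hAt : A ≠ ⊤ := ha.2.ne
  have e1 : Tendsto (fun n => (‖B‖₊ : ℝ≥0∞) * eLpNorm (a' n - a) 2 volume) atTop (𝓝 0) := by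
    simpa using ENNReal.Tendsto.const_mul hla (.inr (by simp))
  have e2 : Tendsto (fun n => eLpNorm (b' n - b) 2 volume + Bb) atTop (𝓝 Bb) := by
    simpa using hlb.add (tendsto_const_nhds (x := Bb))
  have e3 : Tendsto (fun n => (‖B‖₊ : ℝ≥0∞) * A * eLpNorm (b' n - b) 2 volume) atTop (𝓝 0) := by
    simpa using ENNReal.Tendsto.const_mul hlb (.inr (ENNReal.mul_ne_top (by simp) hAt))
  have e4 := (ENNReal.Tendsto.mul e1 (.inr hBt) e2 (.inr (by simp))).add e3
  have e5 := ENNReal.Tendsto.const_mul (a := ENNReal.ofReal C) e4 (.inr (by simp))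
  simpa using e5

lemma pd_moll {f g : Plane → F} {i : Fin 2} (h : WD univ i f g) (n : ℕ) :
    pd i (moll n f) = moll n g := by
  rw [moll, pd_conv (contDiff_kern n) (hasCompactSupport_kern n) (locallyIntegrableOn_univ.1 h.lf),
    conv_pd_eq (contDiff_kern n) (hasCompactSupport_kern n) h, moll]

lemma contDiff_moll {f : Plane → F} (h : LocallyIntegrable f volume) (n : ℕ) :
    ContDiff ℝ ∞ (moll n f) := contDiff_conv (contDiff_kern n) (hasCompactSupport_kern n) h

/-- Leibniz rule for square-integrable functions with square-integrable weak derivatives, by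
mollifying both factors. -/
lemma WD.bilin_of_memLp [CompleteSpace F] [CompleteSpace G] (B : F →L[ℝ] G →L[ℝ] H) {i : Fin 2}
    {f f' : Plane → F} {g g' : Plane → G} (hf : WD univ i f f') (hg : WD univ i g g')
    (mf : MemLp f 2 volume) (mf' : MemLp f' 2 volume) (mg : MemLp g 2 volume)
    (mg' : MemLp g' 2 volume) :
    WD univ i (fun x => B (f x) (g x)) (fun x => B (f' x) (g x) + B (f x) (g' x)) := by
  have i1 := integrable_bilin B mf' mg
  have i2 := integrable_bilin B mf mg'
  refine ⟨(integrable_bilin B mf mg).locallyIntegrable.locallyIntegrableOn _,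
    (i1.add i2).locallyIntegrable.locallyIntegrableOn _, fun φ hφ => ?_⟩
  have sf := contDiff_moll (locallyIntegrableOn_univ.1 hf.lf)
  have sg := contDiff_moll (locallyIntegrableOn_univ.1 hg.lf)
  have hn : ∀ n, ∫ x, pd i φ x • B (moll n f x) (moll n g x) =
      -(∫ x, φ x • B (moll n f' x) (moll n g x)) - ∫ x, φ x • B (moll n f x) (moll n g' x) := by
    intro n
    have hs : ContDiff ℝ 1 (fun x => B (moll n f x) (moll n g x)) :=
      (B.isBoundedBilinearMap.contDiff.comp ((sf n).prodMk (sg n))).of_le (by simp)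
    have h1 := (WD.of_contDiffOn (i := i) isOpen_univ hs.contDiffOn).parts φ hφ
    have h2 : pd i (fun x => B (moll n f x) (moll n g x)) =
        fun x => B (moll n f' x) (moll n g x) + B (moll n f x) (moll n g' x) := by
      ext x
      have d1 := ((sf n).differentiable (by simp) x).hasFDerivAt
      have d2 := ((sg n).differentiable (by simp) x).hasFDerivAt
      have d3 : fderiv ℝ (fun x => B (moll n f x) (moll n g x)) x = _ :=
        (B.hasFDerivAt_of_bilinear d1 d2).fderiv
      have e1 : fderiv ℝ (moll n f) x (bvec i) = moll n f' x := congrFun (pd_moll hf n) x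
      have e2 : fderiv ℝ (moll n g) x (bvec i) = moll n g' x := congrFun (pd_moll hg n) x
      simp only [pd, d3]
      simp [e1, e2, add_comm]
    rw [h1, h2]
    simp only [smul_add]
    rw [integral_add, neg_add, sub_eq_add_neg]
    · exact hφ.integrable_smul
        ((integrable_bilin B (memLp_moll mf' n) (memLp_moll mg n)).locallyIntegrable
          |>.locallyIntegrableOn _)
    · exact hφ.integrable_smul
        ((integrable_bilin B (memLp_moll mf n) (memLp_moll mg' n)).locallyIntegrable
          |>.locallyIntegrableOn _)
  have hc := hφ.smooth.continuous
  have hcp := (hφ.pd i).smooth.continuous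
  have l1 := tendsto_integral_bilin B mf mg (memLp_moll mf) (memLp_moll mg) (tendsto_moll mf)
    (tendsto_moll mg) hcp (hφ.pd i).compact
  have l2 := tendsto_integral_bilin B mf' mg (memLp_moll mf') (memLp_moll mg) (tendsto_moll mf')
    (tendsto_moll mg) hc hφ.compact
  have l3 := tendsto_integral_bilin B mf mg' (memLp_moll mf) (memLp_moll mg') (tendsto_moll mf)
    (tendsto_moll mg') hc hφ.compact
  simp only [hn] at l1
  rw [tendsto_nhds_unique l1 (l2.neg.sub l3)]
  simp only [smul_add]
  rw [integral_add (hφ.integrable_smul (i1.locallyIntegrable.locallyIntegrableOn _))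
    (hφ.integrable_smul (i2.locallyIntegrable.locallyIntegrableOn _)), neg_add, sub_eq_add_neg]

/-- Square integrability on bounded sets. -/
def L2Loc {E : Type*} [NormedAddCommGroup E] (f : Plane → E) : Prop :=
  ∀ R : ℝ, MemLp f 2 (volume.restrict (Metric.closedBall (0 : Plane) R))

lemma _root_.MeasureTheory.MemLp.l2Loc {E : Type*} [NormedAddCommGroup E] {f : Plane → E}
    (h : MemLp f 2 volume) : L2Loc f := fun _ => h.restrict _

lemma L2Loc.of_bound {E : Type*} [NormedAddCommGroup E] {f : Plane → E}
    (h : AEStronglyMeasurable f volume) {K : ℝ} (hK : ∀ᵐ x, ‖f x‖ ≤ K) : L2Loc f := fun R =>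
  haveI : IsFiniteMeasure (volume.restrict (Metric.closedBall (0 : Plane) R)) :=
    ⟨by rw [Measure.restrict_apply_univ]; exact measure_closedBall_lt_top⟩
  MemLp.of_bound h.restrict K (ae_restrict_of_ae hK)

lemma L2Loc.memLp_smul {f : Plane → F} (h : L2Loc f) {χ : Plane → ℝ} (hχ : Continuous χ)
    (hc : HasCompactSupport χ) : MemLp (fun x => χ x • f x) 2 volume := by
  obtain ⟨R, hR⟩ := hc.isCompact.isBounded.subset_closedBall (0 : Plane)
  obtain ⟨C, hC⟩ := hχ.bounded_above_of_compact_support hc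
  have h1 : MemLp (fun x => χ x • f x) 2 (volume.restrict (Metric.closedBall (0 : Plane) R)) := by
    refine MemLp.of_le_mul (c := C) (h R) (hχ.aestronglyMeasurable.smul (h R).1)
      (.of_forall fun x => ?_)
    rw [norm_smul]
    exact mul_le_mul_of_nonneg_right (hC x) (norm_nonneg _)
  rw [← memLp_indicator_iff_restrict Metric.isClosed_closedBall.measurableSet] at h1
  convert h1 using 1
  refine (indicator_eq_self.2 fun x hx => hR (subset_tsupport _ fun h0 => hx ?_)).symm
  simp [h0]

lemma L2Loc.add {E : Type*} [NormedAddCommGroup E] {f g : Plane → E} (hf : L2Loc f)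
    (hg : L2Loc g) : L2Loc (fun x => f x + g x) := fun R => (hf R).add (hg R)

lemma L2Loc.integrableOn_bilin (B : F →L[ℝ] G →L[ℝ] H) {f : Plane → F} {g : Plane → G}
    (hf : L2Loc f) (hg : L2Loc g) : LocallyIntegrable (fun x => B (f x) (g x)) volume := by
  rw [locallyIntegrable_iff]
  intro K hK
  obtain ⟨R, hR⟩ := hK.isBounded.subset_closedBall (0 : Plane)
  exact IntegrableOn.mono_set (integrable_bilin B (hf R) (hg R)) hR

/-- Leibniz rule for locally square-integrable functions with locally square-integrable weak
derivatives. -/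
lemma WD.bilin [CompleteSpace F] [CompleteSpace G] (B : F →L[ℝ] G →L[ℝ] H) {i : Fin 2}
    {f f' : Plane → F} {g g' : Plane → G} (hf : WD univ i f f') (hg : WD univ i g g')
    (mf : L2Loc f) (mf' : L2Loc f') (mg : L2Loc g) (mg' : L2Loc g') :
    WD univ i (fun x => B (f x) (g x)) (fun x => B (f' x) (g x) + B (f x) (g' x)) := by
  have i1 := L2Loc.integrableOn_bilin B mf' mg
  have i2 := L2Loc.integrableOn_bilin B mf mg'
  refine ⟨(L2Loc.integrableOn_bilin B mf mg).locallyIntegrableOn _,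
    (i1.add i2).locallyIntegrableOn _, fun φ hφ => ?_⟩
  obtain ⟨R, hR0, hR⟩ := hφ.compact.isCompact.isBounded.subset_ball_lt 0 (0 : Plane)
  -- localize with a cutoff that equals `1` near the support of `φ`
  let χ : ContDiffBump (0 : Plane) := ⟨R, R + 1, hR0, by linarith⟩
  have hχ : ContDiff ℝ ∞ (χ : Plane → ℝ) := χ.contDiff
  have h1 : ∀ x ∈ tsupport φ, χ x = 1 ∧ pd i χ x = 0 := by
    intro x hx
    have hx' := hR hx
    refine ⟨χ.one_of_mem_closedBall (Metric.ball_subset_closedBall hx'), ?_⟩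
    have : (χ : Plane → ℝ) =ᶠ[𝓝 x] fun _ => 1 := by
      filter_upwards [Metric.isOpen_ball.mem_nhds hx'] with y hy
      exact χ.one_of_mem_closedBall (Metric.ball_subset_closedBall hy)
    simp [pd, this.fderiv_eq]
  have cχ := hχ.continuous
  have cχ' := (contDiff_pd hχ i).continuous
  have kχ := χ.hasCompactSupport
  have kχ' := hasCompactSupport_pd χ.hasCompactSupport i
  have key := WD.bilin_of_memLp B (hf.smooth_smul isOpen_univ hχ.contDiffOn)
    (hg.smooth_smul isOpen_univ hχ.contDiffOn) (mf.memLp_smul cχ kχ)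
    ((mf'.memLp_smul cχ kχ).add (mf.memLp_smul cχ' kχ')) (mg.memLp_smul cχ kχ)
    ((mg'.memLp_smul cχ kχ).add (mg.memLp_smul cχ' kχ'))
  refine Eq.trans ?_ ((key.parts φ hφ).trans ?_)
  · refine integral_congr_ae (.of_forall fun x => ?_)
    by_cases hx : x ∈ tsupport φ
    · simp [(h1 x hx).1]
    · have : pd i φ x = 0 :=
        image_eq_zero_of_notMem_tsupport fun h => hx (tsupport_pd_subset i φ h)
      simp [this]
  · congr 1
    refine integral_congr_ae (.of_forall fun x => ?_)
    by_cases hx : x ∈ tsupport φ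
    · simp [(h1 x hx).1, (h1 x hx).2]
    · simp [image_eq_zero_of_notMem_tsupport hx]

end Mollification

/-! ### Interpolation inequalities on the plane -/

lemma lintegral_plane (q : Plane → ℝ≥0∞) (hq : Measurable q) :
    ∫⁻ x, q x = ∫⁻ y : ℝ, ∫⁻ x : ℝ, q !₂[x, y] := by
  have h1 := (EuclideanSpace.volume_preserving_symm_measurableEquiv_toLp (Fin 2)).symm
  have h2 := (volume_preserving_finTwoArrow ℝ).symm
  have h3 := h1.comp h2
  rw [← h3.lintegral_comp hq]
  change ∫⁻ p : ℝ × ℝ, _ ∂(volume.prod volume) = _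
  exact lintegral_prod_symm' _ (hq.comp h3.measurable)

lemma hasCompactSupport_line {Q : Plane → ℝ} (hc : HasCompactSupport Q) (x v : Plane)
    (hv : v ≠ 0) : HasCompactSupport (fun t : ℝ => Q (x + t • v)) := by
  obtain ⟨R, hR⟩ := hc.isCompact.isBounded.subset_closedBall (0 : Plane)
  refine HasCompactSupport.intro (isCompact_closedBall (0 : ℝ) ((R + ‖x‖) / ‖v‖)) fun t ht => ?_
  refine image_eq_zero_of_notMem_tsupport fun h => ht ?_
  have h1 := mem_closedBall_zero_iff.1 (hR h)
  have h2 : ‖t • v‖ ≤ R + ‖x‖ := by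
    calc ‖t • v‖ = ‖(x + t • v) - x‖ := by simp
      _ ≤ _ := (norm_sub_le _ _).trans (by linarith)
  rw [mem_closedBall_zero_iff, le_div_iff₀ (norm_pos_iff.2 hv), ← norm_smul]
  exact h2

lemma enorm_le_lintegral_line {Q : Plane → ℝ} (hs : ContDiff ℝ ∞ Q) (hc : HasCompactSupport Q)
    (x : Plane) (i : Fin 2) : ‖Q x‖ₑ ≤ ∫⁻ t : ℝ, ‖pd i Q (x + t • bvec i)‖ₑ := by
  have hd : ∀ t : ℝ, HasDerivAt (fun t : ℝ => Q (x + t • bvec i)) (pd i Q (x + t • bvec i)) t := by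
    intro t
    have h1 : HasDerivAt (fun t : ℝ => x + t • bvec i) (bvec i) t := by
      simpa using ((hasDerivAt_id t).smul_const (bvec i)).const_add x
    exact (hs.differentiable (by simp) _).hasFDerivAt.comp_hasDerivAt t h1
  have hs' : ContDiff ℝ 1 (fun t : ℝ => Q (x + t • bvec i)) :=
    (hs.of_le (by simp)).comp (contDiff_const.add (contDiff_id.smul contDiff_const))
  have := HasCompactSupport.enorm_le_lintegral_Ici_deriv hs'
    (hasCompactSupport_line hc x (bvec i) (by simp)) 0
  simp only [zero_smul, add_zero] at this
  refine this.trans ((setLIntegral_le_lintegral _ _).trans_eq (lintegral_congr fun t => ?_))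
  rw [(hd t).deriv]

/-- In the plane a test function is bounded by the integral of its mixed second derivative. -/
lemma enorm_le_lintegral_mixed {Q : Plane → ℝ} (hs : ContDiff ℝ ∞ Q) (hc : HasCompactSupport Q)
    (x : Plane) : ‖Q x‖ₑ ≤ ∫⁻ y, ‖pd 0 (pd 1 Q) y‖ₑ := by
  have hm : Measurable fun y => ‖pd 0 (pd 1 Q) y‖ₑ :=
    (contDiff_pd (contDiff_pd hs 1) 0).continuous.measurable.enorm
  rw [lintegral_plane _ hm]
  refine (enorm_le_lintegral_line hs hc x 1).trans ?_
  calc ∫⁻ t : ℝ, ‖pd 1 Q (x + t • bvec 1)‖ₑ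
      ≤ ∫⁻ t : ℝ, ∫⁻ s : ℝ, ‖pd 0 (pd 1 Q) !₂[s + x 0, t + x 1]‖ₑ := by
        refine lintegral_mono fun t => ?_
        refine (enorm_le_lintegral_line (contDiff_pd hs 1) (hasCompactSupport_pd hc 1) _ 0).trans_eq
          (lintegral_congr fun s => ?_)
        congr 2
        ext k
        fin_cases k <;> simp [add_comm]
    _ = ∫⁻ t : ℝ, ∫⁻ s : ℝ, ‖pd 0 (pd 1 Q) !₂[s, t + x 1]‖ₑ := by
        refine lintegral_congr fun t => ?_
        exact lintegral_add_right_eq_self (μ := volume)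
          (fun s : ℝ => ‖pd 0 (pd 1 Q) !₂[s, t + x 1]‖ₑ) (x 0)
    _ = _ := lintegral_add_right_eq_self (μ := volume)
          (fun t : ℝ => ∫⁻ s : ℝ, ‖pd 0 (pd 1 Q) !₂[s, t]‖ₑ) (x 1)

section Inner

variable {E : Type*} [NormedAddCommGroup E] [InnerProductSpace ℝ E]

lemma pd_inner {f g : Plane → E} {i : Fin 2} {x : Plane} (hf : DifferentiableAt ℝ f x)
    (hg : DifferentiableAt ℝ g x) :
    pd i (fun y => inner ℝ (f y) (g y)) x = inner ℝ (f x) (pd i g x) + inner ℝ (pd i f x) (g x) := by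
  simp [pd, fderiv_inner_apply ℝ hf hg]

lemma eLpNorm_inner_le {f g : Plane → E} (hf : AEStronglyMeasurable f volume)
    (hg : AEStronglyMeasurable g volume) :
    ∫⁻ x, ‖(inner ℝ (f x) (g x) : ℝ)‖ₑ ≤ eLpNorm f 2 volume * eLpNorm g 2 volume := by
  have := eLpNorm_le_eLpNorm_mul_eLpNorm_of_nnnorm (p := 2) (q := 2) (r := 1) hf hg
    (fun y z => (inner ℝ y z : ℝ)) 1
    (.of_forall fun x => by simpa using nnnorm_inner_le_nnnorm (𝕜 := ℝ) (f x) (g x))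
  simpa [eLpNorm_one_eq_lintegral_enorm] using this

lemma integrable_inner_of_memLp {f g : Plane → E} (hf : MemLp f 2 volume) (hg : MemLp g 2 volume) :
    Integrable (fun x => (inner ℝ (f x) (g x) : ℝ)) volume :=
  integrable_bilin (innerSL ℝ) hf hg

/-- The interpolation inequality `‖∂_i m‖² ≤ ‖m‖ ‖∂_i² m‖` in `L²`. -/
lemma eLpNorm_pd_sq_le {m : Plane → E} (hs : ContDiff ℝ ∞ m) {i : Fin 2} (h0 : MemLp m 2 volume)
    (h1 : MemLp (pd i m) 2 volume) (h2 : MemLp (pd i (pd i m)) 2 volume) :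
    eLpNorm (pd i m) 2 volume ^ 2 ≤ eLpNorm m 2 volume * eLpNorm (pd i (pd i m)) 2 volume := by
  have hs1 := contDiff_pd hs i
  have key := integral_bilinear_hasLineDerivAt_right_eq_neg_left_of_integrable (μ := volume)
    (B := innerSL ℝ) (f := pd i m) (f' := pd i (pd i m)) (g := m) (g' := pd i m) (v := bvec i)
    (integrable_inner_of_memLp h2 h0) (integrable_inner_of_memLp h1 h1)
    (integrable_inner_of_memLp h1 h0)
    (fun x _ => (hs1.differentiable (by simp) x).hasFDerivAt.hasLineDerivAt _)
    (fun x _ => (hs.differentiable (by simp) x).hasFDerivAt.hasLineDerivAt _)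
  have e1 : eLpNorm (pd i m) 2 volume ^ 2 = ‖∫ x, (inner ℝ (pd i m x) (pd i m x) : ℝ)‖ₑ := by
    rw [eLpNorm_two_sq, ← ofReal_norm, Real.norm_of_nonneg
      (integral_nonneg fun x => real_inner_self_nonneg),
      ofReal_integral_eq_lintegral_ofReal (integrable_inner_of_memLp h1 h1)
        (.of_forall fun x => real_inner_self_nonneg)]
    refine lintegral_congr fun x => ?_
    rw [real_inner_self_eq_norm_sq, ENNReal.ofReal_pow (norm_nonneg _), ofReal_norm]
  have e2 : ∫ x, (inner ℝ (pd i m x) (pd i m x) : ℝ) =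
      -∫ x, (inner ℝ (pd i (pd i m) x) (m x) : ℝ) := key
  rw [e1, e2, enorm_neg, mul_comm]
  exact (enorm_integral_le_lintegral_enorm _).trans (eLpNorm_inner_le h2.1 h0.1)

/-- The two-dimensional sup bound `|m|² ≤ 2 (‖m‖ ‖∂₀∂₁ m‖ + ‖∂₀ m‖ ‖∂₁ m‖)` with `L²` norms on the
right. -/
lemma enorm_sq_le_of_smooth {m : Plane → E} (hs : ContDiff ℝ ∞ m) (h0 : MemLp m 2 volume)
    (h1 : ∀ i, MemLp (pd i m) 2 volume) (h2 : MemLp (pd 0 (pd 1 m)) 2 volume) (x : Plane) :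
    ‖m x‖ₑ ^ 2 ≤ 2 * (eLpNorm m 2 volume * eLpNorm (pd 0 (pd 1 m)) 2 volume +
      eLpNorm (pd 0 m) 2 volume * eLpNorm (pd 1 m) 2 volume) := by
  set S := 2 * (eLpNorm m 2 volume * eLpNorm (pd 0 (pd 1 m)) 2 volume +
      eLpNorm (pd 0 m) 2 volume * eLpNorm (pd 1 m) 2 volume) with hS
  let Q : Plane → ℝ := fun y => inner ℝ (m y) (m y)
  have hQ : ContDiff ℝ ∞ Q := hs.inner ℝ hs
  have hdm : ∀ y, DifferentiableAt ℝ m y := fun y => hs.differentiable (by simp) y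
  have hdm1 : ∀ y, DifferentiableAt ℝ (pd 1 m) y := fun y =>
    (contDiff_pd hs 1).differentiable (by simp) y
  have q1 : ∀ i y, pd i Q y = 2 * inner ℝ (m y) (pd i m y) := fun i y => by
    rw [pd_inner (hdm y) (hdm y), real_inner_comm (m y) (pd i m y)]; ring
  have q2 : ∀ y, pd 0 (pd 1 Q) y =
      2 * inner ℝ (m y) (pd 0 (pd 1 m) y) + 2 * inner ℝ (pd 0 m y) (pd 1 m y) := fun y => by
    have : pd 1 Q = fun y => (2 : ℝ) * inner ℝ (m y) (pd 1 m y) := funext (q1 1)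
    rw [this, pd_mul (by fun_prop) ((hdm y).inner ℝ (hdm1 y)), pd_inner (hdm y) (hdm1 y)]
    have : pd 0 (fun _ : Plane => (2 : ℝ)) y = 0 := by simp [pd]
    rw [this]; ring
  have iQ : Integrable Q volume := integrable_inner_of_memLp h0 h0
  have iQ1 : ∀ i, Integrable (pd i Q) volume := fun i => by
    rw [funext (q1 i)]; exact (integrable_inner_of_memLp h0 (h1 i)).const_mul 2
  have bQ2 : ∫⁻ y, ‖pd 0 (pd 1 Q) y‖ₑ ≤ S := by
    have m1 := eLpNorm_inner_le h0.1 h2.1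
    have m2 := eLpNorm_inner_le (h1 0).1 (h1 1).1
    calc ∫⁻ y, ‖pd 0 (pd 1 Q) y‖ₑ
        ≤ ∫⁻ y, 2 * ‖(inner ℝ (m y) (pd 0 (pd 1 m) y) : ℝ)‖ₑ +
            2 * ‖(inner ℝ (pd 0 m y) (pd 1 m y) : ℝ)‖ₑ := by
          refine lintegral_mono fun y => ?_
          rw [q2]
          have h2e : ‖(2 : ℝ)‖ₑ = 2 := by rw [Real.enorm_of_nonneg (by norm_num)]; simp
          refine (enorm_add_le _ _).trans_eq ?_
          rw [enorm_mul, enorm_mul, h2e]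
      _ = 2 * (∫⁻ y, ‖(inner ℝ (m y) (pd 0 (pd 1 m) y) : ℝ)‖ₑ) +
            2 * ∫⁻ y, ‖(inner ℝ (pd 0 m y) (pd 1 m y) : ℝ)‖ₑ := by
          rw [lintegral_add_left', lintegral_const_mul' _ _ (by simp),
            lintegral_const_mul' _ _ (by simp)]
          exact ((integrable_inner_of_memLp h0 h2).aestronglyMeasurable.enorm).const_mul 2
      _ ≤ S := by rw [hS, mul_add]; gcongr
  -- localize with cutoffs at scale `n + 1`
  let χ : ContDiffBump (0 : Plane) := ⟨1, 2, by norm_num, by norm_num⟩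
  have hχ : ContDiff ℝ ∞ (χ : Plane → ℝ) := χ.contDiff
  have bdd : ∀ {w : Plane → ℝ}, Continuous w → HasCompactSupport w → ∃ D : ℝ≥0, ∀ y, ‖w y‖ₑ ≤ D := by
    intro w hw hc
    obtain ⟨D, hD⟩ := hw.bounded_above_of_compact_support hc
    refine ⟨D.toNNReal, fun y => ?_⟩
    rw [← ofReal_norm]
    exact ENNReal.ofReal_le_ofReal (hD y)
  have kχ := χ.hasCompactSupport
  obtain ⟨D0, hD0⟩ := bdd (contDiff_pd hχ 0).continuous (hasCompactSupport_pd kχ 0)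
  obtain ⟨D1, hD1⟩ := bdd (contDiff_pd hχ 1).continuous (hasCompactSupport_pd kχ 1)
  obtain ⟨D2, hD2⟩ := bdd (contDiff_pd (contDiff_pd hχ 1) 0).continuous
    (hasCompactSupport_pd (hasCompactSupport_pd kχ 1) 0)
  set I0 := ∫⁻ y, ‖Q y‖ₑ
  set I1 : Fin 2 → ℝ≥0∞ := fun i => ∫⁻ y, ‖pd i Q y‖ₑ
  have hI0 : I0 ≠ ⊤ := iQ.2.ne
  have hI1 : ∀ i, I1 i ≠ ⊤ := fun i => (iQ1 i).2.ne
  have hsc : ∀ (c : ℝ) (w : Plane → ℝ), ContDiff ℝ ∞ w → ∀ i y,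
      pd i (fun y : Plane => w (c • y)) y = c * pd i w (c • y) := by
    intro c w hw i y
    have h1 : HasFDerivAt (fun y : Plane => c • y) (c • ContinuousLinearMap.id ℝ Plane) y :=
      (hasFDerivAt_id (𝕜 := ℝ) y).const_smul c
    have h2 : fderiv ℝ (fun y : Plane => w (c • y)) y = _ :=
      ((hw.differentiable (by simp) (c • y)).hasFDerivAt.comp y h1).fderiv
    simp [pd, h2]
  have hbound : ∀ n : ℕ, ‖χ ((1 / ((n : ℝ) + 1)) • x) * Q x‖ₑ ≤ S +
      (ENNReal.ofReal (1 / ((n : ℝ) + 1)) * (D1 * I1 0 + D0 * I1 1) +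
        ENNReal.ofReal (1 / ((n : ℝ) + 1)) ^ 2 * (D2 * I0)) := by
    intro n
    set c : ℝ := 1 / ((n : ℝ) + 1) with hc
    have hc0 : 0 ≤ c := by positivity
    have hcs : ContDiff ℝ ∞ (fun y : Plane => χ (c • y)) := hχ.comp (contDiff_const_smul _)
    have hcc : HasCompactSupport (fun y : Plane => χ (c • y)) :=
      kχ.comp_homeomorph (Homeomorph.smulOfNeZero c (by positivity))
    refine (enorm_le_lintegral_mixed (hcs.mul hQ) hcc.mul_right x).trans ?_
    have hform : ∀ y, pd 0 (pd 1 (fun y => χ (c • y) * Q y)) y = χ (c • y) * pd 0 (pd 1 Q) y +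
        (c * (pd 1 χ (c • y) * pd 0 Q y + pd 0 χ (c • y) * pd 1 Q y) +
          c ^ 2 * (pd 0 (pd 1 χ) (c • y) * Q y)) := by
      intro y
      have e1 : pd 1 (fun y => χ (c • y) * Q y) =
          fun y => χ (c • y) * pd 1 Q y + c * (pd 1 χ (c • y) * Q y) := by
        ext y
        rw [pd_mul (hcs.differentiable (by simp) y) (hQ.differentiable (by simp) y),
          hsc c χ hχ]
        ring
      have s1 : ContDiff ℝ ∞ (fun y : Plane => pd 1 χ (c • y)) :=
        (contDiff_pd hχ 1).comp (contDiff_const_smul _)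
      have s2 := contDiff_pd hQ 1
      have dd : ∀ {w : Plane → ℝ}, ContDiff ℝ ∞ w → DifferentiableAt ℝ w y := fun hw =>
        hw.differentiable (by simp) y
      rw [e1, pd_add (dd (hcs.mul s2)) (dd (contDiff_const.mul (s1.mul hQ))),
        pd_mul (dd hcs) (dd s2), pd_mul (by fun_prop) (dd (s1.mul hQ)), pd_mul (dd s1) (dd hQ),
        hsc c χ hχ, hsc c _ (contDiff_pd hχ 1)]
      have : pd 0 (fun _ : Plane => c) y = 0 := by simp [pd]
      rw [this]; ring
    have mQ : ∀ {w : Plane → ℝ}, ContDiff ℝ ∞ w → AEMeasurable (fun y => ‖w y‖ₑ) volume :=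
      fun hw => hw.continuous.measurable.enorm.aemeasurable
    calc ∫⁻ y, ‖pd 0 (pd 1 (fun y => χ (c • y) * Q y)) y‖ₑ
        ≤ ∫⁻ y, (‖pd 0 (pd 1 Q) y‖ₑ + (ENNReal.ofReal c * (D1 * ‖pd 0 Q y‖ₑ + D0 * ‖pd 1 Q y‖ₑ) +
            ENNReal.ofReal c ^ 2 * (D2 * ‖Q y‖ₑ))) := by
          refine lintegral_mono fun y => ?_
          rw [hform]
          have hce : ‖c‖ₑ = ENNReal.ofReal c := Real.enorm_of_nonneg hc0
          refine (enorm_add_le _ _).trans (add_le_add ?_ ((enorm_add_le _ _).trans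
            (add_le_add ?_ ?_)))
          · rw [enorm_mul]
            refine mul_le_of_le_one_left (zero_le) ?_
            rw [Real.enorm_of_nonneg χ.nonneg]
            exact ENNReal.ofReal_le_one.2 χ.le_one
          · rw [enorm_mul, hce]
            gcongr
            refine (enorm_add_le _ _).trans ?_
            rw [enorm_mul, enorm_mul]
            gcongr
            · exact hD1 _
            · exact hD0 _
          · rw [enorm_mul, enorm_mul, enorm_pow, hce]
            gcongr
            exact hD2 _
      _ = (∫⁻ y, ‖pd 0 (pd 1 Q) y‖ₑ) + (ENNReal.ofReal c * (D1 * I1 0 + D0 * I1 1) +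
            ENNReal.ofReal c ^ 2 * (D2 * I0)) := by
          rw [lintegral_add_left' (mQ (contDiff_pd (contDiff_pd hQ 1) 0)),
            lintegral_add_right', lintegral_const_mul' _ _ (by simp),
            lintegral_const_mul' _ _ (by simp), lintegral_const_mul' _ _ (by simp),
            lintegral_add_right', lintegral_const_mul' _ _ (by simp),
            lintegral_const_mul' _ _ (by simp)]
          · exact (mQ (contDiff_pd hQ 1)).const_mul _
          · exact ((mQ hQ).const_mul _).const_mul _
      _ ≤ _ := by gcongr
  have hc0 : Tendsto (fun n : ℕ => ENNReal.ofReal (1 / ((n : ℝ) + 1))) atTop (𝓝 0) := by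
    have := ENNReal.tendsto_ofReal (tendsto_one_div_add_atTop_nhds_zero_nat (𝕜 := ℝ))
    simpa using this
  have hA : (D1 : ℝ≥0∞) * I1 0 + D0 * I1 1 ≠ ⊤ :=
    ENNReal.add_ne_top.2 ⟨ENNReal.mul_ne_top (by simp) (hI1 0), ENNReal.mul_ne_top (by simp) (hI1 1)⟩
  have hB : (D2 : ℝ≥0∞) * I0 ≠ ⊤ := ENNReal.mul_ne_top (by simp) hI0
  have lim1 : Tendsto (fun n : ℕ => S +
      (ENNReal.ofReal (1 / ((n : ℝ) + 1)) * (D1 * I1 0 + D0 * I1 1) +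
        ENNReal.ofReal (1 / ((n : ℝ) + 1)) ^ 2 * (D2 * I0))) atTop (𝓝 S) := by
    have t1 := ENNReal.Tendsto.mul_const hc0 (.inr hA)
    have t2 := ENNReal.Tendsto.mul_const (ENNReal.Tendsto.pow (n := 2) hc0) (.inr hB)
    simpa using (tendsto_const_nhds (x := S)).add (t1.add t2)
  have hone : ∀ᶠ n : ℕ in atTop, ‖χ ((1 / ((n : ℝ) + 1)) • x) * Q x‖ₑ = ‖m x‖ₑ ^ 2 := by
    obtain ⟨N, hN⟩ := exists_nat_ge ‖x‖
    filter_upwards [eventually_ge_atTop N] with n hn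
    have : χ ((1 / ((n : ℝ) + 1)) • x) = 1 := by
      refine χ.one_of_mem_closedBall ?_
      rw [mem_closedBall_zero_iff, norm_smul, Real.norm_of_nonneg (by positivity)]
      show _ ≤ (1 : ℝ)
      rw [one_div_mul_eq_div, div_le_one (by positivity)]
      have : (N : ℝ) ≤ n := by exact_mod_cast hn
      linarith
    rw [this, one_mul]
    show ‖(inner ℝ (m x) (m x) : ℝ)‖ₑ = _
    rw [real_inner_self_eq_norm_sq, enorm_pow, enorm_norm]
  refine ge_of_tendsto lim1 ?_
  filter_upwards [hone] with n hn
  rw [← hn]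
  exact hbound n

/-- Convolution with a test kernel turns second weak derivatives into classical ones. -/
lemma pd_pd_moll {f h : Plane → E} {i j : Fin 2} (hw : HasWeakDeriv ![i, j] f h) (n : ℕ) :
    pd i (pd j (moll n f)) = moll n h := by
  have hk := contDiff_kern n
  have kk := hasCompactSupport_kern n
  rw [moll, pd_conv hk kk hw.1, pd_conv (contDiff_pd hk j) (hasCompactSupport_pd kk j) hw.1, moll]
  ext x
  rw [conv_apply_swap, conv_apply_swap]
  set φ : Plane → ℝ := fun t => kern n (x - t) with hφ
  have refl : ∀ {w : Plane → ℝ}, ContDiff ℝ ∞ w → ∀ k t,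
      pd k (fun t => w (x - t)) t = -pd k w (x - t) := by
    intro w hw k t
    have h1 : HasFDerivAt (fun y : Plane => x - y) (-ContinuousLinearMap.id ℝ Plane) t :=
      (hasFDerivAt_id (𝕜 := ℝ) t).const_sub x
    have h3 : fderiv ℝ (fun t => w (x - t)) t = _ :=
      ((hw.differentiable (by simp) (x - t)).hasFDerivAt.comp t h1).fderiv
    simp [pd, h3]
  have hs : ContDiff ℝ ∞ φ := hk.comp (contDiff_const.sub contDiff_id)
  have hc : HasCompactSupport φ := by
    have e : φ = kern n ∘ (Homeomorph.subLeft x) := rfl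
    rw [e]; exact kk.comp_homeomorph _
  have key := hw.2.2 φ hs hc
  have e1 : ∀ t, (iteratedFDeriv ℝ 2 φ t fun k => bvec (![i, j] k)) =
      pd i (pd j (kern n)) (x - t) := by
    intro t
    rw [iteratedFDeriv_bvec_succ _ hs]
    have e2 : (fun y => iteratedFDeriv ℝ 1 φ y fun k => bvec (Fin.tail ![i, j] k)) =
        fun y => -(pd j (kern n) (x - y)) := by
      ext y
      rw [iteratedFDeriv_bvec_succ _ hs]
      simpa [Fin.tail] using refl hk j y
    rw [e2]
    have := refl (contDiff_pd hk j) i t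
    simp only [pd] at this ⊢
    rw [show (fun y => -(fderiv ℝ (kern n) (x - y)) (bvec j)) =
      -(fun y => (fderiv ℝ (kern n) (x - y)) (bvec j)) from rfl, fderiv_neg]
    exact neg_eq_iff_eq_neg.2 this
  simp only [e1] at key
  simpa using key

lemma memLp_pd_moll {f : Plane → E} (hf : MemLp f 2 volume) (i : Fin 2) (n : ℕ) :
    MemLp (pd i (moll n f)) 2 volume := by
  have hk := contDiff_kern n
  have kk := hasCompactSupport_kern n
  have hl := hf.locallyIntegrable (by norm_num)
  refine ⟨(contDiff_pd (contDiff_moll hl n) i).continuous.aestronglyMeasurable, ?_⟩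
  rw [moll, pd_conv hk kk hl]
  have hc := (contDiff_pd hk i).continuous
  refine (eLpNorm_conv_le hc.aestronglyMeasurable hf.1).trans_lt (ENNReal.mul_lt_top ?_ hf.2)
  exact (hc.integrable_of_hasCompactSupport (hasCompactSupport_pd kk i)).2

end Inner

lemma tendsto_eLpNorm_of_sub {E : Type*} [NormedAddCommGroup E] {a : Plane → E}
    {a' : ℕ → Plane → E} (ha : MemLp a 2 volume) (ha' : ∀ n, MemLp (a' n) 2 volume)
    (h : Tendsto (fun n => eLpNorm (a' n - a) 2 volume) atTop (𝓝 0)) :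
    Tendsto (fun n => eLpNorm (a' n) 2 volume) atTop (𝓝 (eLpNorm a 2 volume)) := by
  have h1 : Tendsto (fun n => eLpNorm a 2 volume - eLpNorm (a' n - a) 2 volume) atTop
      (𝓝 (eLpNorm a 2 volume)) := by
    simpa using ENNReal.Tendsto.sub tendsto_const_nhds h (.inl ha.2.ne)
  have h2 : Tendsto (fun n => eLpNorm (a' n - a) 2 volume + eLpNorm a 2 volume) atTop
      (𝓝 (eLpNorm a 2 volume)) := by
    simpa using h.add (tendsto_const_nhds (x := eLpNorm a 2 volume))
  refine tendsto_of_tendsto_of_tendsto_of_le_of_le h1 h2 (fun n => ?_) (fun n => ?_)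
  · rw [tsub_le_iff_left, eLpNorm_sub_comm]
    exact eLpNorm_le_of_sub (ha' n).1 ha.1
  · exact eLpNorm_le_of_sub ha.1 (ha' n).1

/-- If `f` and its second weak derivatives are square integrable, so are its first weak
derivatives, `f` is bounded, and the interpolation inequalities hold. -/
theorem exists_weakDeriv_of_second {E : Type*} [NormedAddCommGroup E] [InnerProductSpace ℝ E]
    [CompleteSpace E] {f : Plane → E} {h : Fin 2 → Fin 2 → Plane → E} (hf : MemLp f 2 volume)
    (hw : ∀ i j, HasWeakDeriv ![i, j] f (h i j)) (hh : ∀ i j, MemLp (h i j) 2 volume) :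
    ∃ g : Fin 2 → Plane → E, (∀ i, WD univ i f (g i)) ∧ (∀ i, MemLp (g i) 2 volume) ∧
      (∀ i, eLpNorm (g i) 2 volume ^ 2 ≤ eLpNorm f 2 volume * eLpNorm (h i i) 2 volume) ∧
      ∀ᵐ x, ‖f x‖ₑ ^ 2 ≤ 2 * (eLpNorm f 2 volume * eLpNorm (h 0 1) 2 volume +
        eLpNorm (g 0) 2 volume * eLpNorm (g 1) 2 volume) := by
  have hl := hf.locallyIntegrable (by norm_num)
  have sm := fun n => contDiff_moll hl n
  have m0 := fun n => memLp_moll hf n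
  have m1 := fun i n => memLp_pd_moll hf i n
  have e2 := fun i j n => pd_pd_moll (hw i j) n
  have m2 := fun i j n => memLp_moll (hh i j) n
  have t0 := tendsto_moll hf
  have t2 := fun i j => tendsto_moll (hh i j)
  -- the first derivatives of the mollifications form a Cauchy sequence, by interpolation
  have hcau : ∀ i, ∃ g : Plane → E, MemLp g 2 volume ∧
      Tendsto (fun n => eLpNorm (pd i (moll n f) - g) 2 volume) atTop (𝓝 0) := by
    intro i
    let G : ℕ → Lp E 2 (volume : Measure Plane) := fun n => (m1 i n).toLp _
    have hdiff : ∀ n k, eLpNorm (pd i (moll n f) - pd i (moll k f)) 2 volume ^ 2 ≤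
        eLpNorm (moll n f - moll k f) 2 volume *
          eLpNorm (moll n (h i i) - moll k (h i i)) 2 volume := by
      intro n k
      have hsub : ∀ {a b : Plane → E}, ContDiff ℝ ∞ a → ContDiff ℝ ∞ b →
          pd i (a - b) = pd i a - pd i b := by
        intro a b ha hb
        ext x
        have := fderiv_sub (ha.differentiable (by simp) x) (hb.differentiable (by simp) x)
        simp [pd, this]
      have d1 : pd i (moll n f - moll k f) = pd i (moll n f) - pd i (moll k f) :=
        hsub (sm n) (sm k)
      have d2 : pd i (pd i (moll n f - moll k f)) = moll n (h i i) - moll k (h i i) := by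
        rw [d1, hsub (contDiff_pd (sm n) i) (contDiff_pd (sm k) i), e2, e2]
      have := eLpNorm_pd_sq_le (m := moll n f - moll k f) (i := i) ((sm n).sub (sm k))
        ((m0 n).sub (m0 k)) (by rw [d1]; exact (m1 i n).sub (m1 i k))
        (by rw [d2]; exact (m2 i i n).sub (m2 i i k))
      rwa [d2, d1] at this
    have hC : CauchySeq G := by
      have c0 : CauchySeq (fun n => (m0 n).toLp (moll n f)) :=
        (((Lp.tendsto_Lp_iff_tendsto_eLpNorm'' _ m0 _ hf).2 t0)).cauchySeq
      have c2 : CauchySeq (fun n => (m2 i i n).toLp (moll n (h i i))) :=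
        (((Lp.tendsto_Lp_iff_tendsto_eLpNorm'' _ (m2 i i) _ (hh i i)).2 (t2 i i))).cauchySeq
      rw [EMetric.cauchySeq_iff] at c0 c2 ⊢
      intro ε hε
      obtain ⟨N0, hN0⟩ := c0 ε hε
      obtain ⟨N2, hN2⟩ := c2 ε hε
      refine ⟨max N0 N2, fun n hn k hk => ?_⟩
      have a0 := hN0 n (le_of_max_le_left hn) k (le_of_max_le_left hk)
      have a2 := hN2 n (le_of_max_le_right hn) k (le_of_max_le_right hk)
      rw [Lp.edist_toLp_toLp] at a0 a2 ⊢
      refine (ENNReal.pow_lt_pow_left_iff two_ne_zero).1 ((hdiff n k).trans_lt ?_)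
      rw [sq]
      exact ENNReal.mul_lt_mul a0 a2
    obtain ⟨g, hg⟩ := cauchySeq_tendsto_of_complete hC
    refine ⟨g, Lp.memLp g, ?_⟩
    have := (Lp.tendsto_Lp_iff_tendsto_eLpNorm' (f := G) g).1 hg
    refine this.congr fun n => eLpNorm_congr_ae ?_
    filter_upwards [(m1 i n).coeFn_toLp] with x hx
    simp [G, hx]
  choose g hg tg using hcau
  have weak : ∀ {a : Plane → E} {a' : ℕ → Plane → E}, MemLp a 2 volume →
      (∀ n, MemLp (a' n) 2 volume) →
      Tendsto (fun n => eLpNorm (a' n - a) 2 volume) atTop (𝓝 0) → ∀ {φ}, IsTest univ φ →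
      Tendsto (fun n => ∫ x, φ x • a' n x) atTop (𝓝 (∫ x, φ x • a x)) := by
    intro a a' ha ha' hlim φ hφ
    obtain ⟨R, hR0, hR⟩ := hφ.compact.isCompact.isBounded.subset_ball_lt 0 (0 : Plane)
    let χ : ContDiffBump (0 : Plane) := ⟨R, R + 1, hR0, by linarith⟩
    have hχ : MemLp (χ : Plane → ℝ) 2 volume :=
      χ.continuous.memLp_of_hasCompactSupport χ.hasCompactSupport
    have := tendsto_integral_bilin (ContinuousLinearMap.lsmul ℝ ℝ) hχ ha (fun _ => hχ) ha'
      (by simp) hlim hφ.smooth.continuous hφ.compact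
    have e : ∀ w : Plane → E, ∀ x, φ x • (ContinuousLinearMap.lsmul ℝ ℝ) (χ x) (w x) =
        φ x • w x := by
      intro w x
      by_cases hx : x ∈ tsupport φ
      · simp [χ.one_of_mem_closedBall (Metric.ball_subset_closedBall (hR hx))]
      · simp [image_eq_zero_of_notMem_tsupport hx]
    simpa only [e] using this
  have hWD : ∀ i, WD univ i f (g i) := by
    intro i
    refine ⟨hl.locallyIntegrableOn _,
      ((hg i).locallyIntegrable (by norm_num)).locallyIntegrableOn _, fun φ hφ => ?_⟩
    have l1 := weak hf m0 t0 (hφ.pd i)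
    have l2 := weak (hg i) (m1 i) (tg i) hφ
    have : ∀ n, ∫ x, pd i φ x • moll n f x = -∫ x, φ x • pd i (moll n f) x := fun n =>
      (WD.of_contDiffOn isOpen_univ ((sm n).of_le (by simp)).contDiffOn).parts φ hφ
    simp only [this] at l1
    exact tendsto_nhds_unique l1 l2.neg
  have T0 := tendsto_eLpNorm_of_sub hf m0 t0
  have T1 := fun i => tendsto_eLpNorm_of_sub (hg i) (m1 i) (tg i)
  have T2 := fun i j => tendsto_eLpNorm_of_sub (hh i j) (m2 i j) (t2 i j)
  refine ⟨g, hWD, hg, fun i => ?_, ?_⟩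
  · refine le_of_tendsto_of_tendsto' (ENNReal.Tendsto.pow (n := 2) (T1 i))
      (ENNReal.Tendsto.mul T0 (.inr (hh i i).2.ne) (T2 i i) (.inr hf.2.ne)) fun n => ?_
    have := eLpNorm_pd_sq_le (sm n) (m0 n) (m1 i n) (by rw [e2]; exact m2 i i n)
    rwa [e2] at this
  · have hmeas : TendstoInMeasure volume (fun n => moll n f) atTop f :=
      tendstoInMeasure_of_tendsto_eLpNorm (p := 2) (by norm_num) (fun n => (m0 n).1) hf.1 t0
    obtain ⟨ns, hns, hae⟩ := hmeas.exists_seq_tendsto_ae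
    filter_upwards [hae] with x hx
    have s := hns.tendsto_atTop
    have L1 : Tendsto (fun n => ‖moll (ns n) f x‖ₑ ^ 2) atTop (𝓝 (‖f x‖ₑ ^ 2)) :=
      ENNReal.Tendsto.pow (n := 2) ((continuous_enorm.tendsto _).comp hx)
    have A := (ENNReal.Tendsto.mul T0 (.inr (hh 0 1).2.ne) (T2 0 1) (.inr hf.2.ne)).add
      (ENNReal.Tendsto.mul (T1 0) (.inr (hg 1).2.ne) (T1 1) (.inr (hg 0).2.ne))
    have L2 := (ENNReal.Tendsto.const_mul (a := 2) A (.inr (by simp))).comp s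
    refine le_of_tendsto_of_tendsto' L1 L2 fun n => ?_
    have := enorm_sq_le_of_smooth (sm (ns n)) (m0 _) (fun i => m1 i _)
      (by rw [e2]; exact m2 0 1 _) x
    rwa [e2] at this

/-! ### Absolutely continuous functions on the half-line -/

section HalfLine

variable {E : Type*} [NormedAddCommGroup E]

/-- Local absolute continuity on `(0, ∞)`. -/
def LocAC {X : Type*} [PseudoMetricSpace X] (F : ℝ → X) : Prop :=
  ∀ a b : ℝ, 0 < a → a ≤ b → AbsolutelyContinuousOnInterval F a b

lemma absolutelyContinuousOnInterval_of_dist_le {X : Type*} [PseudoMetricSpace X] {F : ℝ → X}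
    {a b : ℝ} {g : ℝ → ℝ} (hg : AbsolutelyContinuousOnInterval g a b)
    (h : ∀ x ∈ uIcc a b, ∀ y ∈ uIcc a b, dist (F x) (F y) ≤ dist (g x) (g y)) :
    AbsolutelyContinuousOnInterval F a b := by
  refine squeeze_zero' (.of_forall fun _ => Finset.sum_nonneg fun _ _ => dist_nonneg) ?_ hg
  have : ∀ᶠ E : ℕ × (ℕ → ℝ × ℝ) in AbsolutelyContinuousOnInterval.totalLengthFilter ⊓
      𝓟 (AbsolutelyContinuousOnInterval.disjWithin a b),
      E ∈ AbsolutelyContinuousOnInterval.disjWithin a b :=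
    eventually_inf_principal.mpr (by simp)
  filter_upwards [this] with E hE
  exact Finset.sum_le_sum fun i hi => h _ (hE.1 i hi).1 _ (hE.1 i hi).2

lemma absolutelyContinuousOnInterval_of_norm_sub_le {F : ℝ → E} {a b : ℝ} (hab : a ≤ b)
    {g : ℝ → ℝ} (hg : IntervalIntegrable g volume a b)
    (h : ∀ x y, a ≤ x → x ≤ y → y ≤ b → ‖F y - F x‖ ≤ ∫ t in x..y, g t) :
    AbsolutelyContinuousOnInterval F a b := by
  refine absolutelyContinuousOnInterval_of_dist_le
    (hg.absolutelyContinuousOnInterval_intervalIntegral (c := a) left_mem_uIcc) ?_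
  rw [uIcc_of_le hab]
  have key : ∀ x y, a ≤ x → x ≤ y → y ≤ b →
      dist (F x) (F y) ≤ dist (∫ t in a..x, g t) (∫ t in a..y, g t) := by
    intro x y hax hxy hyb
    have i1 : IntervalIntegrable g volume a x := hg.mono_set (by
      rw [uIcc_of_le hax, uIcc_of_le hab]; exact Icc_subset_Icc_right (hxy.trans hyb))
    have i2 : IntervalIntegrable g volume a y := hg.mono_set (by
      rw [uIcc_of_le (hax.trans hxy), uIcc_of_le hab]; exact Icc_subset_Icc_right hyb)
    rw [dist_comm, dist_comm (∫ t in a..x, g t), dist_eq_norm, dist_eq_norm,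
      intervalIntegral.integral_interval_sub_left i2 i1]
    exact (h x y hax hxy hyb).trans (Real.le_norm_self _)
  intro x hx y hy
  rcases le_total x y with hxy | hxy
  · exact key x y hx.1 hxy hy.2
  · rw [dist_comm, dist_comm (∫ t in a..x, g t)]
    exact key y x hy.1 hxy hx.2

lemma LocAC.continuousOn {F : ℝ → E} (h : LocAC F) :
    ContinuousOn F (Ioi 0) := by
  intro r hr
  have hr0 : (0 : ℝ) < r := hr
  have h2 : r / 2 ≤ r + 1 := (half_le_self hr0.le).trans (lt_add_one r).le
  have h3 : AbsolutelyContinuousOnInterval F (r / 2) (r + 1) := h _ _ (half_pos hr0) h2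
  have h1 : ContinuousOn F (uIcc (r / 2) (r + 1)) := h3.continuousOn
  rw [uIcc_of_le h2] at h1
  exact (h1.continuousAt (Icc_mem_nhds (half_lt_self hr0) (lt_add_one r))).continuousWithinAt

variable [NormedSpace ℝ E]

/-- `F'` is locally integrable on `(0, ∞)` and `F` is one of its primitives. -/
def HasIntDeriv (F F' : ℝ → E) : Prop :=
  ∀ a b : ℝ, 0 < a → a ≤ b →
    IntervalIntegrable F' volume a b ∧ F b - F a = ∫ r in a..b, F' r

lemma HasIntDeriv.locAC {F F' : ℝ → E} (h : HasIntDeriv F F') : LocAC F := by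
  intro a b ha hab
  refine absolutelyContinuousOnInterval_of_norm_sub_le hab (h a b ha hab).1.norm
    fun x y hax hxy hyb => ?_
  rw [(h x y (ha.trans_le hax) hxy).2]
  exact intervalIntegral.norm_integral_le_integral_norm hxy

lemma ae_pos_of_Icc {P : ℝ → Prop}
    (h : ∀ n : ℕ, ∀ᵐ r : ℝ, r ∈ Icc (1 / ((n : ℝ) + 1)) ((n : ℝ) + 1) → P r) :
    ∀ᵐ r : ℝ, 0 < r → P r := by
  filter_upwards [ae_all_iff.2 h] with r hr h0
  obtain ⟨n, hn⟩ := exists_nat_gt (max r (1 / r))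
  have h1 : r < n := (le_max_left _ _).trans_lt hn
  have h2 : 1 / r < n := (le_max_right _ _).trans_lt hn
  refine hr n ⟨?_, by linarith⟩
  rw [one_div_le (by positivity) h0]
  linarith

lemma one_div_le_add_one (n : ℕ) : 1 / ((n : ℝ) + 1) ≤ (n : ℝ) + 1 := by
  have : (1 : ℝ) ≤ (n : ℝ) + 1 := by linarith [Nat.cast_nonneg (α := ℝ) n]
  exact (div_le_one (by positivity)).2 this |>.trans this

lemma HasIntDeriv.ae_hasDerivAt [CompleteSpace E] {F F' : ℝ → E} (h : HasIntDeriv F F') :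
    ∀ᵐ r : ℝ, 0 < r → HasDerivAt F (F' r) r := by
  have key : ∀ n : ℕ, ∀ᵐ r : ℝ, r ∈ Ioo (1 / ((n : ℝ) + 1) / 2) ((n : ℝ) + 1 + 1) →
      HasDerivAt F (F' r) r := by
    intro n
    set a := 1 / ((n : ℝ) + 1) / 2 with ha
    set b := (n : ℝ) + 1 + 1 with hb
    have ha0 : 0 < a := by positivity
    have hab : a ≤ b := by
      have := one_div_le_add_one n
      have h1 : 0 < 1 / ((n : ℝ) + 1) := by positivity
      rw [ha, hb]; linarith
    filter_upwards [(h a b ha0 hab).1.ae_hasDerivAt_integral] with r hr hmem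
    have hr' : r ∈ uIcc a b := by rw [uIcc_of_le hab]; exact Ioo_subset_Icc_self hmem
    have h1 := (hr hr' a left_mem_uIcc).const_add (F a)
    refine h1.congr_of_eventuallyEq ?_
    filter_upwards [Ioo_mem_nhds hmem.1 hmem.2] with x hx
    rw [← (h a x ha0 hx.1.le).2]
    abel
  refine ae_pos_of_Icc fun n => ?_
  filter_upwards [key n] with r hr hmem
  refine hr ⟨?_, by linarith [hmem.2]⟩
  have h1 : 0 < 1 / ((n : ℝ) + 1) := by positivity
  linarith [hmem.1]

lemma LocAC.hasIntDeriv_real {F : ℝ → ℝ} (h : LocAC F) : HasIntDeriv F (deriv F) :=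
  fun a b ha hab => ⟨(h a b ha hab).intervalIntegrable_deriv,
    ((h a b ha hab).integral_deriv_eq_sub).symm⟩

lemma LocAC.const_of_deriv_zero {F : ℝ → E} (h : LocAC F)
    (h0 : ∀ᵐ r : ℝ, 0 < r → HasDerivAt F 0 r) {a b : ℝ} (ha : 0 < a) (hb : 0 < b) :
    F a = F b := by
  wlog hab : a ≤ b generalizing a b
  · exact (this hb ha (le_of_not_ge hab)).symm
  obtain ⟨C, hC⟩ := (h a b ha hab).const_of_ae_hasDerivAt_zero (by
    filter_upwards [h0] with r hr hmem
    rw [uIcc_of_le hab] at hmem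
    exact hr (ha.trans_le hmem.1))
  rw [hC a left_mem_uIcc, hC b right_mem_uIcc]

end HalfLine

section SpaceValued

lemma norm_le_sum_coord (a : Space) : ‖a‖ ≤ |a 0| + |a 1| + |a 2| := by
  rw [EuclideanSpace.norm_eq, Real.sqrt_le_left (by positivity)]
  simp only [Fin.sum_univ_three, Real.norm_eq_abs]
  nlinarith [abs_nonneg (a 0), abs_nonneg (a 1), abs_nonneg (a 2),
    mul_nonneg (abs_nonneg (a 0)) (abs_nonneg (a 1)), mul_nonneg (abs_nonneg (a 0)) (abs_nonneg (a 2)),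
    mul_nonneg (abs_nonneg (a 1)) (abs_nonneg (a 2))]

lemma abs_coord_le (a : Space) (i : Fin 3) : |a i| ≤ ‖a‖ := PiLp.norm_apply_le a i

lemma LocAC.coord {F : ℝ → Space} (h : LocAC F) (i : Fin 3) : LocAC fun r => F r i := by
  intro a b ha hab
  refine squeeze_zero (fun _ => Finset.sum_nonneg fun _ _ => dist_nonneg)
    (fun E => Finset.sum_le_sum fun j _ => ?_) (h a b ha hab)
  rw [Real.dist_eq, dist_eq_norm]
  exact abs_coord_le (_ - _) i

lemma LocAC.of_coord {F : ℝ → Space} (h : ∀ i, LocAC fun r => F r i) : LocAC F := by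
  intro a b ha hab
  have h3 := ((h 0 a b ha hab).add (h 1 a b ha hab)).add (h 2 a b ha hab)
  have key : Tendsto (fun E : ℕ × (ℕ → ℝ × ℝ) =>
      (∑ j ∈ Finset.range E.1, dist (F (E.2 j).1 0) (F (E.2 j).2 0)) +
      (∑ j ∈ Finset.range E.1, dist (F (E.2 j).1 1) (F (E.2 j).2 1)) +
      (∑ j ∈ Finset.range E.1, dist (F (E.2 j).1 2) (F (E.2 j).2 2)))
      (AbsolutelyContinuousOnInterval.totalLengthFilter ⊓
        𝓟 (AbsolutelyContinuousOnInterval.disjWithin a b)) (𝓝 0) := by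
    have := (Tendsto.add (Tendsto.add (h 0 a b ha hab) (h 1 a b ha hab)) (h 2 a b ha hab))
    simpa using this
  refine squeeze_zero (fun _ => Finset.sum_nonneg fun _ _ => dist_nonneg) (fun E => ?_) key
  rw [← Finset.sum_add_distrib, ← Finset.sum_add_distrib]
  refine Finset.sum_le_sum fun j _ => ?_
  rw [dist_eq_norm]
  exact norm_le_sum_coord _

lemma hasDerivAt_coord_iff {F : ℝ → Space} {F' : Space} {r : ℝ} :
    HasDerivAt F F' r ↔ ∀ i, HasDerivAt (fun r => F r i) (F' i) r := by
  simp only [← hasDerivWithinAt_univ, hasDerivWithinAt_iff_hasFDerivWithinAt]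
  rw [hasFDerivWithinAt_euclidean]
  refine forall_congr' fun i => ?_
  refine iff_of_eq (congrArg (fun L => HasFDerivWithinAt (fun r => F r i) L univ r) ?_)
  ext
  simp

/-- A locally absolutely continuous curve in space is differentiable almost everywhere and is a
primitive of its derivative. -/
lemma LocAC.hasIntDeriv {F : ℝ → Space} (h : LocAC F) : HasIntDeriv F (deriv F) := by
  have hc := fun i => (h.coord i).hasIntDeriv_real
  have hae := fun i => (hc i).ae_hasDerivAt
  have hd : ∀ᵐ r : ℝ, 0 < r → ∀ i, deriv F r i = deriv (fun r => F r i) r := by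
    filter_upwards [ae_all_iff.2 hae] with r hr h0 i
    have : HasDerivAt F (WithLp.toLp 2 fun i => deriv (fun r => F r i) r) r :=
      hasDerivAt_coord_iff.2 fun i => hr i h0
    rw [this.deriv]
  intro a b ha hab
  have hi : ∀ i, IntervalIntegrable (fun r => deriv F r i) volume a b := fun i => by
    refine (hc i a b ha hab).1.congr_ae ?_
    rw [uIoc_of_le hab]
    filter_upwards [ae_restrict_of_ae hd, ae_restrict_mem measurableSet_Ioc] with r hr hm
    exact (hr (ha.trans hm.1) i).symm
  have hI : IntervalIntegrable (deriv F) volume a b := by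
    rw [intervalIntegrable_iff] at *
    refine (Integrable.of_eval_piLp fun i => ?_)
    exact intervalIntegrable_iff.1 (hi i)
  refine ⟨hI, ?_⟩
  ext i
  have e1 : (∫ r in a..b, deriv F r) i = ∫ r in a..b, deriv F r i := by
    have := (EuclideanSpace.proj (𝕜 := ℝ) i : Space →L[ℝ] ℝ).intervalIntegral_comp_comm hI
    simpa using this.symm
  rw [e1]
  have e2 : ∫ r in a..b, deriv F r i = ∫ r in a..b, deriv (fun r => F r i) r := by
    refine intervalIntegral.integral_congr_ae ?_
    rw [uIoc_of_le hab]
    filter_upwards [hd] with r hr hm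
    exact hr (ha.trans hm.1) i
  rw [e2, ← (hc i a b ha hab).2]
  simp

end SpaceValued

/-! ### Radial functions on the plane -/

section Radial

variable {E : Type*} [NormedAddCommGroup E] [NormedSpace ℝ E]

lemma integrable_comp_norm_iff {F : ℝ → E} :
    Integrable (fun x : Plane => F ‖x‖) volume ↔
      IntegrableOn (fun r : ℝ => r • F r) (Ioi 0) volume := by
  have := integrable_fun_norm_addHaar (volume : Measure Plane) (f := F)
  simpa [finrank_euclideanSpace] using this

/-- The length of the unit circle, as the constant of integration in polar coordinates. -/
def circ : ℝ := 2 * volume.real (Metric.ball (0 : Plane) 1)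

lemma circ_pos : 0 < circ := by
  have : 0 < volume.real (Metric.ball (0 : Plane) 1) :=
    ENNReal.toReal_pos (Metric.measure_ball_pos volume _ one_pos).ne' measure_ball_lt_top.ne
  unfold circ; positivity

lemma integral_comp_norm (F : ℝ → E) :
    ∫ x : Plane, F ‖x‖ = circ • ∫ r in Ioi (0 : ℝ), r • F r := by
  have := integral_fun_norm_addHaar (volume : Measure Plane) F
  rw [this]
  simp [circ, mul_smul, two_smul]

lemma ae_comp_norm {P : ℝ → Prop} (h : ∀ᵐ r : ℝ, 0 < r → P r) : ∀ᵐ x : Plane, P ‖x‖ := by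
  obtain ⟨N, hN, hNm, hN0⟩ := exists_measurable_superset_of_null (ae_iff.1 h)
  set f : ℝ → ℝ := N.indicator 1 with hf
  have hz : (fun r : ℝ => r • f r) =ᵐ[volume.restrict (Ioi 0)] 0 := by
    filter_upwards [ae_restrict_of_ae (measure_eq_zero_iff_ae_notMem.1 hN0)] with r hr
    simp [hf, hr]
  have hi : Integrable (fun x : Plane => f ‖x‖) volume :=
    integrable_comp_norm_iff.2 ((integrable_zero _ _ _).congr hz.symm)
  have h0 : ∫ x : Plane, f ‖x‖ = 0 := by
    rw [integral_comp_norm, integral_congr_ae hz]; simp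
  have h1 := (integral_eq_zero_iff_of_nonneg (f := fun x : Plane => f ‖x‖)
    (fun x => indicator_nonneg (fun _ _ => zero_le_one) _) hi).1 h0
  filter_upwards [h1, measure_eq_zero_iff_ae_notMem.1 (measure_singleton (0 : Plane))] with x hx hx0
  by_contra hP
  have : ‖x‖ ∈ N := hN (by simp only [mem_ofPred_eq]; push Not; exact ⟨norm_pos_iff.2 hx0, hP⟩)
  simp [hf, this] at hx

lemma isOpen_punctured : IsOpen ({0}ᶜ : Set Plane) := isOpen_compl_singleton

lemma pd_comp_norm {F : ℝ → E} {F' : E} {x : Plane} (hx : x ≠ 0) (h : HasDerivAt F F' ‖x‖)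
    (k : Fin 2) : pd k (fun y => F ‖y‖) x = (x k / ‖x‖) • F' := by
  have h1 : DifferentiableAt ℝ (fun y : Plane => ‖y‖) x := (contDiffAt_norm ℝ hx).differentiableAt
    (n := 1) (by simp)
  have h3 : HasFDerivAt (fun y => F ‖y‖) _ x := h.hasFDerivAt.comp x h1.hasFDerivAt
  unfold pd
  rw [h3.fderiv]
  have h4 : fderiv ℝ (fun y : Plane => ‖y‖) x (bvec k) = x k / ‖x‖ := by
    have h5 : HasFDerivAt (fun y : Plane => ‖y‖ ^ 2) (2 • innerSL ℝ x) x :=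
      (hasStrictFDerivAt_norm_sq x).hasFDerivAt
    have h6 := (h1.hasFDerivAt.pow 2).unique h5
    have h7 := congrArg (fun L => L (bvec k)) h6
    have hn : ‖x‖ ≠ 0 := norm_ne_zero_iff.2 hx
    simp [bvec, EuclideanSpace.inner_single_right] at h7
    rw [eq_div_iff hn, bvec, mul_comm]
    linarith
  simp [h4]

lemma contDiffOn_norm : ContDiffOn ℝ ∞ (fun x : Plane => ‖x‖) {0}ᶜ :=
  fun _ hx => (contDiffAt_norm ℝ hx).contDiffWithinAt

lemma contDiff_coord (k : Fin 2) : ContDiff ℝ ∞ (fun x : Plane => x k) := by fun_prop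

lemma pd_coord (k l : Fin 2) (x : Plane) :
    pd l (fun x : Plane => x k) x = if l = k then 1 else 0 := by
  have : (fun x : Plane => x k) = (EuclideanSpace.proj (𝕜 := ℝ) k : Plane →L[ℝ] ℝ) := by ext; simp
  unfold pd
  rw [this, ContinuousLinearMap.fderiv]
  simp [bvec, eq_comm]

/-- On a compact set that avoids the origin the norm is bounded above and away from zero. -/
lemma exists_annulus {K : Set Plane} (hK : IsCompact K) (h0 : K ⊆ {0}ᶜ) :
    ∃ a b : ℝ, 0 < a ∧ a ≤ b ∧ ∀ x ∈ K, a ≤ ‖x‖ ∧ ‖x‖ ≤ b := by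
  rcases K.eq_empty_or_nonempty with rfl | hne
  · exact ⟨1, 1, one_pos, le_rfl, by simp⟩
  obtain ⟨x, hx, hxm⟩ := hK.exists_isMinOn hne continuous_norm.continuousOn
  obtain ⟨y, hy, hym⟩ := hK.exists_isMaxOn hne continuous_norm.continuousOn
  exact ⟨‖x‖, ‖y‖, norm_pos_iff.2 (h0 hx), hxm hy, fun z hz => ⟨hxm hz, hym hz⟩⟩

lemma integrable_comp_norm_of_Icc {F : ℝ → E} {a b : ℝ} (ha : 0 < a)
    (hF : Integrable F volume) (hs : ∀ r, r ∉ Icc a b → F r = 0) :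
    Integrable (fun x : Plane => F ‖x‖) volume := by
  rw [integrable_comp_norm_iff]
  refine Integrable.integrableOn ?_
  refine (hF.norm.const_mul (max a b)).mono (by fun_prop) (.of_forall fun r => ?_)
  by_cases hr : r ∈ Icc a b
  · rw [norm_smul]
    have h1 : ‖r‖ ≤ max a b := by
      rw [Real.norm_of_nonneg (ha.le.trans hr.1)]; exact hr.2.trans (le_max_right _ _)
    have : 0 ≤ max a b := (norm_nonneg r).trans h1
    rw [norm_mul, Real.norm_of_nonneg this, norm_norm]
    gcongr
  · simp [hs r hr]

lemma norm_unit_le (x : Plane) (k : Fin 2) : ‖x k / ‖x‖‖ ≤ 1 := by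
  rw [norm_div, norm_norm]
  exact div_le_one_of_le₀ (PiLp.norm_apply_le x k) (norm_nonneg _)

lemma measurable_unit (k : Fin 2) : Measurable fun x : Plane => x k / ‖x‖ := by fun_prop

lemma HasIntDeriv.integrable_indicator {F F' : ℝ → E} (h : HasIntDeriv F F') {a b : ℝ}
    (ha : 0 < a) (hab : a ≤ b) : Integrable ((Icc a b).indicator F') volume := by
  rw [integrable_indicator_iff measurableSet_Icc, ← intervalIntegrable_iff_integrableOn_Icc_of_le hab]
  exact (h a b ha hab).1

lemma HasIntDeriv.locallyIntegrableOn_radial {F F' : ℝ → E} (h : HasIntDeriv F F') (k : Fin 2) :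
    LocallyIntegrableOn (fun x : Plane => (x k / ‖x‖) • F' ‖x‖) {0}ᶜ volume := by
  rw [locallyIntegrableOn_iff isOpen_punctured.isLocallyClosed]
  intro K hK0 hK
  obtain ⟨a, b, ha, hab, hKab⟩ := exists_annulus hK hK0
  have h1 := integrable_comp_norm_of_Icc ha (h.integrable_indicator ha hab)
    (fun r hr => indicator_of_notMem hr _)
  have h2 := h1.bdd_smul 1 (measurable_unit k).aestronglyMeasurable
    (.of_forall fun x => norm_unit_le x k)
  refine h2.integrableOn.congr_fun (fun x hx => ?_) hK.measurableSet
  rw [Pi.smul_apply', indicator_of_mem (show ‖x‖ ∈ Icc a b from hKab x hx)]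

/-- A radial function whose profile is locally absolutely continuous on `(0, ∞)` is weakly
differentiable away from the origin, with the expected gradient. -/
lemma HasIntDeriv.wd_radial [CompleteSpace E] {F F' : ℝ → E} (h : HasIntDeriv F F') (k : Fin 2) :
    WD {0}ᶜ k (fun x => F ‖x‖) (fun x => (x k / ‖x‖) • F' ‖x‖) := by
  have hFc : ContinuousOn (fun x : Plane => F ‖x‖) {0}ᶜ :=
    h.locAC.continuousOn.comp continuous_norm.continuousOn fun x hx => norm_pos_iff.2 hx
  have hlf := hFc.locallyIntegrableOn (μ := volume) isOpen_punctured.measurableSet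
  have hlg := h.locallyIntegrableOn_radial k
  refine ⟨hlf, hlg, fun φ hφ => ?_⟩
  obtain ⟨a, b, ha, hab, hKab⟩ := exists_annulus hφ.compact hφ.supp
  set G := (Icc a b).indicator F' with hG
  have hGi : Integrable G volume := h.integrable_indicator ha hab
  obtain ⟨C, hC⟩ := hφ.compact.exists_bound_of_continuous hφ.smooth.continuous
  have hC0 : 0 ≤ C := (norm_nonneg _).trans (hC 0)
  set D := ∫ x, ‖pd k φ x‖ with hD
  -- the error made when `F'` is replaced by a continuous function `h'`
  have key : ∀ ε : ℝ, 0 < ε →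
      ‖(∫ x, pd k φ x • F ‖x‖) + ∫ x, φ x • ((x k / ‖x‖) • F' ‖x‖)‖ ≤ (D + C * (circ * b)) * ε := by
    intro ε hε
    obtain ⟨q, -, hqi, hqc, hq⟩ := hGi.exists_hasCompactSupport_integral_sub_le hε
    set Q : ℝ → E := fun r => F a + ∫ t in a..r, q t with hQ
    have hQd : ∀ r, HasDerivAt Q (q r) r := fun r =>
      (intervalIntegral.integral_hasDerivAt_right (hqc.intervalIntegrable _ _)
        hqc.aestronglyMeasurable.stronglyMeasurableAtFilter hqc.continuousAt).const_add _
    have hQ1 : ContDiff ℝ 1 Q := by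
      rw [contDiff_one_iff_deriv]
      refine ⟨fun r => (hQd r).differentiableAt, ?_⟩
      rw [show deriv Q = q from funext fun r => (hQd r).deriv]
      exact hqc
    have hQw : WD {0}ᶜ k (fun x => Q ‖x‖) (pd k fun x => Q ‖x‖) :=
      WD.of_contDiffOn isOpen_punctured
        (hQ1.comp_contDiffOn (contDiffOn_norm.of_le (by simp)))
    have e1 : ∫ x, φ x • pd k (fun x => Q ‖x‖) x = ∫ x, φ x • ((x k / ‖x‖) • q ‖x‖) := by
      refine integral_congr_ae (.of_forall fun x => ?_)
      by_cases hx : x = 0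
      · have : φ x = 0 := by
          by_contra hne
          exact hφ.supp (subset_tsupport _ hne) hx
        simp [this]
      · simp only [pd_comp_norm hx (hQd _)]
    have iq : Integrable (fun x => φ x • ((x k / ‖x‖) • q ‖x‖)) volume := by
      refine (hφ.integrable_smul hQw.lg).congr (.of_forall fun x => ?_)
      by_cases hx : x = 0
      · have : φ x = 0 := by
          by_contra hne
          exact hφ.supp (subset_tsupport _ hne) hx
        simp [this]
      · simp only [pd_comp_norm hx (hQd _)]
    have e2 := hQw.parts φ hφ
    rw [e1] at e2
    have e3 : (∫ x, pd k φ x • F ‖x‖) + ∫ x, φ x • ((x k / ‖x‖) • F' ‖x‖) =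
        (∫ x, (pd k φ x • F ‖x‖ - pd k φ x • Q ‖x‖)) +
          ∫ x, (φ x • ((x k / ‖x‖) • F' ‖x‖) - φ x • ((x k / ‖x‖) • q ‖x‖)) := by
      rw [integral_sub ((hφ.pd k).integrable_smul hlf) ((hφ.pd k).integrable_smul hQw.lf),
        integral_sub (hφ.integrable_smul hlg) iq, e2]
      abel
    have hFQ : ∀ r ∈ Icc a b, ‖F r - Q r‖ ≤ ε := by
      intro r hr
      have h1 := h a r ha hr.1
      have h2 : F r - Q r = ∫ t in a..r, (F' t - q t) := by
        rw [intervalIntegral.integral_sub h1.1 (hqc.intervalIntegrable _ _), ← h1.2]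
        simp only [hQ]; abel
      rw [h2]
      refine (intervalIntegral.norm_integral_le_integral_norm hr.1).trans ?_
      rw [intervalIntegral.integral_of_le hr.1]
      refine le_trans ?_ hqi
      refine le_trans (le_of_eq ?_) (setIntegral_le_integral (s := Ioc a r)
        (hGi.sub hq).norm
        (.of_forall fun _ => norm_nonneg _))
      refine setIntegral_congr_fun measurableSet_Ioc fun t ht => ?_
      have : t ∈ Icc a b := ⟨ht.1.le, ht.2.trans hr.2⟩
      simp [hG, this]
    have b1 : ‖∫ x, (pd k φ x • F ‖x‖ - pd k φ x • Q ‖x‖)‖ ≤ D * ε := by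
      rw [hD, ← integral_mul_const]
      refine norm_integral_le_of_norm_le ?_ (.of_forall fun x => ?_)
      · exact (((hφ.pd k).smooth.continuous.integrable_of_hasCompactSupport
          (hφ.pd k).compact).norm).mul_const _
      · rw [← smul_sub, norm_smul]
        by_cases hx : x ∈ tsupport φ
        · gcongr
          exact hFQ _ (hKab x hx)
        · have : pd k φ x = 0 := by
            by_contra hne
            exact hx (tsupport_pd_subset k φ (subset_tsupport _ hne))
          simp [this]
    have hi : Integrable (fun r => (Icc a b).indicator (fun r => ‖F' r - q r‖) r) volume := by
      rw [integrable_indicator_iff measurableSet_Icc,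
        ← intervalIntegrable_iff_integrableOn_Icc_of_le hab]
      exact ((h a b ha hab).1.sub (hqc.intervalIntegrable _ _)).norm
    have b2 : ‖∫ x, (φ x • ((x k / ‖x‖) • F' ‖x‖) - φ x • ((x k / ‖x‖) • q ‖x‖))‖ ≤
        C * (circ * b) * ε := by
      have c1 : ‖∫ x, (φ x • ((x k / ‖x‖) • F' ‖x‖) - φ x • ((x k / ‖x‖) • q ‖x‖))‖ ≤
          ∫ x : Plane, C * (Icc a b).indicator (fun r => ‖F' r - q r‖) ‖x‖ := by
        refine norm_integral_le_of_norm_le ((integrable_comp_norm_of_Icc ha hi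
          (fun r hr => indicator_of_notMem hr _)).const_mul C) (.of_forall fun x => ?_)
        rw [← smul_sub, ← smul_sub, norm_smul, norm_smul]
        by_cases hx : x ∈ tsupport φ
        · rw [indicator_of_mem (show ‖x‖ ∈ Icc a b from hKab x hx)]
          have := norm_unit_le x k
          calc ‖φ x‖ * (‖x k / ‖x‖‖ * ‖F' ‖x‖ - q ‖x‖‖) ≤ C * (1 * ‖F' ‖x‖ - q ‖x‖‖) := by
                gcongr; exact hC x
            _ = _ := by rw [one_mul]
        · rw [image_eq_zero_of_notMem_tsupport hx]
          simp only [norm_zero, zero_mul]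
          exact mul_nonneg hC0 (indicator_nonneg (fun _ _ => norm_nonneg _) _)
      refine c1.trans ?_
      rw [integral_const_mul, integral_comp_norm, mul_assoc, mul_assoc]
      refine mul_le_mul_of_nonneg_left ?_ hC0
      rw [smul_eq_mul]
      refine mul_le_mul_of_nonneg_left ?_ circ_pos.le
      calc ∫ r in Ioi (0 : ℝ), r • (Icc a b).indicator (fun r => ‖F' r - q r‖) r
          ≤ ∫ r in Ioi (0 : ℝ), b * ‖G r - q r‖ := by
            refine setIntegral_mono_on ?_ ?_ measurableSet_Ioi fun r hr => ?_
            · exact (integrable_comp_norm_iff.1 (integrable_comp_norm_of_Icc ha hi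
                (fun r hr => indicator_of_notMem hr _)))
            · exact ((hGi.sub hq).norm.const_mul b).integrableOn
            · by_cases hm : r ∈ Icc a b
              · simp only [hG, indicator_of_mem hm, smul_eq_mul]
                gcongr; exact hm.2
              · rw [indicator_of_notMem hm, smul_zero]
                have : 0 ≤ b := ha.le.trans hab
                positivity
        _ ≤ ∫ r, b * ‖G r - q r‖ := setIntegral_le_integral
            ((hGi.sub hq).norm.const_mul b)
            (.of_forall fun _ => mul_nonneg (ha.le.trans hab) (norm_nonneg _))
        _ ≤ b * ε := by
            rw [integral_const_mul]
            exact mul_le_mul_of_nonneg_left hqi (ha.le.trans hab)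
    rw [e3, add_mul]
    exact (norm_add_le _ _).trans (add_le_add b1 b2)
  have hz : ‖(∫ x, pd k φ x • F ‖x‖) + ∫ x, φ x • ((x k / ‖x‖) • F' ‖x‖)‖ ≤ 0 := by
    have ht : Tendsto (fun ε : ℝ => (D + C * (circ * b)) * ε) (𝓝[>] 0) (𝓝 0) := by
      have : Tendsto (fun ε : ℝ => (D + C * (circ * b)) * ε) (𝓝 0)
          (𝓝 ((D + C * (circ * b)) * 0)) := (continuous_const.mul continuous_id).tendsto 0
      rw [mul_zero] at this
      exact this.mono_left nhdsWithin_le_nhds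
    refine ge_of_tendsto ht ?_
    filter_upwards [self_mem_nhdsWithin] with ε hε using key ε hε
  exact eq_neg_of_add_eq_zero_left (norm_le_zero_iff.1 hz)

end Radial

section RadialConverse

variable {E : Type*} [NormedAddCommGroup E] [NormedSpace ℝ E]

lemma contDiffOn_radial_field (k : Fin 2) :
    ContDiffOn ℝ ∞ (fun x : Plane => x k / ‖x‖ ^ 2) {0}ᶜ :=
  (contDiff_coord k).contDiffOn.div (contDiffOn_norm.pow 2)
    fun _ hx => pow_ne_zero 2 (norm_ne_zero_iff.2 hx)

lemma norm_sq_plane (x : Plane) : ‖x‖ ^ 2 = x 0 ^ 2 + x 1 ^ 2 := by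
  rw [EuclideanSpace.norm_sq_eq, Fin.sum_univ_two]; simp

lemma pd_radial_field {x : Plane} (hx : x ≠ 0) (k : Fin 2) :
    pd k (fun x : Plane => x k / ‖x‖ ^ 2) x = 1 / ‖x‖ ^ 2 - 2 * x k ^ 2 / ‖x‖ ^ 4 := by
  have hn : ‖x‖ ≠ 0 := norm_ne_zero_iff.2 hx
  have e : (fun x : Plane => x k / ‖x‖ ^ 2) = fun x => x k * (‖x‖ ^ 2)⁻¹ := by
    ext; rw [div_eq_mul_inv]
  have hd : HasDerivAt (fun r : ℝ => (r ^ 2)⁻¹) (-(2 * ‖x‖) / (‖x‖ ^ 2) ^ 2) ‖x‖ := by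
    simpa using (hasDerivAt_pow 2 ‖x‖).fun_inv (pow_ne_zero 2 hn)
  have hdiff : DifferentiableAt ℝ (fun y : Plane => (‖y‖ ^ 2)⁻¹) x :=
    hd.differentiableAt.comp x ((contDiffAt_norm ℝ hx).differentiableAt (n := 1) (by simp))
  rw [e, pd_mul ((contDiff_coord k).differentiable (by simp) x) hdiff,
    pd_comp_norm (F := fun r : ℝ => (r ^ 2)⁻¹) hx hd, pd_coord]
  simp only [if_true, smul_eq_mul]
  field_simp
  ring

/-- The divergence-free radial field `x / |x|²` turns the weak derivatives of a radial function
into the derivative of its profile, tested against `η`. -/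
lemma integral_deriv_smul_of_wd [CompleteSpace E] {F : ℝ → E} {g : Fin 2 → Plane → E}
    (h : ∀ k, WD {0}ᶜ k (fun x => F ‖x‖) (g k)) {η : ℝ → ℝ} (hη : ContDiff ℝ ∞ η) {a b : ℝ}
    (ha : 0 < a) (hs : ∀ r, r ∉ Icc a b → η r = 0) :
    circ • ∫ r in Ioi (0 : ℝ), deriv η r • F r =
      -∫ x : Plane, η ‖x‖ • ∑ k, (x k / ‖x‖ ^ 2) • g k x := by
  have hs0 : ∀ x : Plane, ‖x‖ < a → η ‖x‖ = 0 := fun x hx => hs _ fun hm => by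
    linarith [hm.1]
  have hT : ∀ k : Fin 2, IsTest {0}ᶜ (fun x : Plane => η ‖x‖ * (x k / ‖x‖ ^ 2)) := by
    intro k
    have hsub : tsupport (fun x : Plane => η ‖x‖ * (x k / ‖x‖ ^ 2)) ⊆
        {x | ‖x‖ ∈ Icc a b} := by
      refine closure_minimal (fun x hx => ?_) (isClosed_Icc.preimage continuous_norm)
      by_contra hm
      exact hx (by simp [hs _ hm])
    refine ⟨?_, ?_, fun x hx => ?_⟩
    · rw [contDiff_iff_contDiffAt]
      intro x
      by_cases hx : x = 0
      · have : (fun x : Plane => η ‖x‖ * (x k / ‖x‖ ^ 2)) =ᶠ[𝓝 x] fun _ => 0 := by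
          filter_upwards [(isOpen_lt continuous_norm continuous_const).mem_nhds
            (show ‖x‖ < a by simpa [hx] using ha)] with y hy
          rw [hs0 y hy, zero_mul]
        exact contDiffAt_const.congr_of_eventuallyEq this
      · exact ((hη.contDiffAt.comp x (contDiffAt_norm ℝ hx)).mul
          ((contDiffOn_radial_field k).contDiffAt (isOpen_punctured.mem_nhds hx)))
    · refine HasCompactSupport.of_support_subset_isCompact (isCompact_closedBall (0 : Plane) b)
        ((subset_tsupport _).trans (hsub.trans fun x hx => ?_))
      simpa using hx.2
    · intro h0
      have := (hsub hx).1
      simp only [mem_singleton_iff] at h0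
      rw [h0, norm_zero] at this
      linarith
  have hpd : ∀ x : Plane, ∑ k, pd k (fun x : Plane => η ‖x‖ * (x k / ‖x‖ ^ 2)) x =
      ‖x‖⁻¹ * deriv η ‖x‖ := by
    intro x
    by_cases hx : x = 0
    · have : ∀ k, pd k (fun x : Plane => η ‖x‖ * (x k / ‖x‖ ^ 2)) x = 0 := by
        intro k
        by_contra hne
        exact (hT k).supp (tsupport_pd_subset k _ (subset_tsupport _ hne)) hx
      rw [Fin.sum_univ_two, this, this, hx]
      simp
    · have hn : ‖x‖ ≠ 0 := norm_ne_zero_iff.2 hx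
      have hd1 : DifferentiableAt ℝ (fun y : Plane => η ‖y‖) x :=
        (hη.differentiable (by simp) _).comp x
          ((contDiffAt_norm ℝ hx).differentiableAt (n := 1) (by simp))
      have hd2 : ∀ k : Fin 2, DifferentiableAt ℝ (fun x : Plane => x k / ‖x‖ ^ 2) x := fun k =>
        ((contDiffOn_radial_field k).contDiffAt (isOpen_punctured.mem_nhds hx)).differentiableAt
          (by simp)
      simp only [pd_mul hd1 (hd2 _), pd_radial_field hx,
        pd_comp_norm hx (hη.differentiable (by simp) ‖x‖).hasDerivAt, Fin.sum_univ_two, smul_eq_mul]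
      have h2 := norm_sq_plane x
      have h3 : x 1 ^ 2 = ‖x‖ ^ 2 - x 0 ^ 2 := by linarith
      field_simp
      rw [h3]
      ring
  have e1 : ∑ k, ∫ x : Plane, pd k (fun x : Plane => η ‖x‖ * (x k / ‖x‖ ^ 2)) x • F ‖x‖ =
      ∑ k, -∫ x : Plane, (η ‖x‖ * (x k / ‖x‖ ^ 2)) • g k x :=
    Finset.sum_congr rfl fun k _ => (h k).parts _ (hT k)
  rw [Finset.sum_neg_distrib, ← integral_finsetSum _ fun k _ =>
      ((hT k).pd k).integrable_smul (h k).lf,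
    ← integral_finsetSum _ fun k _ => (hT k).integrable_smul (h k).lg] at e1
  simp only [← Finset.sum_smul, hpd, mul_smul, ← Finset.smul_sum] at e1
  rw [← e1, integral_comp_norm (fun r => r⁻¹ • deriv η r • F r)]
  congr 1
  refine setIntegral_congr_fun measurableSet_Ioi fun r hr => ?_
  rw [smul_smul r, mul_inv_cancel₀ (ne_of_gt hr), one_smul]

/-- A smooth approximation of the indicator function of `(a, ∞)`. -/
def ramp (n : ℕ) (a r : ℝ) : ℝ := Real.smoothTransition (((n : ℝ) + 1) * (r - a))

lemma contDiff_ramp (n : ℕ) (a : ℝ) : ContDiff ℝ ∞ (ramp n a) := by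
  unfold ramp
  exact Real.smoothTransition.contDiff.comp (by fun_prop)

lemma ramp_of_le {n : ℕ} {a r : ℝ} (h : r ≤ a) : ramp n a r = 0 :=
  Real.smoothTransition.zero_of_nonpos (mul_nonpos_of_nonneg_of_nonpos (by positivity) (by linarith))

lemma ramp_of_ge {n : ℕ} {a r : ℝ} (h : a + 1 / ((n : ℝ) + 1) ≤ r) : ramp n a r = 1 := by
  refine Real.smoothTransition.one_of_one_le ?_
  have h0 : (0 : ℝ) < (n : ℝ) + 1 := by positivity
  rw [← div_le_iff₀' h0]; linarith

lemma deriv_smoothTransition_eq_zero {t : ℝ} (ht : t ∉ Icc (0 : ℝ) 1) :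
    deriv Real.smoothTransition t = 0 := by
  rw [mem_Icc, not_and_or, not_le, not_le] at ht
  rcases ht with ht | ht
  · have : Real.smoothTransition =ᶠ[𝓝 t] fun _ => 0 := by
      filter_upwards [Iio_mem_nhds ht] with s hs
      exact Real.smoothTransition.zero_of_nonpos (le_of_lt hs)
    rw [this.deriv_eq]; simp
  · have : Real.smoothTransition =ᶠ[𝓝 t] fun _ => 1 := by
      filter_upwards [Ioi_mem_nhds ht] with s hs
      exact Real.smoothTransition.one_of_one_le (le_of_lt hs)
    rw [this.deriv_eq]; simp

lemma continuous_deriv_smoothTransition : Continuous (deriv Real.smoothTransition) :=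
  (Real.smoothTransition.contDiff (n := 1)).continuous_deriv le_rfl

lemma hasCompactSupport_deriv_smoothTransition :
    HasCompactSupport (deriv Real.smoothTransition) :=
  HasCompactSupport.intro isCompact_Icc fun _ hx => deriv_smoothTransition_eq_zero hx

lemma integral_deriv_smoothTransition : ∫ t, deriv Real.smoothTransition t = 1 := by
  rw [← setIntegral_eq_integral_of_forall_compl_eq_zero (s := Icc 0 1)
    fun t ht => deriv_smoothTransition_eq_zero ht, integral_Icc_eq_integral_Ioc,
    ← intervalIntegral.integral_of_le zero_le_one,
    intervalIntegral.integral_deriv_eq_sub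
      (fun t _ => Real.smoothTransition.contDiff.differentiable (n := 1) (by simp) t)
      (continuous_deriv_smoothTransition.intervalIntegrable _ _)]
  simp

lemma deriv_ramp (n : ℕ) (a r : ℝ) :
    deriv (ramp n a) r = ((n : ℝ) + 1) * deriv Real.smoothTransition (((n : ℝ) + 1) * (r - a)) := by
  have h1 : HasDerivAt (fun r => ((n : ℝ) + 1) * (r - a)) ((n : ℝ) + 1) r := by
    simpa using ((hasDerivAt_id r).sub_const a).const_mul ((n : ℝ) + 1)
  have h2 := (Real.smoothTransition.contDiff.differentiable (n := 1) (by simp)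
    (((n : ℝ) + 1) * (r - a))).hasDerivAt.comp r h1
  rw [mul_comm]
  exact h2.deriv

lemma deriv_ramp_eq_zero {n : ℕ} {a r : ℝ} (hr : r ∉ Icc a (a + 1)) : deriv (ramp n a) r = 0 := by
  rw [deriv_ramp, deriv_smoothTransition_eq_zero, mul_zero]
  rw [mem_Icc, not_and_or, not_le, not_le] at hr ⊢
  have h0 : (1 : ℝ) ≤ (n : ℝ) + 1 := by linarith [Nat.cast_nonneg (α := ℝ) n]
  rcases hr with hr | hr
  · left; nlinarith
  · right; nlinarith

lemma integrable_deriv_ramp_smul (n : ℕ) {a : ℝ} (ha : 0 < a) {F : ℝ → E}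
    (hF : ContinuousOn F (Ioi 0)) : Integrable (fun r => deriv (ramp n a) r • F r) volume := by
  have h1 : ContinuousOn (fun r => deriv (ramp n a) r • F r) (Icc a (a + 1)) :=
    ((contDiff_ramp n a).continuous_deriv (by simp)).continuousOn.smul
      (hF.mono fun x hx => ha.trans_le hx.1)
  refine (integrableOn_iff_integrable_of_support_subset ?_).1 (h1.integrableOn_Icc (μ := volume))
  intro t ht
  by_contra hm
  exact ht (by simp [deriv_ramp_eq_zero hm])

lemma integral_deriv_ramp_smul (n : ℕ) (a : ℝ) (ha : 0 < a) (F : ℝ → E) :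
    ∫ r in Ioi (0 : ℝ), deriv (ramp n a) r • F r =
      ∫ t, deriv Real.smoothTransition t • F (a + t / ((n : ℝ) + 1)) := by
  have h0 : (0 : ℝ) < (n : ℝ) + 1 := by positivity
  rw [setIntegral_eq_integral_of_forall_compl_eq_zero]
  · have h1 := integral_sub_right_eq_self (μ := volume) (fun r => (((n : ℝ) + 1) *
      deriv Real.smoothTransition (((n : ℝ) + 1) * r)) • F (a + r)) a
    have h2 := Measure.integral_comp_mul_left
      (fun t => ((n : ℝ) + 1) • deriv Real.smoothTransition t • F (a + t / ((n : ℝ) + 1)))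
      ((n : ℝ) + 1)
    rw [integral_smul (μ := volume) ((n : ℝ) + 1)
      (fun t => deriv Real.smoothTransition t • F (a + t / ((n : ℝ) + 1))),
      abs_of_pos (inv_pos.2 h0), smul_smul, inv_mul_cancel₀ h0.ne', one_smul] at h2
    rw [← h2]
    convert h1 using 1
    · refine integral_congr_ae (.of_forall fun r => ?_)
      simp [deriv_ramp]
    · refine integral_congr_ae (.of_forall fun r => ?_)
      simp only [mul_smul]
      rw [mul_div_cancel_left₀ _ h0.ne']
  · intro r hr
    have : r ≤ 0 := not_lt.1 hr
    rw [deriv_ramp, deriv_smoothTransition_eq_zero, mul_zero, zero_smul]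
    intro hm
    have := hm.1
    nlinarith

lemma tendsto_integral_deriv_ramp_smul [CompleteSpace E] {F : ℝ → E} (hF : ContinuousOn F (Ioi 0))
    {a : ℝ} (ha : 0 < a) :
    Tendsto (fun n : ℕ => ∫ r in Ioi (0 : ℝ), deriv (ramp n a) r • F r) atTop (𝓝 (F a)) := by
  simp only [integral_deriv_ramp_smul _ a ha]
  have hlim : (∫ t, deriv Real.smoothTransition t • F a) = F a := by
    rw [integral_smul_const, integral_deriv_smoothTransition, one_smul]
  rw [← hlim]
  have hcont : ContinuousOn F (Icc a (a + 1)) := hF.mono fun x hx => ha.trans_le hx.1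
  obtain ⟨C, hC⟩ := isCompact_Icc.exists_bound_of_continuousOn hcont
  have hmem : ∀ (n : ℕ) (t : ℝ), t ∈ Icc (0 : ℝ) 1 → a + t / ((n : ℝ) + 1) ∈ Icc a (a + 1) := by
    intro n t ht
    have h0 : (0 : ℝ) < (n : ℝ) + 1 := by positivity
    have h1 : 0 ≤ t / ((n : ℝ) + 1) := div_nonneg ht.1 h0.le
    have h2 : t / ((n : ℝ) + 1) ≤ 1 := by
      rw [div_le_one h0]; linarith [ht.2, Nat.cast_nonneg (α := ℝ) n]
    exact ⟨by linarith, by linarith⟩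
  refine tendsto_integral_of_dominated_convergence
    (fun t => ‖deriv Real.smoothTransition t‖ * C) (fun n => ?_) ?_ (fun n => ?_) ?_
  · have : ContinuousOn (fun t => deriv Real.smoothTransition t • F (a + t / ((n : ℝ) + 1)))
        (Icc 0 1) :=
      continuous_deriv_smoothTransition.continuousOn.smul
        (hcont.comp (by fun_prop) fun t ht => hmem n t ht)
    have h2 := (this.integrableOn_Icc (μ := volume))
    refine ((integrableOn_iff_integrable_of_support_subset ?_).1 h2).aestronglyMeasurable
    intro t ht
    by_contra hm
    exact ht (by simp [deriv_smoothTransition_eq_zero hm])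
  · exact ((continuous_deriv_smoothTransition.integrable_of_hasCompactSupport
      hasCompactSupport_deriv_smoothTransition).norm).mul_const _
  · refine .of_forall fun t => ?_
    by_cases hm : t ∈ Icc (0 : ℝ) 1
    · rw [norm_smul]; gcongr; exact hC _ (hmem n t hm)
    · simp [deriv_smoothTransition_eq_zero hm]
  · refine .of_forall fun t => Tendsto.const_smul ?_ _
    refine ((hF.continuousAt (Ioi_mem_nhds ha)).tendsto).comp ?_
    have h3 : Tendsto (fun n : ℕ => t * (1 / ((n : ℝ) + 1))) atTop (𝓝 (t * 0)) :=
      tendsto_one_div_add_atTop_nhds_zero_nat.const_mul t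
    have h4 := h3.const_add a
    simpa [div_eq_mul_inv] using h4

/-- The increments of the profile of a radial function with weak derivatives away from the origin
are integrals over annuli. -/
lemma circ_smul_sub_eq_integral [CompleteSpace E] {F : ℝ → E} (hF : ContinuousOn F (Ioi 0))
    {g : Fin 2 → Plane → E} (h : ∀ k, WD {0}ᶜ k (fun x => F ‖x‖) (g k)) {a b : ℝ} (ha : 0 < a)
    (hab : a ≤ b) :
    circ • (F b - F a) = ∫ x in {x : Plane | ‖x‖ ∈ Ioc a b}, ∑ k, (x k / ‖x‖ ^ 2) • g k x := by
  set Y : Plane → E := fun x => ∑ k, (x k / ‖x‖ ^ 2) • g k x with hY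
  have hb : 0 < b := ha.trans_le hab
  have hYl : LocallyIntegrableOn Y {0}ᶜ volume := by
    have h1 := fun k => locallyIntegrableOn_smul isOpen_punctured (h k).lg
      (contDiffOn_radial_field k).continuousOn
    simp only [hY, Fin.sum_univ_two]
    exact (h1 0).add (h1 1)
  have hcomp : IsCompact {x : Plane | ‖x‖ ∈ Icc a (b + 1)} := by
    refine (isCompact_closedBall (0 : Plane) (b + 1)).of_isClosed_subset
      (isClosed_Icc.preimage continuous_norm) fun x hx => ?_
    simpa using hx.2
  have hYi : IntegrableOn Y {x : Plane | ‖x‖ ∈ Icc a (b + 1)} volume := by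
    refine hYl.integrableOn_compact_subset (fun x hx => ?_) hcomp
    intro h0
    have := hx.1
    simp only [mem_singleton_iff] at h0
    rw [h0, norm_zero] at this; linarith
  set η : ℕ → ℝ → ℝ := fun n r => ramp n a r - ramp n b r with hη
  have hinv : ∀ n : ℕ, 1 / ((n : ℝ) + 1) ≤ 1 := fun n => by
    rw [div_le_one (by positivity)]; linarith [Nat.cast_nonneg (α := ℝ) n]
  have hηs : ∀ n r, r ∉ Icc a (b + 1) → η n r = 0 := by
    intro n r hr
    rw [mem_Icc, not_and_or, not_le, not_le] at hr
    rcases hr with hr | hr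
    · simp [hη, ramp_of_le hr.le, ramp_of_le (hr.le.trans hab)]
    · have h1 := hinv n
      simp only [hη]
      rw [ramp_of_ge (by linarith), ramp_of_ge (by linarith), sub_self]
  have key : ∀ n : ℕ, circ • ((∫ r in Ioi (0 : ℝ), deriv (ramp n a) r • F r) -
      ∫ r in Ioi (0 : ℝ), deriv (ramp n b) r • F r) = -∫ x : Plane, η n ‖x‖ • Y x := by
    intro n
    rw [← integral_deriv_smul_of_wd h ((contDiff_ramp n a).sub (contDiff_ramp n b)) ha (hηs n),
      ← integral_sub]
    · congr 1
      refine integral_congr_ae (.of_forall fun r => ?_)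
      have e : deriv (η n) r = deriv (ramp n a) r - deriv (ramp n b) r :=
        deriv_fun_sub ((contDiff_ramp n a).differentiable (by simp) r)
          ((contDiff_ramp n b).differentiable (by simp) r)
      change _ = deriv (η n) r • F r
      rw [e, sub_smul]
    · exact (integrable_deriv_ramp_smul n ha hF).integrableOn
    · exact (integrable_deriv_ramp_smul n hb hF).integrableOn
  have l1 := ((tendsto_integral_deriv_ramp_smul hF ha).sub
    (tendsto_integral_deriv_ramp_smul hF hb)).const_smul circ
  simp only [key] at l1
  have l2 : Tendsto (fun n => ∫ x : Plane, η n ‖x‖ • Y x) atTop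
      (𝓝 (∫ x, {x : Plane | ‖x‖ ∈ Ioc a b}.indicator Y x)) := by
    set Z : Plane → E := {x : Plane | ‖x‖ ∈ Icc a (b + 1)}.indicator Y with hZ
    have hZi : Integrable Z volume := (integrable_indicator_iff hcomp.measurableSet).2 hYi
    have e : ∀ n : ℕ, (fun x : Plane => η n ‖x‖ • Y x) = fun x => η n ‖x‖ • Z x := by
      intro n
      ext1 x
      by_cases hx : x ∈ {x : Plane | ‖x‖ ∈ Icc a (b + 1)}
      · simp only [hZ, indicator_of_mem hx]
      · rw [hηs n _ hx, zero_smul, zero_smul]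
    simp only [e]
    refine tendsto_integral_of_dominated_convergence (fun x => ‖Z x‖) (fun n => ?_) hZi.norm
      (fun n => .of_forall fun x => ?_) (.of_forall fun x => ?_)
    · have : Continuous fun x : Plane => η n ‖x‖ :=
        ((contDiff_ramp n a).sub (contDiff_ramp n b)).continuous.comp continuous_norm
      exact this.aestronglyMeasurable.smul hZi.aestronglyMeasurable
    · rw [norm_smul]
      refine mul_le_of_le_one_left (norm_nonneg _) ?_
      have h1 := Real.smoothTransition.nonneg (((n : ℝ) + 1) * (‖x‖ - a))
      have h2 := Real.smoothTransition.le_one (((n : ℝ) + 1) * (‖x‖ - a))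
      have h3 := Real.smoothTransition.nonneg (((n : ℝ) + 1) * (‖x‖ - b))
      have h4 := Real.smoothTransition.le_one (((n : ℝ) + 1) * (‖x‖ - b))
      rw [Real.norm_eq_abs, abs_le]
      simp only [hη, ramp]
      constructor <;> linarith
    · have hev : ∀ c : ℝ, c < ‖x‖ → ∀ᶠ n : ℕ in atTop, ramp n c ‖x‖ = 1 := by
        intro c hc
        filter_upwards [tendsto_one_div_add_atTop_nhds_zero_nat.eventually
          (Iio_mem_nhds (sub_pos.2 hc))] with n hn
        exact ramp_of_ge (by linarith)
      rcases le_or_gt ‖x‖ a with h1 | h1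
      · have : x ∉ {x : Plane | ‖x‖ ∈ Ioc a b} := fun hm => (not_lt.2 h1) hm.1
        rw [indicator_of_notMem this]
        simp [hη, ramp_of_le h1, ramp_of_le (h1.trans hab)]
      · rcases le_or_gt ‖x‖ b with h2 | h2
        · rw [indicator_of_mem (show x ∈ {x : Plane | ‖x‖ ∈ Ioc a b} from ⟨h1, h2⟩)]
          refine tendsto_const_nhds.congr' ?_
          filter_upwards [hev a h1] with n hn
          have : x ∈ {x : Plane | ‖x‖ ∈ Icc a (b + 1)} := ⟨h1.le, by linarith⟩
          simp only [hη, hn, ramp_of_le h2, hZ, indicator_of_mem this, sub_zero, one_smul]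
        · have : x ∉ {x : Plane | ‖x‖ ∈ Ioc a b} := fun hm => (not_lt.2 hm.2) h2
          rw [indicator_of_notMem this]
          refine tendsto_const_nhds.congr' ?_
          filter_upwards [hev a h1, hev b h2] with n hn hn'
          simp only [hη, hn, hn', sub_self, zero_smul]
  have h3 := tendsto_nhds_unique l1 l2.neg
  have hm : MeasurableSet {x : Plane | ‖x‖ ∈ Ioc a b} := measurableSet_Ioc.preimage measurable_norm
  rw [integral_indicator hm] at h3
  rw [← neg_inj, ← h3, ← smul_neg, neg_sub]

/-- The profile of a radial function with weak derivatives away from the origin is locally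
absolutely continuous. -/
lemma locAC_of_wd_radial [CompleteSpace E] {F : ℝ → E} (hF : ContinuousOn F (Ioi 0))
    {g : Fin 2 → Plane → E} (h : ∀ k, WD {0}ᶜ k (fun x => F ‖x‖) (g k)) : LocAC F := by
  intro a b ha hab
  set Y : Plane → E := fun x => ∑ k, (x k / ‖x‖ ^ 2) • g k x with hY
  have hYl : LocallyIntegrableOn Y {0}ᶜ volume := by
    have h1 := fun k => locallyIntegrableOn_smul isOpen_punctured (h k).lg
      (contDiffOn_radial_field k).continuousOn
    simp only [hY, Fin.sum_univ_two]
    exact (h1 0).add (h1 1)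
  set A : Set Plane := {x : Plane | ‖x‖ ∈ Icc a b} with hA
  have hcomp : IsCompact A := by
    refine (isCompact_closedBall (0 : Plane) b).of_isClosed_subset
      (isClosed_Icc.preimage continuous_norm) fun x hx => ?_
    simpa using hx.2
  have hYi : IntegrableOn Y A volume := by
    refine hYl.integrableOn_compact_subset (fun x hx => ?_) hcomp
    intro h0
    have := hx.1
    simp only [mem_singleton_iff] at h0
    rw [h0, norm_zero] at this; linarith
  -- the mass of `|Y|` over annuli, as a measure on the radii
  set ν₀ : Measure Plane := (volume.restrict A).withDensity fun x => ‖Y x‖ₑ with hν₀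
  have : IsFiniteMeasure ν₀ := isFiniteMeasure_withDensity hYi.2.ne
  set ν : Measure ℝ := ν₀.map (fun x => ‖x‖) with hν
  have hac : ν ≪ volume := by
    refine Measure.AbsolutelyContinuous.mk fun s hs hs0 => ?_
    rw [hν, Measure.map_apply measurable_norm hs]
    refine (withDensity_absolutelyContinuous _ _) ?_
    refine Measure.absolutelyContinuous_of_le Measure.restrict_le_self ?_
    have := ae_comp_norm (P := fun r => r ∉ s)
      ((measure_eq_zero_iff_ae_notMem.1 hs0).mono fun r hr _ => hr)
    exact measure_eq_zero_iff_ae_notMem.2 this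
  have hfin : IsFiniteMeasure ν := Measure.isFiniteMeasure_map _ _
  have hint : Integrable (fun r => (ν.rnDeriv volume r).toReal) volume :=
    Measure.integrable_toReal_rnDeriv
  refine absolutelyContinuousOnInterval_of_norm_sub_le hab
    (g := fun r => circ⁻¹ * (ν.rnDeriv volume r).toReal)
    (hint.const_mul _).intervalIntegrable fun x y hax hxy hyb => ?_
  have e1 := circ_smul_sub_eq_integral hF h (ha.trans_le hax) hxy
  have hsub : {z : Plane | ‖z‖ ∈ Ioc x y} ⊆ A := fun z hz => ⟨hax.trans hz.1.le, hz.2.trans hyb⟩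
  have hm : MeasurableSet {z : Plane | ‖z‖ ∈ Ioc x y} :=
    measurableSet_Ioc.preimage measurable_norm
  have e2 : ∫ z in {z : Plane | ‖z‖ ∈ Ioc x y}, ‖Y z‖ = ∫ t in x..y, (ν.rnDeriv volume t).toReal := by
    rw [intervalIntegral.integral_of_le hxy, Measure.setIntegral_toReal_rnDeriv hac,
      integral_norm_eq_lintegral_enorm (hYi.mono_set hsub).aestronglyMeasurable, measureReal_def, hν,
      Measure.map_apply measurable_norm measurableSet_Ioc, hν₀]
    congr 1
    rw [withDensity_apply _ (measurableSet_Ioc.preimage measurable_norm),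
      Measure.restrict_restrict (measurableSet_Ioc.preimage measurable_norm)]
    congr 2
    exact (inter_eq_left.2 hsub).symm
  have e3 : circ * ‖F y - F x‖ ≤ ∫ t in x..y, (ν.rnDeriv volume t).toReal := by
    rw [← e2, ← abs_of_pos circ_pos, ← Real.norm_eq_abs, ← norm_smul, e1]
    exact norm_integral_le_integral_norm _
  rw [intervalIntegral.integral_const_mul, ← div_eq_inv_mul, le_div_iff₀ circ_pos, mul_comm]
  exact e3

end RadialConverse

/-! ### Linear differential equations with locally integrable coefficients -/

section LinearODE

variable {E : Type*} [NormedAddCommGroup E] [NormedSpace ℝ E]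

lemma uIcc_subset_pos {a b : ℝ} (ha : 0 < a) (hb : 0 < b) : uIcc a b ⊆ Ioi 0 :=
  fun _ hx => lt_of_lt_of_le (lt_min ha hb) hx.1

/-- Local integrability on `(0, ∞)`, in terms of interval integrals. -/
def LocInt (f : ℝ → E) : Prop := ∀ a b : ℝ, 0 < a → 0 < b → IntervalIntegrable f volume a b

lemma HasIntDeriv.locInt {F F' : ℝ → E} (h : HasIntDeriv F F') : LocInt F' := by
  intro a b ha hb
  rcases le_total a b with hab | hab
  · exact (h a b ha hab).1
  · exact (h b a hb hab).1.symm

lemma LocInt.hasIntDeriv {f : ℝ → E} (hf : LocInt f) (c : E) :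
    HasIntDeriv (fun r => c + ∫ t in (1 : ℝ)..r, f t) f := by
  intro a b ha hab
  have hb : 0 < b := ha.trans_le hab
  refine ⟨hf a b ha hb, ?_⟩
  rw [add_sub_add_left_eq_sub, intervalIntegral.integral_interval_sub_left (hf _ _ one_pos hb)
    (hf _ _ one_pos ha)]

lemma LocAC.comp_contDiff {g φ : ℝ → ℝ} (hg : LocAC g) (hφ : ContDiff ℝ 1 φ) :
    LocAC fun r => φ (g r) := by
  intro a b ha hab
  have hc : ContinuousOn g (uIcc a b) := (hg a b ha hab).continuousOn
  obtain ⟨R, hR⟩ := (isCompact_uIcc.image_of_continuousOn hc).isBounded.subset_closedBall 0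
  obtain ⟨C, hC⟩ := (isCompact_closedBall (0 : ℝ) R).exists_bound_of_continuousOn
    (hφ.continuous_deriv le_rfl).continuousOn
  refine absolutelyContinuousOnInterval_of_dist_le ((hg a b ha hab).const_mul C) ?_
  intro x hx y hy
  have h1 := (convex_closedBall (0 : ℝ) R).norm_image_sub_le_of_norm_deriv_le
    (fun z _ => hφ.differentiable one_ne_zero z) hC (hR ⟨y, hy, rfl⟩) (hR ⟨x, hx, rfl⟩)
  rw [dist_eq_norm, dist_eq_norm, ← mul_sub]
  refine h1.trans ?_
  rw [norm_mul]
  gcongr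
  exact Real.le_norm_self C

lemma HasIntDeriv.exp_mul {g g' : ℝ → ℝ} (h : HasIntDeriv g g') (c : ℝ) :
    HasIntDeriv (fun r => Real.exp (c * g r)) (fun r => Real.exp (c * g r) * (c * g' r)) := by
  have h1 : LocAC fun r => Real.exp (c * g r) :=
    h.locAC.comp_contDiff (φ := fun t => Real.exp (c * t)) (by fun_prop)
  intro a b ha hab
  have h2 := h1.hasIntDeriv_real a b ha hab
  have h3 : ∀ᵐ r : ℝ, r ∈ Ioc a b →
      deriv (fun r => Real.exp (c * g r)) r = Real.exp (c * g r) * (c * g' r) := by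
    filter_upwards [h.ae_hasDerivAt] with r hr hm
    exact ((hr (ha.trans hm.1)).const_mul c).exp.deriv
  refine ⟨h2.1.congr_ae ?_, ?_⟩
  · rw [uIoc_of_le hab]; exact (ae_restrict_iff' measurableSet_Ioc).2 h3
  · rw [h2.2]
    exact intervalIntegral.integral_congr_ae (by rwa [uIoc_of_le hab])

/-- Existence for a linear differential equation on `(0, ∞)` whose coefficient is only locally
integrable: a contraction for the norm weighted by `exp (-2 |∫₁ʳ ‖K‖|)`. -/
lemma exists_linear_ode [CompleteSpace E] {K : ℝ → E →L[ℝ] E} (hK : LocInt K) (v₀ : E) :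
    ∃ v : ℝ → E, HasIntDeriv v (fun r => K r (v r)) ∧ v 1 = v₀ := by
  have hn : LocInt fun r => ‖K r‖ := fun a b ha hb => (hK a b ha hb).norm
  set Λ : ℝ → ℝ := fun r => 0 + ∫ t in (1 : ℝ)..r, ‖K t‖ with hΛ
  have hΛd : HasIntDeriv Λ fun r => ‖K r‖ := hn.hasIntDeriv 0
  have hΛ1 : Λ 1 = 0 := by simp [hΛ]
  set L : ℝ → ℝ := fun r => |Λ r| with hL
  have hLc : ContinuousOn L (Ioi 0) := hΛd.locAC.continuousOn.abs
  have hL2 : ContinuousOn (fun r => 2 * L r) (Ioi 0) := continuousOn_const.mul hLc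
  have hmono : ∀ a b, 0 < a → a ≤ b → Λ a ≤ Λ b := fun a b ha hab => by
    have := (hΛd a b ha hab).2
    have h2 : 0 ≤ ∫ t in a..b, ‖K t‖ :=
      intervalIntegral.integral_nonneg hab fun _ _ => norm_nonneg _
    linarith
  -- the weighted integral that makes the map below a contraction
  have hweight : ∀ r, 0 < r → ‖∫ t in (1 : ℝ)..r, Real.exp (2 * L t) * ‖K t‖‖ ≤
      (Real.exp (2 * L r) - 1) / 2 := by
    intro r hr
    rcases le_total 1 r with h1 | h1
    · have e := (hΛd.exp_mul 2 1 r one_pos h1).2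
      have e2 : ∫ t in (1 : ℝ)..r, Real.exp (2 * L t) * ‖K t‖ =
          (∫ t in (1 : ℝ)..r, Real.exp (2 * Λ t) * (2 * ‖K t‖)) / 2 := by
        rw [← intervalIntegral.integral_div]
        refine intervalIntegral.integral_congr fun t ht => ?_
        rw [uIcc_of_le h1] at ht
        have : L t = Λ t := abs_of_nonneg (hΛ1 ▸ hmono 1 t one_pos ht.1)
        simp only [this]; ring
      have e3 : L r = Λ r := abs_of_nonneg (hΛ1 ▸ hmono 1 r one_pos h1)
      rw [e2, ← e]
      simp only
      rw [hΛ1, e3, mul_zero, Real.exp_zero, Real.norm_eq_abs, abs_of_nonneg]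
      have : 1 ≤ Real.exp (2 * Λ r) := Real.one_le_exp (by rw [← e3]; positivity)
      linarith
    · have e := (hΛd.exp_mul (-2) r 1 hr h1).2
      have e2 : ∫ t in r..(1 : ℝ), Real.exp (2 * L t) * ‖K t‖ =
          (∫ t in r..(1 : ℝ), Real.exp (-2 * Λ t) * (-2 * ‖K t‖)) / (-2) := by
        rw [← intervalIntegral.integral_div]
        refine intervalIntegral.integral_congr fun t ht => ?_
        rw [uIcc_of_le h1] at ht
        have : L t = -Λ t := abs_of_nonpos (hΛ1 ▸ hmono t 1 (hr.trans_le ht.1) ht.2)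
        simp only [this]; ring_nf
      have e3 : L r = -Λ r := abs_of_nonpos (hΛ1 ▸ hmono r 1 hr h1)
      have e4 : Real.exp (-2 * Λ r) = Real.exp (2 * L r) := by rw [e3]; ring_nf
      rw [intervalIntegral.integral_symm, norm_neg, e2, ← e]
      simp only
      rw [hΛ1, e4, mul_zero, Real.exp_zero, Real.norm_eq_abs, abs_of_nonneg]
      · linarith
      · have : 1 ≤ Real.exp (2 * L r) := Real.one_le_exp (by positivity)
        rw [div_neg, neg_nonneg]; linarith
  let X := BoundedContinuousFunction (Ioi (0 : ℝ)) E
  let ext : X → ℝ → E := fun z r => if h : 0 < r then z ⟨r, h⟩ else 0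
  have hext : ∀ (z : X) (r : Ioi (0 : ℝ)), ext z r = z r := fun z r => dif_pos r.2
  have hextc : ∀ z : X, ContinuousOn (ext z) (Ioi 0) := by
    intro z
    rw [continuousOn_iff_continuous_domRestrict]
    exact z.continuous.congr fun r => (hext z r).symm
  have hextb : ∀ (z : X) (r : ℝ), ‖ext z r‖ ≤ ‖z‖ := by
    intro z r
    by_cases h : 0 < r
    · simp only [ext, dif_pos h]; exact z.norm_coe_le_norm _
    · simp only [ext, dif_neg h, norm_zero]; exact norm_nonneg _
  let f : X → ℝ → E := fun z r => Real.exp (2 * L r) • K r (ext z r)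
  have hf : ∀ z, LocInt (f z) := by
    intro z a b ha hb
    have hs := uIcc_subset_pos ha hb
    have h1 : IntervalIntegrable (fun r => K r (ext z r)) volume a b := by
      rw [intervalIntegrable_iff]
      have hcz : AEStronglyMeasurable (ext z) (volume.restrict (uIoc a b)) :=
        ((hextc z).mono (uIoc_subset_uIcc.trans hs)).aestronglyMeasurable measurableSet_uIoc
      refine ((intervalIntegrable_iff.1 (hK a b ha hb)).norm.mul_const ‖z‖).mono'
        ((ContinuousLinearMap.id ℝ (E →L[ℝ] E)).aestronglyMeasurable_comp₂
          (intervalIntegrable_iff.1 (hK a b ha hb)).aestronglyMeasurable hcz)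
        (.of_forall fun r => ?_)
      exact ((K r).le_opNorm _).trans (by gcongr; exact hextb z r)
    exact h1.continuousOn_smul ((Real.continuous_exp.comp_continuousOn
      (hL2.mono hs)))
  have hdiff : ∀ (z z' : X) (r : ℝ), 0 < r →
      ‖(∫ t in (1 : ℝ)..r, f z t) - ∫ t in (1 : ℝ)..r, f z' t‖ ≤
        (Real.exp (2 * L r) - 1) / 2 * ‖z - z'‖ := by
    intro z z' r hr
    rw [← intervalIntegral.integral_sub (hf z 1 r one_pos hr) (hf z' 1 r one_pos hr)]
    have hw : IntervalIntegrable (fun t => Real.exp (2 * L t) * ‖K t‖) volume 1 r :=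
      (hn 1 r one_pos hr).continuousOn_mul (Real.continuous_exp.comp_continuousOn
        (hL2.mono (uIcc_subset_pos one_pos hr)))
    have h1 : ‖∫ t in (1 : ℝ)..r, (f z t - f z' t)‖ ≤
        |∫ t in (1 : ℝ)..r, Real.exp (2 * L t) * ‖K t‖ * ‖z - z'‖| := by
      refine intervalIntegral.norm_integral_le_abs_of_norm_le (.of_forall fun t => ?_)
        (hw.mul_const _)
      have e : f z t - f z' t = Real.exp (2 * L t) • K t (ext (z - z') t) := by
        simp only [f, ← smul_sub, ← map_sub]
        congr 2
        by_cases h : 0 < t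
        · simp only [ext, dif_pos h]; rfl
        · simp [ext, h]
      rw [e, norm_smul, Real.norm_of_nonneg (Real.exp_pos _).le, mul_assoc]
      gcongr
      exact ((K t).le_opNorm _).trans (by gcongr; exact hextb _ t)
    refine h1.trans ?_
    rw [intervalIntegral.integral_mul_const, abs_mul, abs_norm]
    gcongr
    exact hweight r hr
  have hf0 : ∀ r, ∫ t in (1 : ℝ)..r, f 0 t = 0 := by
    intro r
    have : f 0 = fun _ => 0 := by
      ext1 t
      have : ext 0 t = 0 := norm_le_zero_iff.1 ((hextb 0 t).trans norm_zero.le)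
      simp [f, this]
    simp [this]
  have hexp1 : ∀ r, 1 ≤ Real.exp (2 * L r) := fun r => Real.one_le_exp (by positivity)
  have hcontr : ∀ (z z' : X) (r : ℝ), 0 < r →
      ‖Real.exp (-(2 * L r)) • ((∫ t in (1 : ℝ)..r, f z t) - ∫ t in (1 : ℝ)..r, f z' t)‖ ≤
        1 / 2 * ‖z - z'‖ := by
    intro z z' r hr
    rw [norm_smul, Real.norm_of_nonneg (Real.exp_pos _).le]
    calc Real.exp (-(2 * L r)) * ‖(∫ t in (1 : ℝ)..r, f z t) - ∫ t in (1 : ℝ)..r, f z' t‖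
        ≤ Real.exp (-(2 * L r)) * (Real.exp (2 * L r) / 2 * ‖z - z'‖) := by
          gcongr
          refine (hdiff z z' r hr).trans ?_
          gcongr
          linarith
      _ = 1 / 2 * ‖z - z'‖ := by
          rw [Real.exp_neg]
          field_simp
  let T : X → X := fun z => BoundedContinuousFunction.ofNormedAddCommGroup
    (fun r : Ioi (0 : ℝ) => Real.exp (-(2 * L r)) • (v₀ + ∫ t in (1 : ℝ)..r, f z t))
    (by
      have h1 : ContinuousOn (fun r => Real.exp (-(2 * L r)) • (v₀ + ∫ t in (1 : ℝ)..r, f z t))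
          (Ioi 0) :=
        (Real.continuous_exp.comp_continuousOn hL2.neg).smul
          ((hf z).hasIntDeriv v₀).locAC.continuousOn
      exact continuousOn_iff_continuous_domRestrict.1 h1)
    (‖v₀‖ + 1 / 2 * ‖z‖)
    (by
      intro r
      have h1 := hcontr z 0 r r.2
      rw [hf0, sub_zero, sub_zero] at h1
      rw [smul_add]
      refine (norm_add_le _ _).trans (add_le_add ?_ h1)
      rw [norm_smul, Real.norm_of_nonneg (Real.exp_pos _).le]
      exact mul_le_of_le_one_left (norm_nonneg _) (Real.exp_le_one_iff.2 (by
        have : 0 ≤ L r := abs_nonneg _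
        linarith)))
  have hT : ∀ (z : X) (r : Ioi (0 : ℝ)),
      T z r = Real.exp (-(2 * L r)) • (v₀ + ∫ t in (1 : ℝ)..r, f z t) := fun z r => rfl
  have hTc : ContractingWith (1 / 2 : ℝ≥0) T := by
    refine ⟨by rw [← NNReal.coe_lt_coe]; norm_num, LipschitzWith.of_dist_le_mul fun z z' => ?_⟩
    rw [BoundedContinuousFunction.dist_le (by positivity)]
    intro r
    rw [dist_eq_norm, dist_eq_norm, hT, hT, ← smul_sub, add_sub_add_left_eq_sub]
    simpa using hcontr z z' r r.2
  obtain ⟨z, hz⟩ : ∃ z, T z = z := ⟨_, hTc.fixedPoint_isFixedPt⟩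
  have hv : ∀ r, 0 < r → Real.exp (2 * L r) • ext z r = v₀ + ∫ t in (1 : ℝ)..r, f z t := by
    intro r hr
    have h1 : ext z r = T z ⟨r, hr⟩ := by rw [hz]; exact hext z ⟨r, hr⟩
    rw [h1, hT, smul_smul, ← Real.exp_add]
    simp
  refine ⟨fun r => v₀ + ∫ t in (1 : ℝ)..r, f z t, ?_, by simp⟩
  have hd := (hf z).hasIntDeriv v₀
  intro a b ha hab
  have e : ∀ t ∈ uIcc a b, f z t = K t (v₀ + ∫ s in (1 : ℝ)..t, f z s) := by
    intro t ht
    have ht0 : 0 < t := uIcc_subset_pos ha (ha.trans_le hab) ht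
    rw [← hv t ht0, map_smul]
  refine ⟨(hd a b ha hab).1.congr fun t ht => e t (uIoc_subset_uIcc ht), ?_⟩
  rw [(hd a b ha hab).2]
  exact intervalIntegral.integral_congr e

end LinearODE

/-! ### Moving frames along a curve on the sphere -/

lemma inner_space (a b : Space) : inner ℝ a b = a 0 * b 0 + a 1 * b 1 + a 2 * b 2 := by
  simp only [PiLp.inner_apply, Fin.sum_univ_three, RCLike.inner_apply, conj_trivial]
  ring

lemma norm_sq_space (a : Space) : ‖a‖ ^ 2 = a 0 ^ 2 + a 1 ^ 2 + a 2 ^ 2 := by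
  rw [← real_inner_self_eq_norm_sq, inner_space]; ring

@[simp] lemma cross_zero_coord (a b : Space) : cross a b 0 = a 1 * b 2 - a 2 * b 1 := by
  simp [cross, cross_apply]

@[simp] lemma cross_one_coord (a b : Space) : cross a b 1 = a 2 * b 0 - a 0 * b 2 := by
  simp [cross, cross_apply]

@[simp] lemma cross_two_coord (a b : Space) : cross a b 2 = a 0 * b 1 - a 1 * b 0 := by
  simp [cross, cross_apply]

lemma space_ext {a b : Space} (h0 : a 0 = b 0) (h1 : a 1 = b 1) (h2 : a 2 = b 2) : a = b := by
  ext i; fin_cases i <;> assumption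

lemma tendsto_space_of_coord {α : Type*} {F : α → Space} {a : Space} {l : Filter α}
    (h0 : Tendsto (fun r => F r 0) l (𝓝 (a 0))) (h1 : Tendsto (fun r => F r 1) l (𝓝 (a 1)))
    (h2 : Tendsto (fun r => F r 2) l (𝓝 (a 2))) : Tendsto F l (𝓝 a) := by
  have h := (PiLp.continuous_toLp 2 (fun _ : Fin 3 => ℝ)).tendsto (WithLp.ofLp a)
  refine h.comp (tendsto_pi_nhds.2 fun i => ?_)
  fin_cases i <;> assumption

lemma tendsto_coord {α : Type*} {F : α → Space} {a : Space} {l : Filter α} (h : Tendsto F l (𝓝 a))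
    (i : Fin 3) : Tendsto (fun r => F r i) l (𝓝 (a i)) :=
  ((EuclideanSpace.proj (𝕜 := ℝ) i : Space →L[ℝ] ℝ).continuous.tendsto _).comp h

lemma tendsto_cross {α : Type*} {f g : α → Space} {a b : Space} {l : Filter α}
    (hf : Tendsto f l (𝓝 a)) (hg : Tendsto g l (𝓝 b)) :
    Tendsto (fun r => cross (f r) (g r)) l (𝓝 (cross a b)) := by
  have f0 := tendsto_coord hf 0
  have f1 := tendsto_coord hf 1
  have f2 := tendsto_coord hf 2
  have g0 := tendsto_coord hg 0
  have g1 := tendsto_coord hg 1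
  have g2 := tendsto_coord hg 2
  refine tendsto_space_of_coord ?_ ?_ ?_
  · simp only [cross_zero_coord]
    exact (f1.mul g2).sub (f2.mul g1)
  · simp only [cross_one_coord]
    exact (f2.mul g0).sub (f0.mul g2)
  · simp only [cross_two_coord]
    exact (f0.mul g1).sub (f1.mul g0)

lemma LocAC.mul {f g : ℝ → ℝ} (hf : LocAC f) (hg : LocAC g) : LocAC fun r => f r * g r :=
  fun a b ha hab => (hf a b ha hab).mul (hg a b ha hab)

lemma LocAC.add {E : Type*} [NormedAddCommGroup E] {f g : ℝ → E} (hf : LocAC f) (hg : LocAC g) :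
    LocAC fun r => f r + g r :=
  fun a b ha hab => (hf a b ha hab).add (hg a b ha hab)

lemma LocAC.sub {E : Type*} [NormedAddCommGroup E] {f g : ℝ → E} (hf : LocAC f) (hg : LocAC g) :
    LocAC fun r => f r - g r :=
  fun a b ha hab => (hf a b ha hab).sub (hg a b ha hab)

lemma LocAC.const_smul {E : Type*} [NormedAddCommGroup E] [NormedSpace ℝ E] {f : ℝ → E}
    (hf : LocAC f) (c : ℝ) : LocAC fun r => c • f r :=
  fun a b ha hab => (hf a b ha hab).const_smul c

lemma LocAC.inner {f g : ℝ → Space} (hf : LocAC f) (hg : LocAC g) :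
    LocAC fun r => inner ℝ (f r) (g r) := by
  simp only [inner_space]
  exact (((hf.coord 0).mul (hg.coord 0)).add ((hf.coord 1).mul (hg.coord 1))).add
    ((hf.coord 2).mul (hg.coord 2))

lemma LocAC.cross {f g : ℝ → Space} (hf : LocAC f) (hg : LocAC g) :
    LocAC fun r => cross (f r) (g r) := by
  refine LocAC.of_coord fun i => ?_
  fin_cases i
  · simpa using ((hf.coord 1).mul (hg.coord 2)).sub ((hf.coord 2).mul (hg.coord 1))
  · simpa using ((hf.coord 2).mul (hg.coord 0)).sub ((hf.coord 0).mul (hg.coord 2))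
  · simpa using ((hf.coord 0).mul (hg.coord 1)).sub ((hf.coord 1).mul (hg.coord 0))

lemma HasDerivAt.cross {f g : ℝ → Space} {f' g' : Space} {r : ℝ} (hf : HasDerivAt f f' r)
    (hg : HasDerivAt g g' r) :
    HasDerivAt (fun r => cross (f r) (g r)) (cross f' (g r) + cross (f r) g') r := by
  have hf := hasDerivAt_coord_iff.1 hf
  have hg := hasDerivAt_coord_iff.1 hg
  refine hasDerivAt_coord_iff.2 fun i => ?_
  fin_cases i
  · change HasDerivAt (fun r => EquivMap.cross (f r) (g r) 0) _ r
    simp only [cross_zero_coord]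
    exact (((hf 1).mul (hg 2)).sub ((hf 2).mul (hg 1))).congr_deriv (by simp; ring)
  · change HasDerivAt (fun r => EquivMap.cross (f r) (g r) 1) _ r
    simp only [cross_one_coord]
    exact (((hf 2).mul (hg 0)).sub ((hf 0).mul (hg 2))).congr_deriv (by simp; ring)
  · change HasDerivAt (fun r => EquivMap.cross (f r) (g r) 2) _ r
    simp only [cross_two_coord]
    exact (((hf 0).mul (hg 1)).sub ((hf 1).mul (hg 0))).congr_deriv (by simp; ring)

lemma inner_cross_right (p v : Space) : inner ℝ (cross p v) p = 0 := by
  rw [inner_space]; simp; ring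

lemma inner_cross_left (p v : Space) : inner ℝ v (cross p v) = 0 := by
  rw [inner_space]; simp; ring

/-- `p` and `v` are orthogonal unit vectors, so that `(v, p × v, p)` is an orthonormal basis. -/
structure OrthoPair (p v : Space) : Prop where
  norm_p : ‖p‖ = 1
  norm_v : ‖v‖ = 1
  orth : inner ℝ v p = 0

namespace OrthoPair

variable {p v : Space} (h : OrthoPair p v)
include h

lemma sq_p : p 0 ^ 2 + p 1 ^ 2 + p 2 ^ 2 = 1 := by rw [← norm_sq_space, h.norm_p, one_pow]
lemma sq_v : v 0 ^ 2 + v 1 ^ 2 + v 2 ^ 2 = 1 := by rw [← norm_sq_space, h.norm_v, one_pow]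
lemma dot : v 0 * p 0 + v 1 * p 1 + v 2 * p 2 = 0 := by rw [← inner_space, h.orth]

lemma norm_cross : ‖cross p v‖ = 1 := by
  have h1 : ‖cross p v‖ ^ 2 = 1 := by
    rw [norm_sq_space]
    simp only [cross_zero_coord, cross_one_coord, cross_two_coord]
    linear_combination (v 0 ^ 2 + v 1 ^ 2 + v 2 ^ 2) * h.sq_p + h.sq_v -
      (v 0 * p 0 + v 1 * p 1 + v 2 * p 2) * h.dot
  exact (pow_eq_one_iff_of_nonneg (norm_nonneg _) two_ne_zero).1 h1

lemma expand (X : Space) :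
    X = inner ℝ X v • v + inner ℝ X (cross p v) • cross p v + inner ℝ X p • p := by
  have hon : Orthonormal ℝ ![v, cross p v, p] := by
    rw [orthonormal_iff_ite]
    intro i j
    have e1 := inner_cross_right p v
    have e2 := inner_cross_left p v
    have e3 := h.orth
    fin_cases i <;> fin_cases j <;>
      simp [h.norm_p, h.norm_v, h.norm_cross, e1, e2, e3, real_inner_comm v, real_inner_comm (cross p v)]
  let b := (basisOfOrthonormalOfCardEqFinrank hon (by simp)).toOrthonormalBasis (by
    simpa using hon)
  have := b.sum_repr' X
  rw [Fin.sum_univ_three] at this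
  simp [b] at this
  rw [real_inner_comm v X, real_inner_comm (cross p v) X, real_inner_comm p X]
  exact this.symm

lemma cross_deriv {X : Space} (hX : inner ℝ X p = 0) :
    cross X v + cross p (-inner ℝ X v • p) = -inner ℝ X (cross p v) • p := by
  have e := h.expand X
  rw [hX, zero_smul, add_zero] at e
  set α := inner ℝ X v
  set β := inner ℝ X (cross p v)
  have e0 := h.sq_v
  have e1 := h.dot
  rw [e]
  refine space_ext ?_ ?_ ?_ <;> simp
  · linear_combination (-β * p 0) * e0 + β * v 0 * e1
  · linear_combination (-β * p 1) * e0 + β * v 1 * e1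
  · linear_combination (-β * p 2) * e0 + β * v 2 * e1

end OrthoPair

lemma inner_self_deriv {p : ℝ → Space} {p' : Space} {r c : ℝ} (hr : 0 < r)
    (h : HasDerivAt p p' r) (hn : ∀ r, 0 < r → ‖p r‖ = c) : inner ℝ p' (p r) = 0 := by
  have e1 := h.inner ℝ h
  have e2 : HasDerivAt (fun r => inner ℝ (p r) (p r)) (0 : ℝ) r := by
    refine (hasDerivAt_const r (c ^ 2)).congr_of_eventuallyEq ?_
    filter_upwards [Ioi_mem_nhds hr] with s hs
    rw [real_inner_self_eq_norm_sq, hn s hs]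
  have e3 := e1.unique e2
  rw [real_inner_comm p'] at e3
  linarith

lemma IsCoulombFrame.locAC {u : Plane → Space} {v : ℝ → Space} (h : IsCoulombFrame u v) :
    LocAC v := h.ac

/-- The structure equations of a Coulomb frame: `v̄' = -(ū' ⋅ v̄) ū` and `w̄' = -(ū' ⋅ w̄) ū`. -/
lemma IsCoulombFrame.ae_hasDerivAt {u : Plane → Space} {v : ℝ → Space} (h : IsCoulombFrame u v)
    (hp : LocAC (profile u)) (hn : ∀ r, 0 < r → ‖profile u r‖ = 1) :
    ∀ᵐ r : ℝ, 0 < r → HasDerivAt (profile u) (deriv (profile u) r) r ∧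
      inner ℝ (deriv (profile u) r) (profile u r) = 0 ∧
      HasDerivAt v (-inner ℝ (deriv (profile u) r) (v r) • profile u r) r ∧
      HasDerivAt (frameW u v) (-inner ℝ (deriv (profile u) r) (frameW u v r) • profile u r) r := by
  filter_upwards [hp.hasIntDeriv.ae_hasDerivAt, h.locAC.hasIntDeriv.ae_hasDerivAt,
    (ae_restrict_iff' measurableSet_Ioi).1 h.gauge] with r h1 h2 h3 hr
  have h1 := h1 hr
  have h2 := h2 hr
  have h3 : inner ℝ (deriv v r) (cross (profile u r) (v r)) = 0 := h3 hr
  have ho : OrthoPair (profile u r) (v r) := ⟨hn r hr, h.unit r hr, h.tangent r hr⟩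
  have d1 := inner_self_deriv hr h1 hn
  have d2 := inner_self_deriv hr h2 h.unit
  have d3 : inner ℝ (deriv v r) (profile u r) = -inner ℝ (deriv (profile u) r) (v r) := by
    have e1 := h2.inner ℝ h1
    have e2 : HasDerivAt (fun r => inner ℝ (v r) (profile u r)) (0 : ℝ) r := by
      refine (hasDerivAt_const r (0 : ℝ)).congr_of_eventuallyEq ?_
      filter_upwards [Ioi_mem_nhds hr] with s hs
      exact h.tangent s hs
    have e3 := e1.unique e2
    rw [real_inner_comm (deriv (profile u) r)] at e3
    linarith
  have hv : HasDerivAt v (-inner ℝ (deriv (profile u) r) (v r) • profile u r) r := by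
    have := ho.expand (deriv v r)
    rw [d2, h3, d3, zero_smul, zero_smul, zero_add, zero_add] at this
    rwa [← this]
  refine ⟨h1, d1, hv, ?_⟩
  have hw := HasDerivAt.cross h1 hv
  refine hw.congr_deriv ?_
  exact ho.cross_deriv d1

lemma exists_unit_orthogonal (p : Space) : ∃ v : Space, ‖v‖ = 1 ∧ inner ℝ v p = 0 := by
  obtain ⟨x, hx, hxo⟩ : ∃ x : Space, x ≠ 0 ∧ inner ℝ x p = 0 := by
    by_cases h : p 0 = 0
    · refine ⟨vecI, fun h0 => ?_, by simp [inner_space, vecI, h]⟩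
      have := congrArg (fun a : Space => a 0) h0
      simp [vecI] at this
    · refine ⟨!₂[-p 1, p 0, 0], fun h0 => ?_, by simp [inner_space]; ring⟩
      have := congrArg (fun a : Space => a 1) h0
      simp [h] at this
  refine ⟨‖x‖⁻¹ • x, by simp [norm_smul, hx], by rw [inner_smul_left, hxo, mul_zero]⟩

/-- Parallel transport along a curve on the sphere. -/
lemma exists_parallel {p : ℝ → Space} (hp : LocAC p) (hn : ∀ r, 0 < r → ‖p r‖ = 1) :
    ∃ v : ℝ → Space, HasIntDeriv v (fun r => -inner ℝ (deriv p r) (v r) • p r) ∧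
      ∀ r, 0 < r → OrthoPair (p r) (v r) := by
  set K : ℝ → Space →L[ℝ] Space := fun r => (innerSL ℝ (-deriv p r)).smulRight (p r) with hKd
  have hK : LocInt K := by
    intro a b ha hb
    have hi := intervalIntegrable_iff.1 (hp.hasIntDeriv.locInt a b ha hb)
    have hs := uIcc_subset_pos ha hb
    have hc : AEStronglyMeasurable p (volume.restrict (uIoc a b)) :=
      (hp.continuousOn.mono (uIoc_subset_uIcc.trans hs)).aestronglyMeasurable measurableSet_uIoc
    rw [intervalIntegrable_iff]
    refine hi.norm.mono' ?_ ?_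
    · exact (ContinuousLinearMap.smulRightL ℝ Space Space).aestronglyMeasurable_comp₂
        ((innerSL ℝ).continuous.comp_aestronglyMeasurable hi.aestronglyMeasurable.neg) hc
    · refine (ae_restrict_iff' measurableSet_uIoc).2 (.of_forall fun r hr => ?_)
      simp [hKd, ContinuousLinearMap.norm_smulRight_apply, hn r (hs (uIoc_subset_uIcc hr))]
  obtain ⟨v₀, hv0, hvo⟩ := exists_unit_orthogonal (p 1)
  obtain ⟨v, hv, hv1⟩ := exists_linear_ode hK v₀
  have hKv : ∀ r, K r (v r) = -inner ℝ (deriv p r) (v r) • p r := fun r => by simp [hKd]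
  simp only [hKv] at hv
  have hd : ∀ᵐ r : ℝ, 0 < r → HasDerivAt p (deriv p r) r ∧
      HasDerivAt v (-inner ℝ (deriv p r) (v r) • p r) r := by
    filter_upwards [hp.hasIntDeriv.ae_hasDerivAt, hv.ae_hasDerivAt] with r h1 h2 hr
    exact ⟨h1 hr, h2 hr⟩
  have horth : ∀ r, 0 < r → inner ℝ (v r) (p r) = 0 := by
    intro r hr
    have := (hv.locAC.inner hp).const_of_deriv_zero (E := ℝ) (by
      filter_upwards [hd] with r h hr
      have e := (h hr).2.inner ℝ (h hr).1
      refine e.congr_deriv ?_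
      rw [inner_smul_left, real_inner_self_eq_norm_sq, hn r hr, real_inner_comm (deriv p r)]
      simp) hr one_pos
    rw [this, hv1, hvo]
  have hunit : ∀ r, 0 < r → ‖v r‖ = 1 := by
    intro r hr
    have := (hv.locAC.inner hv.locAC).const_of_deriv_zero (E := ℝ) (by
      filter_upwards [hd] with r h hr
      have e := (h hr).2.inner ℝ (h hr).2
      refine e.congr_deriv ?_
      rw [inner_smul_right, inner_smul_left, real_inner_comm (v r) (p r), horth r hr]
      simp) hr one_pos
    simp only [real_inner_self_eq_norm_sq] at this
    rw [hv1, hv0, one_pow] at this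
    exact (pow_eq_one_iff_of_nonneg (norm_nonneg _) two_ne_zero).1 this
  exact ⟨v, hv, fun r hr => ⟨hn r hr, hunit r hr, horth r hr⟩⟩

/-- A Coulomb frame exists as soon as the horizontal part of the transport equation is integrable
at infinity: a parallel frame then has a horizontal limit, and a constant rotation of the frame
makes this limit equal to `i`. -/
lemma exists_isCoulombFrame {u : Plane → Space} (hp : LocAC (profile u))
    (hn : ∀ r, 0 < r → ‖profile u r‖ = 1) (hlim : Tendsto (profile u) atTop (𝓝 (-vecK)))
    (hint : ∀ i : Fin 3, i ≠ 2 →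
      IntegrableOn (fun r => ‖deriv (profile u) r‖ * |profile u r i|) (Ioi 1)) :
    ∃ v, IsCoulombFrame u v := by
  set p := profile u with hpd
  obtain ⟨v, hv, ho⟩ := exists_parallel hp hn
  have hplim := tendsto_coord hlim
  have hp0 := hplim 0
  have hp1 := hplim 1
  have hp2 := hplim 2
  simp [vecK] at hp0 hp1 hp2
  -- the horizontal components have limits
  have hhor : ∀ i : Fin 3, i ≠ 2 → ∃ l, Tendsto (fun r => v r i) atTop (𝓝 l) := by
    intro i hi
    have hfi : ∀ r, 1 < r → ∫ t in (1 : ℝ)..r, -inner ℝ (deriv p t) (v t) * p t i =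
        v r i - v 1 i := by
      intro r hr
      have h1 := hv 1 r one_pos hr.le
      have h2 := (EuclideanSpace.proj (𝕜 := ℝ) i : Space →L[ℝ] ℝ).intervalIntegral_comp_comm h1.1
      rw [← h1.2] at h2
      simpa using h2
    have hmeas : AEStronglyMeasurable (fun t => -inner ℝ (deriv p t) (v t) * p t i)
        (volume.restrict (Ioi 1)) := by
      have hs : Ioi (1 : ℝ) ⊆ Ioi 0 := Ioi_subset_Ioi zero_le_one
      have c1 := (hv.locAC.continuousOn.mono hs).aestronglyMeasurable (μ := volume) measurableSet_Ioi
      have c2 := ((hp.coord i).continuousOn.mono hs).aestronglyMeasurable (μ := volume)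
        measurableSet_Ioi
      exact (((measurable_deriv p).aestronglyMeasurable.inner c1).neg).mul c2
    have hI : IntegrableOn (fun t => -inner ℝ (deriv p t) (v t) * p t i) (Ioi 1) := by
      refine (hint i hi).mono' hmeas ((ae_restrict_iff' measurableSet_Ioi).2
        (.of_forall fun t ht => ?_))
      rw [norm_mul, norm_neg, Real.norm_eq_abs (p t i)]
      gcongr
      refine (norm_inner_le_norm _ _).trans ?_
      rw [(ho t (one_pos.trans ht)).norm_v, mul_one]
    have h3 := intervalIntegral_tendsto_integral_Ioi 1 hI tendsto_id
    refine ⟨_, ((h3.const_add (v 1 i)).congr' ?_)⟩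
    filter_upwards [Ioi_mem_atTop 1] with r hr
    rw [id, hfi r hr]; ring
  obtain ⟨a, ha⟩ := hhor 0 (by decide)
  obtain ⟨b, hb⟩ := hhor 1 (by decide)
  have hc : Tendsto (fun r => v r 2) atTop (𝓝 0) := by
    have h1 : Tendsto (fun r => -(v r 0 * p r 0 + v r 1 * p r 1) / p r 2) atTop
        (𝓝 (-(a * 0 + b * 0) / (-1))) :=
      (((ha.mul hp0).add (hb.mul hp1)).neg).div hp2 (by norm_num)
    simp only [mul_zero, add_zero, neg_zero, zero_div] at h1
    refine h1.congr' ?_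
    filter_upwards [hp2.eventually (Iio_mem_nhds (show (-1 : ℝ) < 0 by norm_num)),
      Ioi_mem_atTop 0] with r hr hr0
    have h2 := (ho r hr0).dot
    rw [div_eq_iff (ne_of_lt hr)]
    linarith
  have hab : a ^ 2 + b ^ 2 = 1 := by
    have h1 : Tendsto (fun r => v r 0 ^ 2 + v r 1 ^ 2 + v r 2 ^ 2) atTop
        (𝓝 (a ^ 2 + b ^ 2 + 0 ^ 2)) := ((ha.pow 2).add (hb.pow 2)).add (hc.pow 2)
    have h2 : Tendsto (fun r => v r 0 ^ 2 + v r 1 ^ 2 + v r 2 ^ 2) atTop (𝓝 1) := by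
      refine tendsto_const_nhds.congr' ?_
      filter_upwards [Ioi_mem_atTop 0] with r hr
      exact ((ho r hr).sq_v).symm
    have := tendsto_nhds_unique h1 h2
    linarith
  set w : ℝ → Space := fun r => cross (p r) (v r) with hw
  have hwac : LocAC w := hp.cross hv.locAC
  have tv : Tendsto (fun r => a • v r + b • w r) atTop (𝓝 vecI) := by
    refine tendsto_space_of_coord ?_ ?_ ?_
    · have h1 := (ha.const_mul a).add (((hp1.mul hc).sub (hp2.mul hb)).const_mul b)
      have e : a * a + b * (0 * 0 - -1 * b) = vecI 0 := by simp [vecI]; linarith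
      rw [e] at h1
      simpa [hw] using h1
    · have h1 := (hb.const_mul a).add (((hp2.mul ha).sub (hp0.mul hc)).const_mul b)
      have e : a * b + b * (-1 * a - 0 * 0) = vecI 1 := by simp [vecI]; ring
      rw [e] at h1
      simpa [hw] using h1
    · have h1 := (hc.const_mul a).add (((hp0.mul hb).sub (hp1.mul ha)).const_mul b)
      have e : a * 0 + b * (0 * b - 0 * a) = vecI 2 := by simp [vecI]
      rw [e] at h1
      simpa [hw] using h1
  refine ⟨fun r => a • v r + b • w r, ?_, ?_, ?_, ?_, tv, ?_⟩
  · exact (hv.locAC.const_smul a).add (hwac.const_smul b)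
  · intro r hr
    have h1 : ‖a • v r + b • w r‖ ^ 2 = 1 := by
      rw [norm_add_sq_real, norm_smul, norm_smul, inner_smul_left, inner_smul_right,
        inner_cross_left, (ho r hr).norm_v, (ho r hr).norm_cross]
      simpa using hab
    exact (pow_eq_one_iff_of_nonneg (norm_nonneg _) two_ne_zero).1 h1
  · intro r hr
    rw [inner_add_left, inner_smul_left, inner_smul_left, inner_cross_right]
    simp [← hpd, (ho r hr).orth]
  · refine (ae_restrict_iff' measurableSet_Ioi).2 ?_
    filter_upwards [hp.hasIntDeriv.ae_hasDerivAt, hv.ae_hasDerivAt] with r h1 h2 hr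
    have h1 := h1 hr
    have h2 := h2 hr
    have d1 := inner_self_deriv hr h1 hn
    have h3 : HasDerivAt w _ r := (HasDerivAt.cross h1 h2).congr_deriv ((ho r hr).cross_deriv d1)
    have h4 := ((h2.const_smul a).add (h3.const_smul b)).deriv
    change inner ℝ (deriv (fun r => a • v r + b • w r) r) (cross (p r) (a • v r + b • w r)) = 0
    rw [show (fun r => a • v r + b • w r) = a • v + b • w from rfl, h4]
    have h5 : inner ℝ (p r) (cross (p r) (a • v r + b • w r)) = 0 := by
      rw [real_inner_comm]; exact inner_cross_right _ _
    rw [inner_add_left, inner_smul_left, inner_smul_left, inner_smul_left, inner_smul_left, h5]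
    simp
  · have h1 : Tendsto (fun r => cross (p r) (a • v r + b • w r)) atTop (𝓝 (cross (-vecK) vecI)) :=
      tendsto_cross hlim tv
    have e : cross (-vecK) vecI = -vecJ := by
      refine space_ext ?_ ?_ ?_ <;> simp [vecI, vecJ, vecK]
    rw [e] at h1
    exact h1

/-! ### Quantitative membership in `L²` and `H²` -/

section Quantitative

variable {F G : Type*} [NormedAddCommGroup F] [NormedAddCommGroup G]

/-- `f ∈ L²(ℝ²)` with `‖f‖ ≤ K`. -/
def L2Bd (f : Plane → F) (K : ℝ≥0) : Prop :=
  AEStronglyMeasurable f volume ∧ eLpNorm f 2 volume ≤ K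

namespace L2Bd

variable {f g : Plane → F} {K K' : ℝ≥0}

lemma memLp (h : L2Bd f K) : MemLp f 2 volume := ⟨h.1, h.2.trans_lt ENNReal.coe_lt_top⟩

lemma mono (h : L2Bd f K) (hK : K ≤ K') : L2Bd f K' :=
  ⟨h.1, h.2.trans (ENNReal.coe_le_coe.2 hK)⟩

lemma add (h : L2Bd f K) (h' : L2Bd g K') : L2Bd (fun x => f x + g x) (K + K') := by
  refine ⟨h.1.add h'.1, (eLpNorm_add_le h.1 h'.1 (by norm_num)).trans ?_⟩
  rw [ENNReal.coe_add]
  exact add_le_add h.2 h'.2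

lemma norm (h : L2Bd f K) : L2Bd (fun x => ‖f x‖) K :=
  ⟨h.1.norm, by rw [eLpNorm_norm]; exact h.2⟩

lemma of_le {b : Plane → ℝ} (hf : AEStronglyMeasurable f volume) (hb : L2Bd b K)
    (h : ∀ᵐ x, ‖f x‖ ≤ b x) : L2Bd f K :=
  ⟨hf, (eLpNorm_mono_ae (h.mono fun _ hx => hx.trans (Real.le_norm_self _))).trans hb.2⟩

lemma const_mul {b : Plane → ℝ} (hb : L2Bd b K) (c : ℝ≥0) : L2Bd (fun x => c * b x) (c * K) := by
  refine ⟨hb.1.const_mul _, ?_⟩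
  have : eLpNorm (fun x => (c : ℝ) * b x) 2 volume = ‖(c : ℝ)‖ₑ * eLpNorm b 2 volume :=
    eLpNorm_const_smul (c : ℝ) b 2 volume
  rw [this, ENNReal.coe_mul]
  gcongr
  · simp
  · exact hb.2

lemma congr (h : L2Bd f K) (hfg : f =ᵐ[volume] g) : L2Bd g K :=
  ⟨h.1.congr hfg, by rw [← eLpNorm_congr_ae hfg]; exact h.2⟩

lemma clm [NormedSpace ℝ F] [NormedSpace ℝ G] (h : L2Bd f K) (L : F →L[ℝ] G) :
    L2Bd (fun x => L (f x)) (‖L‖₊ * K) :=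
  of_le (L.continuous.comp_aestronglyMeasurable h.1) (h.norm.const_mul ‖L‖₊)
    (.of_forall fun _ => L.le_opNorm _)

end L2Bd

variable [NormedSpace ℝ F] [NormedSpace ℝ G]

lemma WD.aestronglyMeasurable_left {i : Fin 2} {f g : Plane → F} (h : WD univ i f g) :
    AEStronglyMeasurable f volume :=
  (locallyIntegrableOn_univ.1 h.lf).aestronglyMeasurable

lemma WD.aestronglyMeasurable_right {i : Fin 2} {f g : Plane → F} (h : WD univ i f g) :
    AEStronglyMeasurable g volume :=
  (locallyIntegrableOn_univ.1 h.lg).aestronglyMeasurable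

/-- The weak derivatives of order one and two of `f`. -/
structure SecondDerivs (f : Plane → F) (f₁ : Fin 2 → Plane → F) (f₂ : Fin 2 → Fin 2 → Plane → F) :
    Prop where
  wd₁ : ∀ i, WD univ i f (f₁ i)
  wd₂ : ∀ i j, WD univ j (f₁ i) (f₂ i j)

/-- `f ∈ H²(ℝ²)` with `‖f‖ ≤ P` and second derivatives of norm at most `K` in `L²`. -/
def H2Bd (f : Plane → F) (P K : ℝ≥0) : Prop :=
  ∃ f₁ f₂, SecondDerivs f f₁ f₂ ∧ L2Bd f P ∧ ∀ i j, L2Bd (f₂ i j) K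

lemma H2Bd.mono {f : Plane → F} {P K P' K' : ℝ≥0} (h : H2Bd f P K) (hP : P ≤ P') (hK : K ≤ K') :
    H2Bd f P' K' := by
  obtain ⟨f₁, f₂, h1, h2, h3⟩ := h
  exact ⟨f₁, f₂, h1, h2.mono hP, fun i j => (h3 i j).mono hK⟩

lemma H2Bd.add {f g : Plane → F} {P K P' K' : ℝ≥0} (h : H2Bd f P K) (h' : H2Bd g P' K') :
    H2Bd (fun x => f x + g x) (P + P') (K + K') := by
  obtain ⟨f₁, f₂, h1, h2, h3⟩ := h
  obtain ⟨g₁, g₂, k1, k2, k3⟩ := h'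
  exact ⟨fun i x => f₁ i x + g₁ i x, fun i j x => f₂ i j x + g₂ i j x,
    ⟨fun i => (h1.wd₁ i).add (k1.wd₁ i), fun i j => (h1.wd₂ i j).add (k1.wd₂ i j)⟩, h2.add k2,
    fun i j => (h3 i j).add (k3 i j)⟩

lemma H2Bd.clm [CompleteSpace F] [CompleteSpace G] {f : Plane → F} {P K : ℝ≥0} (h : H2Bd f P K)
    (L : F →L[ℝ] G) : H2Bd (fun x => L (f x)) (‖L‖₊ * P) (‖L‖₊ * K) := by
  obtain ⟨f₁, f₂, h1, h2, h3⟩ := h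
  exact ⟨fun i x => L (f₁ i x), fun i j x => L (f₂ i j x),
    ⟨fun i => (h1.wd₁ i).clm L, fun i j => (h1.wd₂ i j).clm L⟩, h2.clm L, fun i j => (h3 i j).clm L⟩

lemma H2Bd.congr {f g : Plane → F} {P K : ℝ≥0} (h : H2Bd f P K) (hfg : f =ᵐ[volume] g) :
    H2Bd g P K := by
  obtain ⟨f₁, f₂, h1, h2, h3⟩ := h
  exact ⟨f₁, f₂, ⟨fun i => (h1.wd₁ i).congr hfg .rfl, h1.wd₂⟩, h2.congr hfg, h3⟩

lemma SecondDerivs.hasWeakDeriv {f : Plane → F} {f₁ : Fin 2 → Plane → F}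
    {f₂ : Fin 2 → Fin 2 → Plane → F} (h : SecondDerivs f f₁ f₂) (w : Fin 2 → Fin 2) :
    HasWeakDeriv w f (f₂ (w 0) (w 1)) :=
  (hasWeakDeriv_succ_iff (h.wd₁ (w 0))).2 (hasWeakDeriv_one_iff.2 (h.wd₂ (w 0) (w 1)))

/-- Interpolation: the first derivatives and the supremum of `f` are controlled by the `L²` norms
of `f` and of its second derivatives. -/
lemma SecondDerivs.interp {E : Type*} [NormedAddCommGroup E] [InnerProductSpace ℝ E]
    [CompleteSpace E] {f : Plane → E} {f₁ : Fin 2 → Plane → E} {f₂ : Fin 2 → Fin 2 → Plane → E}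
    {P K : ℝ≥0} (h : SecondDerivs f f₁ f₂) (hf : L2Bd f P) (hf₂ : ∀ i j, L2Bd (f₂ i j) K) :
    (∀ i, L2Bd (f₁ i) (NNReal.sqrt (P * K))) ∧ ∀ᵐ x, ‖f x‖ ≤ (2 * NNReal.sqrt (P * K) : ℝ≥0) := by
  obtain ⟨g, hg, -, hg2, hs⟩ := exists_weakDeriv_of_second hf.memLp (h := f₂)
    (fun i j => by simpa using h.hasWeakDeriv ![i, j]) fun i j => (hf₂ i j).memLp
  have hgb : ∀ i, eLpNorm (g i) 2 volume ≤ (NNReal.sqrt (P * K) : ℝ≥0) := by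
    intro i
    have h1 : eLpNorm (g i) 2 volume ^ 2 ≤ ((NNReal.sqrt (P * K) : ℝ≥0) : ℝ≥0∞) ^ 2 := by
      refine (hg2 i).trans ((mul_le_mul' hf.2 (hf₂ i i).2).trans (le_of_eq ?_))
      rw [← ENNReal.coe_mul, ← ENNReal.coe_pow, NNReal.sq_sqrt]
    exact (ENNReal.pow_le_pow_left_iff two_ne_zero).1 h1
  refine ⟨fun i => ?_, ?_⟩
  · have e := (hg i).unique isOpen_univ (h.wd₁ i)
    exact L2Bd.congr ⟨(hg i).aestronglyMeasurable_right, hgb i⟩ (e.mono fun x hx => hx (mem_univ x))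
  · filter_upwards [hs] with x hx
    have h1 : ‖f x‖ₑ ^ 2 ≤ ((2 * NNReal.sqrt (P * K) : ℝ≥0) : ℝ≥0∞) ^ 2 := by
      refine hx.trans ?_
      calc 2 * (eLpNorm f 2 volume * eLpNorm (f₂ 0 1) 2 volume +
            eLpNorm (g 0) 2 volume * eLpNorm (g 1) 2 volume)
          ≤ 2 * ((P : ℝ≥0∞) * K + (NNReal.sqrt (P * K) : ℝ≥0) * (NNReal.sqrt (P * K) : ℝ≥0)) := by
            gcongr
            exacts [hf.2, (hf₂ 0 1).2, hgb 0, hgb 1]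
        _ = ((2 * NNReal.sqrt (P * K) : ℝ≥0) : ℝ≥0∞) ^ 2 := by
            rw [← ENNReal.coe_mul, ← ENNReal.coe_mul, NNReal.mul_self_sqrt, ← ENNReal.coe_add,
              ← ENNReal.coe_pow, mul_pow, NNReal.sq_sqrt,
              show (2 : ℝ≥0∞) = ((2 : ℝ≥0) : ℝ≥0∞) from rfl, ← ENNReal.coe_mul]
            congr 1
            ring
    have h2 := (ENNReal.pow_le_pow_left_iff two_ne_zero).1 h1
    rw [enorm_eq_nnnorm, ENNReal.coe_le_coe] at h2
    exact_mod_cast h2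

/-! ### Comparison with the norms of `Ḣᵏ` and `H²` -/

lemma le_rpow_half_sum {ι : Type*} (s : Finset ι) (a : ι → ℝ≥0∞) {i : ι} (hi : i ∈ s) :
    a i ≤ (∑ j ∈ s, a j ^ 2) ^ (1 / 2 : ℝ) := by
  have h1 : a i = (a i ^ 2) ^ (1 / 2 : ℝ) := by
    rw [← ENNReal.rpow_natCast, ← ENNReal.rpow_mul]; norm_num
  rw [h1]
  exact ENNReal.rpow_le_rpow (Finset.single_le_sum (f := fun j => a j ^ 2) (fun _ _ => zero_le) hi)
    (by norm_num)

lemma rpow_half_sum_le {ι : Type*} (s : Finset ι) (a : ι → ℝ≥0∞) {K : ℝ≥0∞}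
    (h : ∀ i ∈ s, a i ≤ K) : (∑ j ∈ s, a j ^ 2) ^ (1 / 2 : ℝ) ≤ s.card * K := by
  have h1 : ∑ j ∈ s, a j ^ 2 ≤ (s.card * K) ^ 2 := by
    calc ∑ j ∈ s, a j ^ 2 ≤ ∑ j ∈ s, K ^ 2 :=
          Finset.sum_le_sum fun j hj => pow_le_pow_left' (h j hj) 2
      _ = s.card * K ^ 2 := by rw [Finset.sum_const, nsmul_eq_mul]
      _ ≤ (s.card * K) ^ 2 := by
          rw [mul_pow]
          gcongr
          exact_mod_cast Nat.le_self_pow two_ne_zero _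
  calc (∑ j ∈ s, a j ^ 2) ^ (1 / 2 : ℝ) ≤ ((s.card * K) ^ 2) ^ (1 / 2 : ℝ) :=
        ENNReal.rpow_le_rpow h1 (by norm_num)
    _ = s.card * K := by rw [← ENNReal.rpow_natCast, ← ENNReal.rpow_mul]; norm_num

lemma weakDerivNorm_le_hdotNorm {k : ℕ} (w : Fin k → Fin 2) (f : Plane → F) :
    weakDerivNorm w f ≤ hdotNorm k f :=
  le_rpow_half_sum Finset.univ (fun w => weakDerivNorm w f) (Finset.mem_univ w)

lemma hdotNorm_le {k : ℕ} {f : Plane → F} {K : ℝ≥0∞}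
    (h : ∀ w : Fin k → Fin 2, weakDerivNorm w f ≤ K) :
    hdotNorm k f ≤ 2 ^ k * K := by
  refine (rpow_half_sum_le Finset.univ (fun w => weakDerivNorm w f) fun w _ => h w).trans
    (le_of_eq ?_)
  simp

lemma hdotNorm_le_h2Norm {k : ℕ} (hk : k ≤ 2) (f : Plane → F) : hdotNorm k f ≤ h2Norm f :=
  le_rpow_half_sum (Finset.range 3) (fun k => hdotNorm k f) (by simp; omega)

lemma HasWeakDeriv.weakDerivNorm_le {k : ℕ} {w : Fin k → Fin 2} {f g : Plane → F}
    (h : HasWeakDeriv w f g) : weakDerivNorm w f ≤ eLpNorm g 2 volume := iInf₂_le g h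

lemma MemHdot.hdotNorm_ne_top {k : ℕ} {f : Plane → F} (h : MemHdot k f) : hdotNorm k f ≠ ⊤ := by
  choose g hg hg2 using h
  have hs : ∀ w : Fin k → Fin 2, weakDerivNorm w f ≤ ∑ w, eLpNorm (g w) 2 volume := fun w =>
    (hg w).weakDerivNorm_le.trans
      (Finset.single_le_sum (f := fun w => eLpNorm (g w) 2 volume) (fun _ _ => zero_le)
        (Finset.mem_univ w))
  refine ((hdotNorm_le hs).trans_lt (ENNReal.mul_lt_top (by simp) ?_)).ne
  exact ENNReal.sum_lt_top.2 fun w _ => (hg2 w).2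

lemma MemH2.h2Norm_ne_top {f : Plane → F} (h : MemH2 f) : h2Norm f ≠ ⊤ := by
  have h1 : ∀ k ∈ Finset.range 3, hdotNorm k f ≤ ∑ k ∈ Finset.range 3, hdotNorm k f := fun k hk =>
    Finset.single_le_sum (f := fun k => hdotNorm k f) (fun _ _ => zero_le) hk
  refine ((rpow_half_sum_le (Finset.range 3) _ h1).trans_lt (ENNReal.mul_lt_top (by simp) ?_)).ne
  exact ENNReal.sum_lt_top.2 fun k hk =>
    (h k (by simp at hk; omega)).hdotNorm_ne_top.lt_top

lemma sqrt_mul_le_add (P K : ℝ≥0) : NNReal.sqrt (P * K) ≤ P + K := by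
  rw [NNReal.sqrt_le_iff_le_sq]
  calc P * K ≤ P * K + (P * P + P * K + K * K) := le_self_add
    _ = (P + K) ^ 2 := by ring

lemma memHdot_three_of_h2Bd {u : Plane → F} {G : Fin 2 → Plane → F} (hG : ∀ k, WD univ k u (G k))
    {P K : ℝ≥0} (h : ∀ k, H2Bd (G k) P K) : MemHdot 3 u ∧ hdotNorm 3 u ≤ 8 * (K : ℝ≥0∞) := by
  have key : ∀ w : Fin 3 → Fin 2, ∃ g, HasWeakDeriv w u g ∧ L2Bd g K := by
    intro w
    obtain ⟨f₁, f₂, h1, -, h3⟩ := h (w 0)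
    exact ⟨_, (hasWeakDeriv_succ_iff (hG (w 0))).2 (h1.hasWeakDeriv (Fin.tail w)), h3 _ _⟩
  refine ⟨fun w => ?_, ?_⟩
  · obtain ⟨g, hg, hg2⟩ := key w
    exact ⟨g, hg, hg2.memLp⟩
  · refine (hdotNorm_le (K := K) fun w => ?_).trans (le_of_eq (by norm_num))
    obtain ⟨g, hg, hg2⟩ := key w
    exact hg.weakDerivNorm_le.trans hg2.2

section InnerProduct

variable {E : Type*} [NormedAddCommGroup E] [InnerProductSpace ℝ E] [CompleteSpace E]

lemma H2Bd.memH2_and_le {f : Plane → E} {P K : ℝ≥0} (h : H2Bd f P K) :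
    MemH2 f ∧ h2Norm f ≤ 12 * ((P + K : ℝ≥0) : ℝ≥0∞) := by
  obtain ⟨f₁, f₂, h1, h2, h3⟩ := h
  have h4 := (h1.interp h2 h3).1
  have key : ∀ k ≤ 2, ∀ w : Fin k → Fin 2, ∃ g, HasWeakDeriv w f g ∧ L2Bd g (P + K) := by
    intro k hk w
    interval_cases k
    · exact ⟨f, hasWeakDeriv_zero_iff.2 ⟨locallyIntegrableOn_univ.1 (h1.wd₁ 0).lf, .rfl⟩,
        h2.mono le_self_add⟩
    · exact ⟨f₁ (w 0), hasWeakDeriv_one_iff.2 (h1.wd₁ _), (h4 _).mono (sqrt_mul_le_add P K)⟩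
    · exact ⟨_, h1.hasWeakDeriv w, (h3 _ _).mono le_add_self⟩
  refine ⟨fun k hk w => ?_, ?_⟩
  · obtain ⟨g, hg, hg2⟩ := key k hk w
    exact ⟨g, hg, hg2.memLp⟩
  · have h5 : ∀ k ∈ Finset.range 3, hdotNorm k f ≤ 4 * ((P + K : ℝ≥0) : ℝ≥0∞) := by
      intro k hk
      have hk2 : k ≤ 2 := by simp at hk; omega
      refine (hdotNorm_le fun w => ?_).trans (mul_le_mul_left ?_ _)
      · obtain ⟨g, hg, hg2⟩ := key k hk2 w
        exact hg.weakDerivNorm_le.trans hg2.2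
      · calc (2 : ℝ≥0∞) ^ k ≤ 2 ^ 2 := pow_le_pow_right₀ (by norm_num) hk2
          _ = 4 := by norm_num
    refine (rpow_half_sum_le (Finset.range 3) _ h5).trans (le_of_eq ?_)
    rw [Finset.card_range, ← mul_assoc]
    norm_num

lemma MemH2.h2Bd {f : Plane → E} (h : MemH2 f) {K : ℝ≥0} (hK : h2Norm f ≤ K) : H2Bd f K K := by
  obtain ⟨g, hg, hg2⟩ := h 0 (by norm_num) ![]
  have hfg := (hasWeakDeriv_zero_iff.1 hg).2
  have hf : L2Bd f K := by
    refine L2Bd.congr ⟨hg2.1, ?_⟩ hfg.symm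
    rw [← hg.weakDerivNorm_eq]
    exact ((weakDerivNorm_le_hdotNorm _ f).trans (hdotNorm_le_h2Norm (by norm_num) f)).trans hK
  choose f₂ hf₂ hf₂' using fun i j => h 2 le_rfl ![i, j]
  obtain ⟨f₁, hf₁, -⟩ := exists_weakDeriv_of_second hf.memLp hf₂ hf₂'
  refine ⟨f₁, f₂, ⟨hf₁, fun i j => ?_⟩, hf, fun i j => ⟨(hf₂' i j).1, ?_⟩⟩
  · exact hasWeakDeriv_one_iff.1 ((hasWeakDeriv_succ_iff (w := ![i, j]) (hf₁ i)).1 (hf₂ i j))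
  · rw [← (hf₂ i j).weakDerivNorm_eq]
    exact ((weakDerivNorm_le_hdotNorm _ f).trans (hdotNorm_le_h2Norm le_rfl f)).trans hK

/-- Third derivatives of `u` are second derivatives of its first derivatives. -/
lemma MemHdot.h2Bd_of_wd {u : Plane → E} {G : Fin 2 → Plane → E} (hG : ∀ k, WD univ k u (G k))
    (hu : MemHdot 3 u) {P K : ℝ≥0} (hP : ∀ k, L2Bd (G k) P) (hK : hdotNorm 3 u ≤ K) (k : Fin 2) :
    H2Bd (G k) P K := by
  have h : ∀ i j, ∃ g, HasWeakDeriv ![i, j] (G k) g ∧ L2Bd g K := by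
    intro i j
    obtain ⟨g, hg, hg2⟩ := hu ![k, i, j]
    refine ⟨g, (hasWeakDeriv_succ_iff (w := ![k, i, j]) (hG k)).1 hg, hg2.1, ?_⟩
    rw [← hg.weakDerivNorm_eq]
    exact (weakDerivNorm_le_hdotNorm _ u).trans hK
  choose f₂ hf₂ hf₂' using h
  obtain ⟨f₁, hf₁, -⟩ := exists_weakDeriv_of_second (hP k).memLp hf₂ fun i j => (hf₂' i j).memLp
  refine ⟨f₁, f₂, ⟨hf₁, fun i j => ?_⟩, hP k, hf₂'⟩
  exact hasWeakDeriv_one_iff.1 ((hasWeakDeriv_succ_iff (w := ![i, j]) (hf₁ i)).1 (hf₂ i j))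

end InnerProduct

/-! ### Reflection of the plane -/

/-- The reflection `(x₁, x₂) ↦ (x₁, -x₂)`, which maps the angle `θ` to `-θ`. -/
def reflect : Plane ≃ₗᵢ[ℝ] Plane :=
  LinearIsometryEquiv.piLpCongrRight 2
    ![LinearIsometryEquiv.refl ℝ ℝ, LinearIsometryEquiv.neg ℝ]

@[simp] lemma reflect_zero (x : Plane) : reflect x 0 = x 0 := by simp [reflect]

@[simp] lemma reflect_one (x : Plane) : reflect x 1 = -x 1 := by simp [reflect]

@[simp] lemma reflect_reflect (x : Plane) : reflect (reflect x) = x := by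
  ext i; fin_cases i <;> simp

/-- The sign with which the reflection acts on the `i`-th partial derivative. -/
def reflectSign : Fin 2 → ℝ := ![1, -1]

lemma reflect_bvec (i : Fin 2) : reflect (bvec i) = reflectSign i • bvec i := by
  ext j; fin_cases i <;> fin_cases j <;> simp [bvec, reflectSign]

lemma integral_comp_reflect (f : Plane → F) : ∫ x, f (reflect x) = ∫ x, f x :=
  reflect.measurePreserving.integral_comp reflect.toHomeomorph.measurableEmbedding f

lemma locallyIntegrable_comp_reflect {F : Type*} [NormedAddCommGroup F] {f : Plane → F}
    (hf : LocallyIntegrable f volume) :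
    LocallyIntegrable (fun x => f (reflect x)) volume := by
  rw [locallyIntegrable_iff] at hf ⊢
  intro K hK
  have h1 := hf _ (hK.image reflect.continuous)
  have h2 := (reflect.measurePreserving.integrableOn_comp_preimage
    reflect.toHomeomorph.measurableEmbedding).2 h1
  rwa [preimage_image_eq _ reflect.injective] at h2

lemma pd_comp_reflect {φ : Plane → ℝ} (hφ : Differentiable ℝ φ) (i : Fin 2) (x : Plane) :
    pd i (fun y => φ (reflect y)) x = reflectSign i * pd i φ (reflect x) := by
  have h : HasFDerivAt (fun y => φ (reflect y)) _ x :=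
    (hφ (reflect x)).hasFDerivAt.comp x reflect.toContinuousLinearEquiv.hasFDerivAt
  unfold pd
  rw [h.fderiv]
  simp [reflect_bvec]

lemma WD.comp_reflect {i : Fin 2} {f g : Plane → F} (h : WD univ i f g) :
    WD univ i (fun x => f (reflect x)) (fun x => reflectSign i • g (reflect x)) := by
  have hl := locallyIntegrable_comp_reflect (locallyIntegrableOn_univ.1 h.lf)
  have hl' := locallyIntegrable_comp_reflect (locallyIntegrableOn_univ.1 h.lg)
  refine ⟨hl.locallyIntegrableOn _, (hl'.smul (reflectSign i)).locallyIntegrableOn _, fun φ hφ => ?_⟩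
  have hs : reflectSign i * reflectSign i = 1 := by fin_cases i <;> simp [reflectSign]
  have hT : IsTest univ (fun y => φ (reflect y)) :=
    ⟨hφ.smooth.comp reflect.contDiff, hφ.compact.comp_homeomorph reflect.toHomeomorph,
      subset_univ _⟩
  have h1 := h.parts _ hT
  simp only [pd_comp_reflect (hφ.smooth.differentiable (by simp))] at h1
  rw [← integral_comp_reflect, ← integral_comp_reflect (fun x => φ (reflect x) • g x)] at h1
  simp only [reflect_reflect, mul_smul, integral_smul] at h1
  have h2 := congrArg (fun z => reflectSign i • z) h1
  simp only [smul_smul, hs, one_smul, smul_neg] at h2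
  rw [h2]
  simp only [smul_comm _ (reflectSign i), integral_smul]

lemma L2Bd.comp_reflect {F : Type*} [NormedAddCommGroup F] {f : Plane → F} {K : ℝ≥0}
    (h : L2Bd f K) :
    L2Bd (fun x => f (reflect x)) K :=
  ⟨h.1.comp_measurePreserving reflect.measurePreserving,
    (eLpNorm_comp_measurePreserving h.1 reflect.measurePreserving).trans_le h.2⟩

lemma H2Bd.comp_reflect {f : Plane → F} {P K : ℝ≥0} (h : H2Bd f P K) :
    H2Bd (fun x => f (reflect x)) P K := by
  obtain ⟨f₁, f₂, h1, h2, h3⟩ := h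
  have hs : ∀ i, ‖reflectSign i‖ = 1 := fun i => by fin_cases i <;> simp [reflectSign]
  refine ⟨fun i x => reflectSign i • f₁ i (reflect x),
    fun i j x => reflectSign i • reflectSign j • f₂ i j (reflect x),
    ⟨fun i => (h1.wd₁ i).comp_reflect, fun i j => (h1.wd₂ i j).comp_reflect.const_smul _⟩,
    h2.comp_reflect, fun i j => ?_⟩
  refine L2Bd.of_le (((h3 i j).comp_reflect.1.const_smul _).const_smul _)
    (h3 i j).comp_reflect.norm (.of_forall fun x => ?_)
  rw [norm_smul, norm_smul, hs, hs, one_mul, one_mul]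

end Quantitative

/-! ### Differentiating in a moving frame -/

/-- The signs of the rotation `J (V, W) = (-W, V)` of a frame. -/
def turnSign : Fin 2 → ℝ := ![-1, 1]

lemma norm_turnSign (a : Fin 2) : ‖turnSign a‖ = 1 := by fin_cases a <;> simp [turnSign]

/-- The derivative in direction `m` of the frame vector `e a`, according to the structure
equations `∂ₘ e = -(G m ⋅ e) u + A m J e`. -/
def frameDeriv (u : Plane → Space) (G e : Fin 2 → Plane → Space) (A : Fin 2 → Plane → ℝ)
    (m a : Fin 2) (x : Plane) : Space :=
  A m x • turnSign a • e (1 - a) x - inner ℝ (G m x) (e a x) • u x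

lemma norm_frameDeriv_le_of {u : Plane → Space} {G e : Fin 2 → Plane → Space}
    {A : Fin 2 → Plane → ℝ} {M : ℝ} {m a : Fin 2} {x : Plane} (hG : ‖G m x‖ ≤ M)
    (hA : ‖A m x‖ ≤ 2 * M) (he : ∀ a, ‖e a x‖ ≤ 1) (hu : ‖u x‖ ≤ 1) :
    ‖frameDeriv u G e A m a x‖ ≤ 3 * M := by
  have h3 : ‖inner ℝ (G m x) (e a x)‖ ≤ ‖G m x‖ :=
    (norm_inner_le_norm _ _).trans (mul_le_of_le_one_right (norm_nonneg _) (he a))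
  have h4 := he (1 - a)
  have h0 : 0 ≤ M := (norm_nonneg _).trans hG
  calc ‖frameDeriv u G e A m a x‖
      ≤ ‖A m x‖ * (‖turnSign a‖ * ‖e (1 - a) x‖) + ‖inner ℝ (G m x) (e a x)‖ * ‖u x‖ := by
        refine (norm_sub_le _ _).trans (le_of_eq ?_)
        simp only [norm_smul]
    _ ≤ 2 * M * (1 * 1) + M * 1 := by
        rw [norm_turnSign]
        gcongr
        exact h3.trans hG
    _ = 3 * M := by ring

/-- A map `u` to the sphere with bounded gradient `G`, and an orthonormal frame `e` of its pulled
back tangent bundle with connection form `A`. Both `A` and its derivatives `dA` are bounded in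
terms of the bound `M` for the gradient. -/
structure MovingFrame (u : Plane → Space) (G e : Fin 2 → Plane → Space) (A : Fin 2 → Plane → ℝ)
    (dA : Fin 2 → Fin 2 → Plane → ℝ) (M : ℝ≥0) : Prop where
  wd_u : ∀ k, WD univ k u (G k)
  wd_e : ∀ m a, WD univ m (e a) (frameDeriv u G e A m a)
  wd_A : ∀ l m, WD univ m (A l) (dA l m)
  norm_u : ∀ x, ‖u x‖ ≤ 1
  norm_e : ∀ a x, ‖e a x‖ ≤ 1
  tangent : ∀ k, ∀ᵐ x, inner ℝ (G k x) (u x) = 0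
  expand : ∀ k, ∀ᵐ x, G k x = ∑ a, inner ℝ (G k x) (e a x) • e a x
  norm_G : ∀ k, ∀ᵐ x, ‖G k x‖ ≤ M
  norm_A : ∀ l, ∀ᵐ x, ‖A l x‖ ≤ 2 * M
  norm_dA : ∀ l m, ∀ᵐ x, ‖dA l m x‖ ≤ 10 * (M : ℝ) ^ 2

namespace MovingFrame

variable {u : Plane → Space} {G e : Fin 2 → Plane → Space} {A : Fin 2 → Plane → ℝ}
  {dA : Fin 2 → Fin 2 → Plane → ℝ} {M : ℝ≥0} (h : MovingFrame u G e A dA M)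
include h

lemma l2Loc_u : L2Loc u :=
  .of_bound (h.wd_u 0).aestronglyMeasurable_left (.of_forall h.norm_u)

lemma l2Loc_e (a : Fin 2) : L2Loc (e a) :=
  .of_bound (h.wd_e 0 a).aestronglyMeasurable_left (.of_forall (h.norm_e a))

lemma l2Loc_G (k : Fin 2) : L2Loc (G k) :=
  .of_bound (h.wd_u k).aestronglyMeasurable_right (h.norm_G k)

lemma l2Loc_A (l : Fin 2) : L2Loc (A l) :=
  .of_bound (h.wd_A l 0).aestronglyMeasurable_left (h.norm_A l)

lemma l2Loc_dA (l m : Fin 2) : L2Loc (dA l m) :=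
  .of_bound (h.wd_A l m).aestronglyMeasurable_right (h.norm_dA l m)

lemma norm_inner_le (k a : Fin 2) (x : Plane) : ‖inner ℝ (G k x) (e a x)‖ ≤ ‖G k x‖ := by
  refine (norm_inner_le_norm _ _).trans ?_
  exact mul_le_of_le_one_right (norm_nonneg _) (h.norm_e a x)

lemma norm_frameDeriv_le (m a : Fin 2) : ∀ᵐ x, ‖frameDeriv u G e A m a x‖ ≤ 3 * M := by
  filter_upwards [h.norm_G m, h.norm_A m] with x h1 h2
  exact norm_frameDeriv_le_of h1 h2 (fun a => h.norm_e a x) (h.norm_u x)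

lemma l2Loc_frameDeriv (m a : Fin 2) : L2Loc (frameDeriv u G e A m a) :=
  .of_bound (h.wd_e m a).aestronglyMeasurable_right (h.norm_frameDeriv_le m a)

/-- The coordinates of the gradient in the frame inherit second derivatives in `L²`. -/
lemma h2Bd_inner {G₁ : Fin 2 → Fin 2 → Plane → Space} {G₂ : Fin 2 → Fin 2 → Fin 2 → Plane → Space}
    (hG : ∀ k, SecondDerivs (G k) (G₁ k) (G₂ k)) {P R K : ℝ≥0} (h0 : ∀ k, L2Bd (G k) P)
    (h1 : ∀ k l, L2Bd (G₁ k l) R) (h2 : ∀ k l m, L2Bd (G₂ k l m) K) (k a : Fin 2) :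
    H2Bd (fun x => inner ℝ (G k x) (e a x)) P (K + (5 * M * R + 14 * M ^ 2 * P)) := by
  set ψ : Fin 2 → Plane → ℝ := fun a x => inner ℝ (G k x) (e a x) with hψ
  have mψ : ∀ a, AEStronglyMeasurable (ψ a) volume := fun a =>
    (h.wd_u k).aestronglyMeasurable_right.inner (h.wd_e 0 a).aestronglyMeasurable_left
  have lψ : ∀ a, L2Loc (ψ a) := fun a => .of_bound (mψ a)
    ((h.norm_G k).mono fun x hx => (h.norm_inner_le k a x).trans hx)
  -- the first derivatives
  set ψ₁ : Fin 2 → Fin 2 → Plane → ℝ := fun a l x =>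
    inner ℝ (G₁ k l x) (e a x) + turnSign a • (A l x * ψ (1 - a) x) with hψ₁
  have w1 : ∀ a l, WD univ l (ψ a) (ψ₁ a l) := by
    intro a l
    have hb := WD.bilin (innerSL ℝ) ((hG k).wd₁ l) (h.wd_e l a) (h.l2Loc_G k) (h1 k l).memLp.l2Loc
      (h.l2Loc_e a) (h.l2Loc_frameDeriv l a)
    refine hb.congr .rfl ?_
    filter_upwards [h.tangent k] with x hx
    change inner ℝ (G₁ k l x) (e a x) + inner ℝ (G k x) (frameDeriv u G e A l a x) = _
    simp only [hψ₁, hψ, frameDeriv, inner_sub_right, inner_smul_right, hx,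
      smul_eq_mul]
    ring
  have b1 : ∀ a l, ∀ᵐ x, ‖ψ₁ a l x‖ ≤ ‖G₁ k l x‖ + 2 * M * ‖G k x‖ := by
    intro a l
    filter_upwards [h.norm_A l] with x hx
    have e1 : ‖inner ℝ (G₁ k l x) (e a x)‖ ≤ ‖G₁ k l x‖ :=
      (norm_inner_le_norm _ _).trans (mul_le_of_le_one_right (norm_nonneg _) (h.norm_e a x))
    have e2 := h.norm_inner_le k (1 - a) x
    refine (norm_add_le _ _).trans (add_le_add e1 ?_)
    rw [norm_smul, norm_turnSign, one_mul, norm_mul]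
    gcongr
  have lψ₁ : ∀ a l, L2Loc (ψ₁ a l) := fun a l =>
    (L2Bd.of_le (w1 a l).aestronglyMeasurable_right
      ((h1 k l).norm.add ((h0 k).norm.const_mul (2 * M))) (by simpa using b1 a l)).memLp.l2Loc
  -- the second derivatives
  set ψ₂ : Fin 2 → Fin 2 → Plane → ℝ := fun l m x =>
    (inner ℝ (G₂ k l m x) (e a x) + inner ℝ (G₁ k l x) (frameDeriv u G e A m a x)) +
      turnSign a • (dA l m x * ψ (1 - a) x + A l x * ψ₁ (1 - a) m x) with hψ₂
  have w2 : ∀ l m, WD univ m (ψ₁ a l) (ψ₂ l m) := by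
    intro l m
    have hb1 := WD.bilin (innerSL ℝ) ((hG k).wd₂ l m) (h.wd_e m a) (h1 k l).memLp.l2Loc
      (h2 k l m).memLp.l2Loc (h.l2Loc_e a) (h.l2Loc_frameDeriv m a)
    have hb2 := WD.bilin (ContinuousLinearMap.mul ℝ ℝ) (h.wd_A l m) (w1 (1 - a) m) (h.l2Loc_A l)
      (h.l2Loc_dA l m) (lψ (1 - a)) (lψ₁ (1 - a) m)
    exact hb1.add (hb2.const_smul (turnSign a))
  refine ⟨ψ₁ a, ψ₂, ⟨w1 a, w2⟩, ?_, fun l m => ?_⟩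
  · exact L2Bd.of_le (mψ a) (h0 k).norm (.of_forall fun x => h.norm_inner_le k a x)
  · refine (L2Bd.of_le (w2 l m).aestronglyMeasurable_right ((h2 k l m).norm.add
      (((h1 k l).norm.const_mul (3 * M)).add
      (((h1 k m).norm.const_mul (2 * M)).add ((h0 k).norm.const_mul (14 * M ^ 2))))) ?_).mono
      (le_of_eq (by ring))
    filter_upwards [h.norm_A l, h.norm_dA l m, h.norm_frameDeriv_le m a, b1 (1 - a) m] with
      x hA hdA hD hψ1
    have e1 : ‖inner ℝ (G₂ k l m x) (e a x)‖ ≤ ‖G₂ k l m x‖ :=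
      (norm_inner_le_norm _ _).trans (mul_le_of_le_one_right (norm_nonneg _) (h.norm_e a x))
    have e2 : ‖inner ℝ (G₁ k l x) (frameDeriv u G e A m a x)‖ ≤ ‖G₁ k l x‖ * (3 * M) :=
      (norm_inner_le_norm _ _).trans (by gcongr)
    have e3 : ‖turnSign a • (dA l m x * ψ (1 - a) x + A l x * ψ₁ (1 - a) m x)‖ ≤
        10 * (M : ℝ) ^ 2 * ‖G k x‖ + 2 * M * (‖G₁ k m x‖ + 2 * M * ‖G k x‖) := by
      have := h.norm_inner_le k (1 - a) x
      rw [norm_smul, norm_turnSign, one_mul]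
      refine (norm_add_le _ _).trans ?_
      rw [norm_mul, norm_mul]
      gcongr
    refine (norm_add_le _ _).trans ((add_le_add ((norm_add_le _ _).trans (add_le_add e1 e2)) e3).trans
      (le_of_eq ?_))
    push_cast
    ring

/-- The gradient inherits second derivatives in `L²` from its coordinates in the frame. -/
lemma h2Bd_of_inner {ψ : Fin 2 → Fin 2 → Plane → ℝ}
    (hψ : ∀ k a x, ψ k a x = inner ℝ (G k x) (e a x))
    {ψ₁ : Fin 2 → Fin 2 → Fin 2 → Plane → ℝ} {ψ₂ : Fin 2 → Fin 2 → Fin 2 → Fin 2 → Plane → ℝ}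
    (hd : ∀ k a, SecondDerivs (ψ k a) (ψ₁ k a) (ψ₂ k a)) {P R K Q : ℝ≥0} (hG : ∀ k, L2Bd (G k) Q)
    (h0 : ∀ k a, L2Bd (ψ k a) P) (h1 : ∀ k a l, L2Bd (ψ₁ k a l) R)
    (h2 : ∀ k a l m, L2Bd (ψ₂ k a l m) K) (k : Fin 2) :
    H2Bd (G k) Q (2 * (K + (7 * M * R + 17 * M ^ 2 * P))) := by
  have bψ : ∀ k a, ∀ᵐ x, ‖ψ k a x‖ ≤ M := fun k a => (h.norm_G k).mono fun x hx => by
    rw [hψ]; exact (h.norm_inner_le k a x).trans hx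
  have lψ : ∀ k a, L2Loc (ψ k a) := fun k a => .of_bound (h0 k a).1 (bψ k a)
  have lψ₁ : ∀ k a l, L2Loc (ψ₁ k a l) := fun k a l => (h1 k a l).memLp.l2Loc
  have lψ₂ : ∀ k a l m, L2Loc (ψ₂ k a l m) := fun k a l m => (h2 k a l m).memLp.l2Loc
  set D : Fin 2 → Fin 2 → Plane → Space := frameDeriv u G e A with hD
  -- the derivative of the structure equations
  set D₁ : Fin 2 → Fin 2 → Fin 2 → Plane → Space := fun l a m x =>
    turnSign a • (dA l m x • e (1 - a) x + A l x • D m (1 - a) x) -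
      (ψ₁ l a m x • u x + ψ l a x • G m x) with hD₁
  have wD : ∀ l a m, WD univ m (D l a) (D₁ l a m) := by
    intro l a m
    have c1 := WD.bilin (ContinuousLinearMap.lsmul ℝ ℝ) (h.wd_A l m) (h.wd_e m (1 - a)) (h.l2Loc_A l)
      (h.l2Loc_dA l m) (h.l2Loc_e _) (h.l2Loc_frameDeriv m _)
    have c2 := WD.bilin (ContinuousLinearMap.lsmul ℝ ℝ) ((hd l a).wd₁ m) (h.wd_u m) (lψ l a)
      (lψ₁ l a m) h.l2Loc_u (h.l2Loc_G m)
    refine ((c1.const_smul (turnSign a)).sub c2).congr (.of_forall fun x => ?_) .rfl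
    simp only [hD, frameDeriv, ContinuousLinearMap.lsmul_apply, hψ]
    rw [smul_comm]
  have bD₁ : ∀ l a m, ∀ᵐ x, ‖D₁ l a m x‖ ≤ ‖ψ₁ l a m x‖ + 17 * (M : ℝ) ^ 2 := by
    intro l a m
    filter_upwards [h.norm_A l, h.norm_dA l m, h.norm_frameDeriv_le m (1 - a), h.norm_G m,
      bψ l a] with x hA hdA hD hG hp
    have e1 := h.norm_e (1 - a) x
    have e2 := h.norm_u x
    have e3 : ‖turnSign a • (dA l m x • e (1 - a) x + A l x • D m (1 - a) x)‖ ≤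
        10 * (M : ℝ) ^ 2 * 1 + 2 * M * (3 * M) := by
      rw [norm_smul, norm_turnSign, one_mul]
      refine (norm_add_le _ _).trans ?_
      rw [norm_smul, norm_smul]
      gcongr
    have e4 : ‖ψ₁ l a m x • u x + ψ l a x • G m x‖ ≤ ‖ψ₁ l a m x‖ * 1 + M * M := by
      refine (norm_add_le _ _).trans ?_
      rw [norm_smul, norm_smul]
      gcongr
    refine (norm_sub_le _ _).trans ((add_le_add e3 e4).trans (le_of_eq ?_))
    ring
  have lD₁ : ∀ l a m, L2Loc (D₁ l a m) := by
    intro l a m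
    have c1 : L2Loc (fun _ : Plane => 17 * (M : ℝ) ^ 2) :=
      .of_bound aestronglyMeasurable_const (.of_forall fun _ => le_rfl)
    intro ρ
    exact MemLp.mono (((h1 l a m).norm.memLp.l2Loc.add c1) ρ)
      (wD l a m).aestronglyMeasurable_right.restrict
      (ae_restrict_of_ae ((bD₁ l a m).mono fun x hx => hx.trans (Real.le_norm_self _)))
  set T₁ : Fin 2 → Fin 2 → Plane → Space := fun a l x => ψ₁ k a l x • e a x + ψ k a x • D l a x
    with hT₁
  have w1 : ∀ a l, WD univ l (fun x => ψ k a x • e a x) (T₁ a l) := fun a l =>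
    WD.bilin (ContinuousLinearMap.lsmul ℝ ℝ) ((hd k a).wd₁ l) (h.wd_e l a) (lψ k a) (lψ₁ k a l)
      (h.l2Loc_e a) (h.l2Loc_frameDeriv l a)
  set T₂ : Fin 2 → Fin 2 → Fin 2 → Plane → Space := fun a l m x =>
    (ψ₂ k a l m x • e a x + ψ₁ k a l x • D m a x) + (ψ₁ k a m x • D l a x + ψ k a x • D₁ l a m x)
    with hT₂
  have w2 : ∀ a l m, WD univ m (T₁ a l) (T₂ a l m) := by
    intro a l m
    have c1 := WD.bilin (ContinuousLinearMap.lsmul ℝ ℝ) ((hd k a).wd₂ l m) (h.wd_e m a)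
      (lψ₁ k a l) (lψ₂ k a l m) (h.l2Loc_e a) (h.l2Loc_frameDeriv m a)
    have c2 := WD.bilin (ContinuousLinearMap.lsmul ℝ ℝ) ((hd k a).wd₁ m) (wD l a m) (lψ k a)
      (lψ₁ k a m) (h.l2Loc_frameDeriv l a) (lD₁ l a m)
    exact c1.add c2
  have b2 : ∀ a l m, L2Bd (T₂ a l m) (K + (7 * M * R + 17 * M ^ 2 * P)) := by
    intro a l m
    refine (L2Bd.of_le (w2 a l m).aestronglyMeasurable_right ((h2 k a l m).norm.add
      (((h1 k a l).norm.const_mul (3 * M)).add (((h1 k a m).norm.const_mul (3 * M)).add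
      (((h1 l a m).norm.const_mul M).add ((h0 k a).norm.const_mul (17 * M ^ 2)))))) ?_).mono
      (le_of_eq (by ring))
    filter_upwards [h.norm_frameDeriv_le m a, h.norm_frameDeriv_le l a, bD₁ l a m, bψ k a] with
      x d1 d2 d3 d4
    have e1 := h.norm_e a x
    have e2 : ‖ψ₂ k a l m x • e a x + ψ₁ k a l x • D m a x‖ ≤
        ‖ψ₂ k a l m x‖ * 1 + ‖ψ₁ k a l x‖ * (3 * M) := by
      refine (norm_add_le _ _).trans ?_
      rw [norm_smul, norm_smul]
      gcongr
    have e3 : ‖ψ₁ k a m x • D l a x + ψ k a x • D₁ l a m x‖ ≤ ‖ψ₁ k a m x‖ * (3 * M) +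
        (M * ‖ψ₁ l a m x‖ + ‖ψ k a x‖ * (17 * (M : ℝ) ^ 2)) := by
      refine (norm_add_le _ _).trans ?_
      rw [norm_smul, norm_smul]
      refine add_le_add (by gcongr) ?_
      calc ‖ψ k a x‖ * ‖D₁ l a m x‖ ≤ ‖ψ k a x‖ * (‖ψ₁ l a m x‖ + 17 * (M : ℝ) ^ 2) := by gcongr
        _ = ‖ψ k a x‖ * ‖ψ₁ l a m x‖ + ‖ψ k a x‖ * (17 * (M : ℝ) ^ 2) := by ring
        _ ≤ _ := by gcongr
    refine (norm_add_le _ _).trans ((add_le_add e2 e3).trans (le_of_eq ?_))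
    push_cast
    ring
  refine ⟨fun l x => T₁ 0 l x + T₁ 1 l x, fun l m x => T₂ 0 l m x + T₂ 1 l m x,
    ⟨fun l => ?_, fun l m => (w2 0 l m).add (w2 1 l m)⟩, hG k, fun l m => ?_⟩
  · refine ((w1 0 l).add (w1 1 l)).congr ?_ .rfl
    filter_upwards [h.expand k] with x hx
    rw [hψ, hψ, ← Fin.sum_univ_two (fun a => inner ℝ (G k x) (e a x) • e a x), ← hx]
  · exact ((b2 0 l m).add (b2 1 l m)).mono (le_of_eq (by ring))

end MovingFrame

/-! ### Equivariant fields on the punctured plane -/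

/-- The rotation of `ℝ³` about `k` by the polar angle of `x ≠ 0`. -/
def rotAt (x : Plane) (a : Space) : Space :=
  !₂[x 0 / ‖x‖ * a 0 - x 1 / ‖x‖ * a 1, x 1 / ‖x‖ * a 0 + x 0 / ‖x‖ * a 1, a 2]

@[simp] lemma rotAt_zero_coord (x : Plane) (a : Space) :
    rotAt x a 0 = x 0 / ‖x‖ * a 0 - x 1 / ‖x‖ * a 1 := by simp [rotAt]

@[simp] lemma rotAt_one_coord (x : Plane) (a : Space) :
    rotAt x a 1 = x 1 / ‖x‖ * a 0 + x 0 / ‖x‖ * a 1 := by simp [rotAt]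

@[simp] lemma rotAt_two_coord (x : Plane) (a : Space) : rotAt x a 2 = a 2 := by simp [rotAt]

@[simp] lemma vecK_coord : vecK 0 = 0 ∧ vecK 1 = 0 ∧ vecK 2 = 1 := by simp [vecK]

lemma rotAt_add (x : Plane) (a b : Space) : rotAt x (a + b) = rotAt x a + rotAt x b := by
  refine space_ext ?_ ?_ ?_ <;> simp <;> ring

lemma rotAt_smul (x : Plane) (t : ℝ) (a : Space) : rotAt x (t • a) = t • rotAt x a := by
  refine space_ext ?_ ?_ ?_ <;> simp <;> ring

lemma rotAt_sub (x : Plane) (a b : Space) : rotAt x (a - b) = rotAt x a - rotAt x b := by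
  refine space_ext ?_ ?_ ?_ <;> simp <;> ring

lemma unit_sq {x : Plane} (hx : x ≠ 0) : (x 0 / ‖x‖) ^ 2 + (x 1 / ‖x‖) ^ 2 = 1 := by
  have hn : ‖x‖ ≠ 0 := norm_ne_zero_iff.2 hx
  rw [div_pow, div_pow, ← add_div, ← norm_sq_plane, div_self (pow_ne_zero 2 hn)]

lemma inner_rotAt {x : Plane} (hx : x ≠ 0) (a b : Space) :
    inner ℝ (rotAt x a) (rotAt x b) = inner ℝ a b := by
  simp only [inner_space, rotAt_zero_coord, rotAt_one_coord, rotAt_two_coord]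
  linear_combination (a 0 * b 0 + a 1 * b 1) * unit_sq hx

lemma norm_rotAt {x : Plane} (hx : x ≠ 0) (a : Space) : ‖rotAt x a‖ = ‖a‖ := by
  rw [@norm_eq_sqrt_real_inner _ _ _ (rotAt x a), inner_rotAt hx, ← norm_eq_sqrt_real_inner]

lemma exists_polar (x : Plane) : ∃ θ, x = polar ‖x‖ θ := by
  set z : ℂ := ⟨x 0, x 1⟩ with hz
  have hn : ‖z‖ = ‖x‖ := by
    have h1 : ‖z‖ ^ 2 = ‖x‖ ^ 2 := by
      rw [norm_sq_plane, Complex.sq_norm, Complex.normSq_apply]; ring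
    exact (pow_left_inj₀ (norm_nonneg _) (norm_nonneg _) two_ne_zero).1 h1
  refine ⟨z.arg, ?_⟩
  have e0 := Complex.norm_mul_cos_arg z
  have e1 := Complex.norm_mul_sin_arg z
  rw [hn] at e0 e1
  ext i
  fin_cases i
  · simpa [polar] using e0.symm
  · simpa [polar] using e1.symm

lemma IsEquivariant.eq_rotAt {u : Plane → Space} (h : IsEquivariant u) {x : Plane} (hx : x ≠ 0) :
    u x = rotAt x (profile u ‖x‖) := by
  obtain ⟨θ, hθ⟩ := exists_polar x
  have hn := norm_pos_iff.2 hx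
  have e := h ‖x‖ hn θ
  rw [← hθ] at e
  have e0 : Real.cos θ = x 0 / ‖x‖ := by
    rw [eq_div_iff hn.ne']
    have := congrArg (fun y : Plane => y 0) hθ
    simp only [polar] at this
    simp at this
    linarith
  have e1 : Real.sin θ = x 1 / ‖x‖ := by
    rw [eq_div_iff hn.ne']
    have := congrArg (fun y : Plane => y 1) hθ
    simp only [polar] at this
    simp at this
    linarith
  rw [e]
  simp only [rot, rotAt, e0, e1]

/-- The partial derivatives of the polar angle. -/
def ang (k : Fin 2) (x : Plane) : ℝ := ![-(x 1 / ‖x‖ ^ 2), x 0 / ‖x‖ ^ 2] k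

@[simp] lemma ang_zero (x : Plane) : ang 0 x = -(x 1 / ‖x‖ ^ 2) := rfl

@[simp] lemma ang_one (x : Plane) : ang 1 x = x 0 / ‖x‖ ^ 2 := rfl

lemma contDiffOn_ang (k : Fin 2) : ContDiffOn ℝ ∞ (ang k) {0}ᶜ := by
  fin_cases k
  · exact (contDiffOn_radial_field 1).neg
  · exact contDiffOn_radial_field 0

lemma contDiffOn_unit (k : Fin 2) : ContDiffOn ℝ ∞ (fun x : Plane => x k / ‖x‖) {0}ᶜ :=
  (contDiff_coord k).contDiffOn.div contDiffOn_norm fun _ hx => norm_ne_zero_iff.2 hx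

lemma pd_coord_mul_radial {h : ℝ → ℝ} {h' : ℝ} {x : Plane} (hx : x ≠ 0)
    (hh : HasDerivAt h h' ‖x‖) (k l : Fin 2) : pd k (fun y : Plane => y l * h ‖y‖) x =
      x l * (x k / ‖x‖ * h') + (if k = l then 1 else 0) * h ‖x‖ := by
  have hd : DifferentiableAt ℝ (fun y : Plane => h ‖y‖) x :=
    hh.differentiableAt.comp x ((contDiffAt_norm ℝ hx).differentiableAt (n := 1) (by simp))
  rw [pd_mul ((contDiff_coord l).differentiable (by simp) x) hd, pd_comp_norm hx hh, pd_coord]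
  simp

lemma pd_unit {x : Plane} (hx : x ≠ 0) (k l : Fin 2) :
    pd k (fun y : Plane => y l / ‖y‖) x = (if k = l then 1 else 0) / ‖x‖ - x l * x k / ‖x‖ ^ 3 := by
  have hn : ‖x‖ ≠ 0 := norm_ne_zero_iff.2 hx
  have := pd_coord_mul_radial hx (hasDerivAt_inv hn) k l
  simp only [← div_eq_mul_inv] at this
  rw [this]
  field_simp
  ring

lemma pd_cos {x : Plane} (hx : x ≠ 0) (k : Fin 2) :
    pd k (fun y : Plane => y 0 / ‖y‖) x = -(x 1 / ‖x‖) * ang k x := by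
  have hn : ‖x‖ ≠ 0 := norm_ne_zero_iff.2 hx
  have h2 := norm_sq_plane x
  rw [pd_unit hx]
  fin_cases k
  · simp
    field_simp
    linarith
  · simp
    field_simp

lemma pd_sin {x : Plane} (hx : x ≠ 0) (k : Fin 2) :
    pd k (fun y : Plane => y 1 / ‖y‖) x = x 0 / ‖x‖ * ang k x := by
  have hn : ‖x‖ ≠ 0 := norm_ne_zero_iff.2 hx
  have h2 := norm_sq_plane x
  rw [pd_unit hx]
  fin_cases k
  · simp
    field_simp
  · simp
    field_simp
    linarith

lemma norm_coord_le (x : Plane) (k : Fin 2) : |x k| ≤ ‖x‖ := PiLp.norm_apply_le x k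

lemma abs_ang_le (x : Plane) (k : Fin 2) : |ang k x| ≤ ‖x‖⁻¹ := by
  rcases eq_or_ne x 0 with rfl | hx
  · fin_cases k <;> simp
  have hn : 0 < ‖x‖ := norm_pos_iff.2 hx
  have key : ∀ l : Fin 2, |x l / ‖x‖ ^ 2| ≤ ‖x‖⁻¹ := fun l => by
    rw [abs_div, abs_of_pos (pow_pos hn 2), div_le_iff₀ (pow_pos hn 2), pow_two, ← mul_assoc,
      inv_mul_cancel₀ hn.ne', one_mul]
    exact norm_coord_le x l
  fin_cases k
  · simpa using key 1
  · simpa using key 0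

lemma abs_pd_ang_le {x : Plane} (hx : x ≠ 0) (k l : Fin 2) : |pd k (ang l) x| ≤ 3 / ‖x‖ ^ 2 := by
  have hn : 0 < ‖x‖ := norm_pos_iff.2 hx
  have key : ∀ l : Fin 2, |pd k (fun x : Plane => x l / ‖x‖ ^ 2) x| ≤ 3 / ‖x‖ ^ 2 := by
    intro l
    have hd : HasDerivAt (fun r : ℝ => (r ^ 2)⁻¹) (-(2 * ‖x‖) / (‖x‖ ^ 2) ^ 2) ‖x‖ := by
      simpa using (hasDerivAt_pow 2 ‖x‖).fun_inv (pow_ne_zero 2 hn.ne')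
    have e := pd_coord_mul_radial hx hd k l
    simp only [← div_eq_mul_inv] at e
    have e2 : x l * (x k / ‖x‖ * (-(2 * ‖x‖) / (‖x‖ ^ 2) ^ 2)) + (if k = l then 1 else 0) / ‖x‖ ^ 2
        = (-(2 * (x l / ‖x‖) * (x k / ‖x‖)) + (if k = l then 1 else 0)) / ‖x‖ ^ 2 := by
      field_simp
    rw [e, e2, abs_div, abs_of_pos (pow_pos hn 2)]
    gcongr
    have h1 := norm_unit_le x l
    have h2 := norm_unit_le x k
    rw [Real.norm_eq_abs] at h1 h2
    refine (abs_add_le _ _).trans ?_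
    rw [abs_neg, abs_mul, abs_mul, abs_two]
    have h3 : |(if k = l then (1 : ℝ) else 0)| ≤ 1 := by split_ifs <;> simp
    nlinarith [mul_le_mul h1 h2 (abs_nonneg _) zero_le_one]
  fin_cases l
  · have : ang 0 = fun x : Plane => -(fun x : Plane => x 1 / ‖x‖ ^ 2) x := rfl
    change |pd k (ang 0) x| ≤ _
    rw [this]
    have e : pd k (fun x : Plane => -(fun x : Plane => x 1 / ‖x‖ ^ 2) x) x =
        -pd k (fun x : Plane => x 1 / ‖x‖ ^ 2) x := by
      unfold pd; rw [fderiv_fun_neg]; rfl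
    rw [e, abs_neg]
    exact key 1
  · exact key 0

/-- The operator `R = k ×` as a continuous linear map. -/
def crossK : Space →L[ℝ] Space :=
  LinearMap.toContinuousLinearMap
    { toFun := cross vecK
      map_add' := fun a b => by refine space_ext ?_ ?_ ?_ <;> simp [add_comm]
      map_smul' := fun t a => by refine space_ext ?_ ?_ ?_ <;> simp }

@[simp] lemma crossK_apply (a : Space) : crossK a = cross vecK a := rfl

/-- The projection of `ℝ³` to the vertical axis. -/
def vertical : Space →L[ℝ] Space := (EuclideanSpace.proj (𝕜 := ℝ) 2 : Space →L[ℝ] ℝ).smulRight vecK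

@[simp] lemma vertical_apply (a : Space) : vertical a = a 2 • vecK := rfl

lemma rotAt_eq (x : Plane) (a : Space) : rotAt x a =
    (x 0 / ‖x‖) • (a - a 2 • vecK) + (x 1 / ‖x‖) • cross vecK a + a 2 • vecK := by
  refine space_ext ?_ ?_ ?_ <;> simp <;> ring

lemma ae_ne_zero : ∀ᵐ x : Plane, x ≠ 0 :=
  measure_eq_zero_iff_ae_notMem.1 (measure_singleton (0 : Plane))

/-- The gradient of the equivariant field with profile `f`. -/
lemma HasIntDeriv.wd_rotAt {f f' : ℝ → Space} (h : HasIntDeriv f f') (k : Fin 2) :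
    WD {0}ᶜ k (fun x => rotAt x (f ‖x‖)) (fun x => rotAt x
      ((x k / ‖x‖) • f' ‖x‖ + ang k x • cross vecK (f ‖x‖))) := by
  have h0 := h.wd_radial k
  have hV := h0.clm vertical
  have h1 := (h0.sub hV).smooth_smul isOpen_punctured (contDiffOn_unit 0)
  have h2 := (h0.clm crossK).smooth_smul isOpen_punctured (contDiffOn_unit 1)
  refine ((h1.add h2).add hV).congr (.of_forall fun x => ?_) ?_
  · simp only [rotAt_eq x, crossK_apply, vertical_apply]
  · filter_upwards [ae_ne_zero] with x hx
    rw [pd_cos hx, pd_sin hx]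
    refine space_ext ?_ ?_ ?_ <;> simp <;> ring

section Profile

variable {u : Plane → Space}

lemma polar_zero_right (r : ℝ) : polar r 0 = r • !₂[1, 0] := by
  ext i; fin_cases i <;> simp [polar]

lemma continuous_profile (hu : Continuous u) : Continuous (profile u) := by
  unfold profile
  simp only [polar_zero_right]
  fun_prop

lemma norm_profile (hn : ∀ x, ‖u x‖ = 1) (r : ℝ) : ‖profile u r‖ = 1 := hn _

lemma profile_zero : profile u 0 = u 0 := by
  unfold profile; rw [polar_zero_right, zero_smul]

lemma tendsto_profile {a : Space} (h : Tendsto u (cocompact Plane) (𝓝 a)) :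
    Tendsto (profile u) atTop (𝓝 a) := by
  refine h.comp ?_
  rw [← Metric.cobounded_eq_cocompact]
  refine tendsto_norm_atTop_iff_cobounded.1 ?_
  refine tendsto_abs_atTop_atTop.congr fun r => ?_
  rw [polar_zero_right, norm_smul, Real.norm_eq_abs, EuclideanSpace.norm_eq]
  simp

/-- The profile of an equivariant map with weak derivatives is locally absolutely continuous. -/
lemma locAC_profile (hu : Continuous u) (he : IsEquivariant u) {G : Fin 2 → Plane → Space}
    (hG : ∀ k, WD univ k u (G k)) : LocAC (profile u) := by
  have hw : ∀ k, ∃ g, WD {0}ᶜ k (fun x => profile u ‖x‖) g := by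
    intro k
    have h0 := (hG k).mono (subset_univ ({0}ᶜ : Set Plane))
    have hV := h0.clm vertical
    have h1 := (h0.sub hV).smooth_smul isOpen_punctured (contDiffOn_unit 0)
    have h2 := (h0.clm crossK).smooth_smul isOpen_punctured (contDiffOn_unit 1)
    refine ⟨_, ((h1.sub h2).add hV).congr ?_ .rfl⟩
    filter_upwards [ae_ne_zero] with x hx
    rw [he.eq_rotAt hx]
    have e := unit_sq hx
    refine space_ext ?_ ?_ ?_ <;> simp
    · linear_combination profile u ‖x‖ 0 * e
    · linear_combination profile u ‖x‖ 1 * e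
  choose g hg using hw
  exact locAC_of_wd_radial (continuous_profile hu).continuousOn hg

/-- The gradient of an equivariant map, in terms of its profile. -/
def grad (u : Plane → Space) (k : Fin 2) (x : Plane) : Space :=
  rotAt x ((x k / ‖x‖) • deriv (profile u) ‖x‖ + ang k x • cross vecK (profile u ‖x‖))

lemma wd_grad (hu : Continuous u) (he : IsEquivariant u) {G : Fin 2 → Plane → Space}
    (hG : ∀ k, WD univ k u (G k)) (k : Fin 2) :
    WD univ k u (grad u k) ∧ G k =ᵐ[volume] grad u k := by
  have h1 := (locAC_profile hu he hG).hasIntDeriv.wd_rotAt k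
  have h2 : WD {0}ᶜ k u (grad u k) := h1.congr (by
    filter_upwards [ae_ne_zero] with x hx
    exact (he.eq_rotAt hx).symm) .rfl
  have e : G k =ᵐ[volume] grad u k := by
    filter_upwards [((hG k).mono (subset_univ _)).unique isOpen_punctured h2, ae_ne_zero] with x h3 hx
    exact h3 hx
  exact ⟨(hG k).congr .rfl e, e⟩

lemma norm_sq_grad {x : Plane} (hx : x ≠ 0) :
    ‖grad u 0 x‖ ^ 2 + ‖grad u 1 x‖ ^ 2 =
      ‖deriv (profile u) ‖x‖‖ ^ 2 + (‖cross vecK (profile u ‖x‖)‖ / ‖x‖) ^ 2 := by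
  have hn : ‖x‖ ≠ 0 := norm_ne_zero_iff.2 hx
  unfold grad
  rw [norm_rotAt hx, norm_rotAt hx, norm_add_sq_real, norm_add_sq_real]
  simp only [norm_smul, inner_smul_left, inner_smul_right, mul_pow, Real.norm_eq_abs, sq_abs,
    ang_zero, ang_one, conj_trivial]
  have e := norm_sq_plane x
  have e1 : x 1 ^ 2 = ‖x‖ ^ 2 - x 0 ^ 2 := by linarith
  field_simp
  ring_nf
  rw [e1]
  ring

end Profile

/-! ### The Coulomb frame as a moving frame on the plane -/

/-- A property of `|x|` that holds for almost every point of the plane holds for almost every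
radius. -/
lemma ae_of_ae_comp_norm {P : ℝ → Prop} (h : ∀ᵐ x : Plane, P ‖x‖) : ∀ᵐ r : ℝ, 0 < r → P r := by
  set f : ℝ → ℝ := {r | P r}ᶜ.indicator 1 with hf
  have hz : (fun x : Plane => f ‖x‖) =ᵐ[volume] 0 := by
    filter_upwards [h] with x hx
    simp [hf, hx]
  have hi : Integrable (fun x : Plane => f ‖x‖) volume := (integrable_zero _ _ _).congr hz.symm
  have h0 : circ • ∫ r in Ioi (0 : ℝ), r • f r = 0 := by
    rw [← integral_comp_norm, integral_congr_ae hz]; simp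
  rw [smul_eq_zero_iff_right circ_pos.ne', setIntegral_eq_zero_iff_of_nonneg_ae] at h0
  · filter_upwards [(ae_restrict_iff' measurableSet_Ioi).1 h0] with r hr hr0
    by_contra hn
    have := hr hr0
    simp [hf, hn, hr0.ne'] at this
  · refine (ae_restrict_iff' measurableSet_Ioi).2 (.of_forall fun r hr => ?_)
    exact mul_nonneg (le_of_lt hr) (indicator_nonneg (fun _ _ => zero_le_one) _)
  · exact integrable_comp_norm_iff.1 hi

lemma WD.of_punctured_of_bound {F : Type*} [NormedAddCommGroup F] [NormedSpace ℝ F] {i : Fin 2}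
    {f g : Plane → F} (h : WD {0}ᶜ i f g) {K K' : ℝ} (hK : ∀ x, ‖f x‖ ≤ K)
    (hK' : ∀ᵐ x, ‖g x‖ ≤ K') : WD univ i f g := by
  have hr : volume.restrict ({0}ᶜ : Set Plane) = volume := restrict_compl_singleton 0
  have mf : AEStronglyMeasurable f volume := by
    rw [← hr]; exact h.lf.aestronglyMeasurable
  have mg : AEStronglyMeasurable g volume := by
    rw [← hr]; exact h.lg.aestronglyMeasurable
  exact h.of_punctured mf hK ((locallyIntegrable_const K').mono mg
    (hK'.mono fun x hx => hx.trans (le_abs_self K')))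

section Frame

variable {u : Plane → Space} {v : ℝ → Space}

/-- The frame `e^{-iθ} (v + i w)` of the pulled back tangent bundle, where `(v, w)` is the rotated
Coulomb frame: its real and imaginary parts are `v` and `w` turned by `θ` in the tangent plane. Unlike `(v, w)` it extends across the origin. -/
def planeFrame (u : Plane → Space) (v : ℝ → Space) (a : Fin 2) (x : Plane) : Space :=
  ![(x 0 / ‖x‖) • rotAt x (v ‖x‖) + (x 1 / ‖x‖) • rotAt x (frameW u v ‖x‖),
    (x 0 / ‖x‖) • rotAt x (frameW u v ‖x‖) - (x 1 / ‖x‖) • rotAt x (v ‖x‖)] a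

/-- The connection form `A = -(1 + ū₃) dθ` of `planeFrame`. The rotated Coulomb frame
has the form `-ū₃ dθ`, and the turn from `(v, w)` to `planeFrame` adds `-dθ`. Hence `A` is bounded
near the origin, where `ū₃ → -1`. -/
def conn (u : Plane → Space) (l : Fin 2) (x : Plane) : ℝ := -ang l x * (1 + profile u ‖x‖ 2)

/-- The derivatives of the connection form. -/
def connDeriv (u : Plane → Space) (l m : Fin 2) (x : Plane) : ℝ :=
  -ang l x * (x m / ‖x‖ * deriv (fun r => profile u r 2) ‖x‖) +
    -pd m (ang l) x * (1 + profile u ‖x‖ 2)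

lemma planeFrame_zero_eq (x : Plane) : planeFrame u v 0 x =
    rotAt x ((x 0 / ‖x‖) • v ‖x‖ + (x 1 / ‖x‖) • frameW u v ‖x‖) := by
  rw [rotAt_add, rotAt_smul, rotAt_smul]; rfl

lemma planeFrame_one_eq (x : Plane) : planeFrame u v 1 x =
    rotAt x ((x 0 / ‖x‖) • frameW u v ‖x‖ - (x 1 / ‖x‖) • v ‖x‖) := by
  rw [rotAt_sub, rotAt_smul, rotAt_smul]; rfl

namespace OrthoPair

variable {p v : Space} (h : OrthoPair p v)
include h

lemma cross_vecK_v : cross vecK v = -inner ℝ (cross vecK p) v • p + p 2 • cross p v := by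
  have e := h.expand (cross vecK v)
  have e1 : inner ℝ (cross vecK v) v = 0 := by rw [inner_space]; simp; ring
  have e2 : inner ℝ (cross vecK v) (cross p v) = p 2 := by
    rw [inner_space]; simp
    linear_combination p 2 * h.sq_v - v 2 * h.dot
  have e3 : inner ℝ (cross vecK v) p = -inner ℝ (cross vecK p) v := by
    rw [inner_space, inner_space]; simp; ring
  rw [e1, e2, e3] at e
  rw [e]; module

lemma cross_vecK_w :
    cross vecK (cross p v) = -inner ℝ (cross vecK p) (cross p v) • p - p 2 • v := by
  have e := h.expand (cross vecK (cross p v))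
  have e1 : inner ℝ (cross vecK (cross p v)) (cross p v) = 0 := by rw [inner_space]; simp; ring
  have e2 : inner ℝ (cross vecK (cross p v)) v = -p 2 := by
    rw [inner_space]; simp
    linear_combination -p 2 * h.sq_v + v 2 * h.dot
  have e3 : inner ℝ (cross vecK (cross p v)) p = -inner ℝ (cross vecK p) (cross p v) := by
    rw [inner_space, inner_space]; simp; ring
  rw [e1, e2, e3] at e
  rw [e]; module

end OrthoPair

lemma IsCoulombFrame.orthoPair (hv : IsCoulombFrame u v) (hn : ∀ x, ‖u x‖ = 1) {r : ℝ}
    (hr : 0 < r) : OrthoPair (profile u r) (v r) := ⟨hn _, hv.unit r hr, hv.tangent r hr⟩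

lemma norm_planeFrame_le (hv : IsCoulombFrame u v) (hn : ∀ x, ‖u x‖ = 1) (a : Fin 2) (x : Plane) :
    ‖planeFrame u v a x‖ ≤ 1 := by
  rcases eq_or_ne x 0 with rfl | hx
  · fin_cases a <;> simp [planeFrame]
  have ho := hv.orthoPair hn (norm_pos_iff.2 hx)
  have key : ‖planeFrame u v a x‖ ^ 2 = 1 := by
    fin_cases a
    · change ‖planeFrame u v 0 x‖ ^ 2 = 1
      rw [planeFrame_zero_eq, norm_rotAt hx, norm_add_sq_real, norm_smul, norm_smul,
        inner_smul_left, inner_smul_right, frameW, inner_cross_left, ho.norm_v, ho.norm_cross]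
      simp only [Real.norm_eq_abs, mul_one, sq_abs, conj_trivial, mul_zero, add_zero]
      exact unit_sq hx
    · change ‖planeFrame u v 1 x‖ ^ 2 = 1
      rw [planeFrame_one_eq, norm_rotAt hx, norm_sub_sq_real, norm_smul, norm_smul,
        inner_smul_left, inner_smul_right, frameW, real_inner_comm, inner_cross_left, ho.norm_v,
        ho.norm_cross]
      simp only [Real.norm_eq_abs, mul_one, sq_abs, conj_trivial, mul_zero, sub_zero]
      exact unit_sq hx
  exact ((pow_eq_one_iff_of_nonneg (norm_nonneg _) two_ne_zero).1 key).le

/-- The structure equations of `planeFrame` away from the origin. -/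
lemma wd_planeFrame (hv : IsCoulombFrame u v) (hn : ∀ x, ‖u x‖ = 1) (he : IsEquivariant u)
    (hp : LocAC (profile u)) (m a : Fin 2) :
    WD {0}ᶜ m (planeFrame u v a) (frameDeriv u (grad u) (planeFrame u v) (conn u) m a) := by
  have hwac : LocAC (frameW u v) := hp.cross hv.locAC
  have dv := hv.locAC.hasIntDeriv.wd_rotAt m
  have dw := hwac.hasIntDeriv.wd_rotAt m
  have hae : ∀ᵐ x : Plane, x ≠ 0 → inner ℝ (deriv (profile u) ‖x‖) (profile u ‖x‖) = 0 ∧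
      deriv v ‖x‖ = -inner ℝ (deriv (profile u) ‖x‖) (v ‖x‖) • profile u ‖x‖ ∧
      deriv (frameW u v) ‖x‖ =
        -inner ℝ (deriv (profile u) ‖x‖) (frameW u v ‖x‖) • profile u ‖x‖ := by
    have h1 := ae_comp_norm (P := fun r => 0 < r → inner ℝ (deriv (profile u) r) (profile u r) = 0 ∧
      deriv v r = -inner ℝ (deriv (profile u) r) (v r) • profile u r ∧
      deriv (frameW u v) r = -inner ℝ (deriv (profile u) r) (frameW u v r) • profile u r) (by
      filter_upwards [hv.ae_hasDerivAt hp fun r _ => norm_profile hn r] with r hr hr0 _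
      obtain ⟨-, h2, h3, h4⟩ := hr hr0
      exact ⟨h2, h3.deriv, h4.deriv⟩)
    filter_upwards [h1] with x hx hx0 using hx (norm_pos_iff.2 hx0)
  have hkey : ∀ᵐ x : Plane, x ≠ 0 →
      rotAt x ((x m / ‖x‖) • deriv v ‖x‖ + ang m x • cross vecK (v ‖x‖)) =
        rotAt x (-inner ℝ (grad u m x) (rotAt x (v ‖x‖)) • profile u ‖x‖ +
          (ang m x * profile u ‖x‖ 2) • frameW u v ‖x‖) ∧
      rotAt x ((x m / ‖x‖) • deriv (frameW u v) ‖x‖ + ang m x • cross vecK (frameW u v ‖x‖)) =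
        rotAt x (-inner ℝ (grad u m x) (rotAt x (frameW u v ‖x‖)) • profile u ‖x‖ -
          (ang m x * profile u ‖x‖ 2) • v ‖x‖) := by
    filter_upwards [hae] with x hx hx0
    obtain ⟨h1, h2, h3⟩ := hx hx0
    have ho := hv.orthoPair hn (norm_pos_iff.2 hx0)
    unfold grad
    rw [inner_rotAt hx0, inner_rotAt hx0, h2, h3, inner_add_left, inner_add_left, inner_smul_left,
      inner_smul_left, inner_smul_left, inner_smul_left]
    simp only [frameW, conj_trivial]
    rw [ho.cross_vecK_v, ho.cross_vecK_w]
    constructor <;> congr 1 <;> module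
  fin_cases a
  · refine ((dv.smooth_smul isOpen_punctured (contDiffOn_unit 0)).add
      (dw.smooth_smul isOpen_punctured (contDiffOn_unit 1))).congr .rfl ?_
    filter_upwards [hkey, ae_ne_zero] with x hx hx0
    obtain ⟨k1, k2⟩ := hx hx0
    rw [pd_cos hx0, pd_sin hx0, k1, k2, frameDeriv, he.eq_rotAt hx0]
    change _ = conn u m x • turnSign 0 • planeFrame u v 1 x -
      inner ℝ (grad u m x) (planeFrame u v 0 x) • rotAt x (profile u ‖x‖)
    simp only [planeFrame, turnSign, conn, rotAt_add, rotAt_sub, rotAt_smul, inner_add_right,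
      inner_smul_right, Matrix.cons_val_zero, Matrix.cons_val_one]
    module
  · refine ((dw.smooth_smul isOpen_punctured (contDiffOn_unit 0)).sub
      (dv.smooth_smul isOpen_punctured (contDiffOn_unit 1))).congr .rfl ?_
    filter_upwards [hkey, ae_ne_zero] with x hx hx0
    obtain ⟨k1, k2⟩ := hx hx0
    rw [pd_cos hx0, pd_sin hx0, k1, k2, frameDeriv, he.eq_rotAt hx0]
    change _ = conn u m x • turnSign 1 • planeFrame u v 0 x -
      inner ℝ (grad u m x) (planeFrame u v 1 x) • rotAt x (profile u ‖x‖)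
    simp only [planeFrame, turnSign, conn, rotAt_add, rotAt_sub, rotAt_smul, inner_sub_right,
      inner_smul_right, Matrix.cons_val_zero, Matrix.cons_val_one]
    module

/-- Away from the origin the connection form is weakly differentiable, since `ū₃` is radial and
locally absolutely continuous. -/
lemma wd_conn (hp : LocAC (profile u)) (l m : Fin 2) :
    WD {0}ᶜ m (conn u l) (connDeriv u l m) := by
  have h1 : HasIntDeriv (fun r => 1 + profile u r 2) (deriv fun r => profile u r 2) := by
    intro a b ha hab
    have := (hp.coord 2).hasIntDeriv_real a b ha hab
    exact ⟨this.1, by rw [← this.2]; ring⟩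
  have h2 := (h1.wd_radial m).smooth_smul isOpen_punctured (contDiffOn_ang l).neg
  refine h2.congr .rfl (.of_forall fun x => ?_)
  have e : pd m (-ang l) x = -pd m (ang l) x := by
    unfold pd; rw [fderiv_neg]; rfl
  change (-ang l) x • ((x m / ‖x‖) • _) + pd m (-ang l) x • _ = _
  rw [e]
  rfl

/-! ### Existence of the Coulomb frame and bounds for the connection -/

lemma abs_coord_le_norm_cross_vecK (p : Space) {i : Fin 3} (hi : i ≠ 2) :
    |p i| ≤ ‖cross vecK p‖ := by
  have h := norm_sq_space (cross vecK p)
  simp at h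
  refine abs_le_of_sq_le_sq ?_ (norm_nonneg _)
  fin_cases i
  · change p 0 ^ 2 ≤ _
    nlinarith [sq_nonneg (p 1)]
  · change p 1 ^ 2 ≤ _
    nlinarith [sq_nonneg (p 0)]
  · exact absurd rfl hi

/-- The derivative of the height is bounded through the horizontal part `k × p` of the position,
because the tangential part of `k` has the same length. -/
lemma abs_coord_two_le {p q : Space} (hp : ‖p‖ = 1) (h : inner ℝ q p = 0) :
    |q 2| ≤ ‖q‖ * ‖cross vecK p‖ := by
  have e1 : inner ℝ q (vecK - p 2 • p) = q 2 := by
    rw [inner_sub_right, inner_smul_right, h, inner_space]; simp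
  have e2 : ‖vecK - p 2 • p‖ = ‖cross vecK p‖ := by
    have hs := norm_sq_space p
    rw [hp] at hs
    refine (pow_left_inj₀ (norm_nonneg _) (norm_nonneg _) two_ne_zero).1 ?_
    rw [norm_sq_space, norm_sq_space]
    simp
    linear_combination (1 - p 2 ^ 2) * hs
  rw [← e1, ← e2]
  exact abs_real_inner_le_norm _ _

lemma IsEquivariant.ae_profile (hu : Continuous u) (hn : ∀ x, ‖u x‖ = 1) (he : IsEquivariant u)
    {G : Fin 2 → Plane → Space} (hG : ∀ k, WD univ k u (G k)) :
    ∀ᵐ r : ℝ, 0 < r → HasDerivAt (profile u) (deriv (profile u) r) r ∧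
      inner ℝ (deriv (profile u) r) (profile u r) = 0 := by
  filter_upwards [(locAC_profile hu he hG).hasIntDeriv.ae_hasDerivAt] with r h1 hr
  exact ⟨h1 hr, inner_self_deriv hr (h1 hr) fun r _ => norm_profile hn r⟩

/-- A map of finite energy has a Coulomb frame: its energy controls the horizontal part of the
transport equation. -/
lemma IsEquivariant.exists_isCoulombFrame (hu : Continuous u) (hn : ∀ x, ‖u x‖ = 1)
    (he : IsEquivariant u) (hlim : Tendsto u (cocompact Plane) (𝓝 (-vecK)))
    (hG : ∀ k, WD univ k u (grad u k)) (hL : ∀ k, MemLp (grad u k) 2 volume) :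
    ∃ v, IsCoulombFrame u v := by
  refine EquivMap.exists_isCoulombFrame (locAC_profile hu he hG) (fun r _ => norm_profile hn r)
    (tendsto_profile hlim) fun i hi => ?_
  have hi2 : ∀ k, Integrable (fun x => ‖grad u k x‖ ^ 2) volume := fun k =>
    (hL k).integrable_norm_pow two_ne_zero
  have hF : Integrable (fun x : Plane =>
      (fun r => ‖deriv (profile u) r‖ * |profile u r i| / r) ‖x‖) volume := by
    refine ((hi2 0).add (hi2 1)).mono ?_ ?_
    · have m1 : Measurable (deriv (profile u)) := measurable_deriv _
      have m2 : Measurable (profile u) := (continuous_profile hu).measurable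
      have m3 : Measurable fun r => profile u r i :=
        ((EuclideanSpace.proj (𝕜 := ℝ) i : Space →L[ℝ] ℝ).continuous.measurable).comp m2
      have m4 : Measurable (fun r => ‖deriv (profile u) r‖ * |profile u r i| / r) :=
        (m1.norm.mul m3.norm).div measurable_id
      exact (m4.comp measurable_norm).aestronglyMeasurable
    · filter_upwards [ae_ne_zero] with x hx
      have h0 := norm_pos_iff.2 hx
      have h1 := norm_sq_grad (u := u) hx
      have h2 := abs_coord_le_norm_cross_vecK (profile u ‖x‖) hi
      refine le_trans ?_ (Real.le_norm_self _)
      change _ ≤ ‖grad u 0 x‖ ^ 2 + ‖grad u 1 x‖ ^ 2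
      rw [h1, Real.norm_of_nonneg (by positivity), mul_div_assoc]
      have h3 : |profile u ‖x‖ i| / ‖x‖ ≤ ‖cross vecK (profile u ‖x‖)‖ / ‖x‖ := by gcongr
      have h4 := mul_le_mul_of_nonneg_left h3 (norm_nonneg (deriv (profile u) ‖x‖))
      nlinarith [sq_nonneg (‖deriv (profile u) ‖x‖‖ - ‖cross vecK (profile u ‖x‖)‖ / ‖x‖),
        sq_nonneg ‖deriv (profile u) ‖x‖‖, sq_nonneg (‖cross vecK (profile u ‖x‖)‖ / ‖x‖)]
  refine ((integrable_comp_norm_iff (F := fun r => ‖deriv (profile u) r‖ * |profile u r i| / r)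
    |>.1 hF).mono_set (Ioi_subset_Ioi zero_le_one)).congr_fun
    (fun r hr => ?_) measurableSet_Ioi
  have : r ≠ 0 := (one_pos.trans hr).ne'
  simp only [smul_eq_mul]
  field_simp

section Bounds

variable {M : ℝ≥0}

/-- A bound for the gradient controls the variation of the height `ū₃`. -/
lemma ae_abs_deriv_height_le (hu : Continuous u) (hn : ∀ x, ‖u x‖ = 1) (he : IsEquivariant u)
    (hG : ∀ k, WD univ k u (grad u k)) (hM : ∀ k, ∀ᵐ x, ‖grad u k x‖ ≤ M) :
    ∀ᵐ r : ℝ, 0 < r → |deriv (fun r => profile u r 2) r| ≤ 2 * M ^ 2 * r := by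
  have h1 : ∀ᵐ x : Plane, 0 < ‖x‖ → ‖deriv (profile u) ‖x‖‖ ^ 2 +
      (‖cross vecK (profile u ‖x‖)‖ / ‖x‖) ^ 2 ≤ 2 * M ^ 2 := by
    filter_upwards [hM 0, hM 1] with x h0 h1 hx
    rw [← norm_sq_grad (norm_pos_iff.1 hx)]
    have := pow_le_pow_left₀ (norm_nonneg _) h0 2
    have := pow_le_pow_left₀ (norm_nonneg _) h1 2
    linarith
  have h2 := ae_of_ae_comp_norm (P := fun r => 0 < r → ‖deriv (profile u) r‖ ^ 2 +
      (‖cross vecK (profile u r)‖ / r) ^ 2 ≤ 2 * M ^ 2) h1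
  filter_upwards [h2, he.ae_profile hu hn hG] with r hr hp hr0
  obtain ⟨d1, d2⟩ := hp hr0
  rw [(hasDerivAt_coord_iff.1 d1 2).deriv]
  refine (abs_coord_two_le (norm_profile hn r) d2).trans ?_
  set a := ‖deriv (profile u) r‖
  set b := ‖cross vecK (profile u r)‖ with hb
  have h3 : b = b / r * r := by field_simp
  have h4 := hr hr0 hr0
  rw [h3, ← mul_assoc]
  refine mul_le_mul_of_nonneg_right ?_ hr0.le
  nlinarith [sq_nonneg (a - b / r), sq_nonneg a, sq_nonneg (b / r)]

lemma height_mem_Icc (hn : ∀ x, ‖u x‖ = 1) (r : ℝ) : 1 + profile u r 2 ∈ Icc (0 : ℝ) 2 := by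
  have := abs_le.1 ((abs_coord_le (profile u r) 2).trans (norm_profile hn r).le)
  constructor <;> linarith [this.1, this.2]

/-- Near the origin, the height above the south pole vanishes quadratically. -/
lemma height_le (hu : Continuous u) (hn : ∀ x, ‖u x‖ = 1) (he : IsEquivariant u)
    (h0 : u 0 = -vecK) (hG : ∀ k, WD univ k u (grad u k)) (hM : ∀ k, ∀ᵐ x, ‖grad u k x‖ ≤ M)
    {r : ℝ} (hr : 0 < r) : 1 + profile u r 2 ≤ M ^ 2 * r ^ 2 := by
  have hac := ((locAC_profile hu he hG).coord 2).hasIntDeriv_real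
  have hc : Continuous fun s => profile u s 2 :=
    (EuclideanSpace.proj (𝕜 := ℝ) 2 : Space →L[ℝ] ℝ).continuous.comp (continuous_profile hu)
  have key : ∀ s, 0 < s → s ≤ r → profile u r 2 - profile u s 2 ≤ M ^ 2 * r ^ 2 := by
    intro s hs hsr
    obtain ⟨i1, i2⟩ := hac s r hs hsr
    rw [i2]
    have i3 : IntervalIntegrable (fun t : ℝ => 2 * (M : ℝ) ^ 2 * t) volume s r :=
      (by fun_prop : Continuous fun t : ℝ => 2 * (M : ℝ) ^ 2 * t).intervalIntegrable _ _
    calc ∫ t in s..r, deriv (fun r => profile u r 2) t ≤ ∫ t in s..r, 2 * (M : ℝ) ^ 2 * t := by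
          refine intervalIntegral.integral_mono_ae_restrict hsr i1 i3 ?_
          filter_upwards [ae_restrict_of_ae (ae_abs_deriv_height_le hu hn he hG hM),
            ae_restrict_mem measurableSet_Icc] with t ht hm
          exact (le_abs_self _).trans (ht (hs.trans_le hm.1))
      _ = M ^ 2 * r ^ 2 - M ^ 2 * s ^ 2 := by
          rw [intervalIntegral.integral_const_mul, integral_id]; ring
      _ ≤ M ^ 2 * r ^ 2 := by
          have : (0 : ℝ) ≤ M ^ 2 * s ^ 2 := by positivity
          linarith
  have hl : Tendsto (fun s => profile u r 2 - profile u s 2) (𝓝[>] 0)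
      (𝓝 (profile u r 2 - profile u 0 2)) :=
    (tendsto_const_nhds.sub (hc.tendsto 0)).mono_left nhdsWithin_le_nhds
  have e0 : profile u 0 2 = -1 := by rw [profile_zero, h0]; simp
  have := le_of_tendsto hl (by
    filter_upwards [Ioo_mem_nhdsGT hr] with s hs using key s hs.1 hs.2.le)
  rw [e0] at this
  linarith

/-- The geometric mean of the bounds `1 + ū₃ ≤ 2` and `1 + ū₃ ≤ M² r²` is linear in `r`, which
compensates `|dθ| = 1 / r`. -/
lemma norm_conn_le (hu : Continuous u) (hn : ∀ x, ‖u x‖ = 1) (he : IsEquivariant u)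
    (h0 : u 0 = -vecK) (hG : ∀ k, WD univ k u (grad u k)) (hM : ∀ k, ∀ᵐ x, ‖grad u k x‖ ≤ M)
    (l : Fin 2) (x : Plane) : ‖conn u l x‖ ≤ 2 * M := by
  rcases eq_or_ne x 0 with rfl | hx
  · have : ang l (0 : Plane) = 0 := by fin_cases l <;> simp
    simp [conn, this]
  have hr := norm_pos_iff.2 hx
  obtain ⟨b0, b2⟩ := height_mem_Icc hn ‖x‖
  have b3 := height_le hu hn he h0 hG hM hr
  set F := 1 + profile u ‖x‖ 2 with hF
  have b4 : F ≤ 2 * M * ‖x‖ := by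
    refine (le_abs_self F).trans (abs_le_of_sq_le_sq ?_ (by positivity))
    nlinarith [mul_le_mul b3 b2 b0 (by positivity), sq_nonneg ((M : ℝ) * ‖x‖)]
  rw [conn, norm_mul, norm_neg, Real.norm_eq_abs, Real.norm_of_nonneg b0]
  calc |ang l x| * F ≤ ‖x‖⁻¹ * (2 * M * ‖x‖) := by gcongr; exact abs_ang_le x l
    _ = 2 * M := by field_simp

lemma norm_connDeriv_le (hu : Continuous u) (hn : ∀ x, ‖u x‖ = 1) (he : IsEquivariant u)
    (h0 : u 0 = -vecK) (hG : ∀ k, WD univ k u (grad u k)) (hM : ∀ k, ∀ᵐ x, ‖grad u k x‖ ≤ M)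
    (l m : Fin 2) : ∀ᵐ x, ‖connDeriv u l m x‖ ≤ 10 * (M : ℝ) ^ 2 := by
  filter_upwards [ae_comp_norm (P := fun r => |deriv (fun r => profile u r 2) r| ≤ 2 * M ^ 2 * r)
    (ae_abs_deriv_height_le hu hn he hG hM), ae_ne_zero] with x h2 hx
  have hr := norm_pos_iff.2 hx
  have h3 := height_le hu hn he h0 hG hM hr
  have h4 := (height_mem_Icc hn ‖x‖).1
  rw [connDeriv]
  refine (norm_add_le _ _).trans ?_
  rw [norm_mul, norm_mul, norm_mul, norm_neg, norm_neg, Real.norm_of_nonneg h4]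
  simp only [Real.norm_eq_abs]
  have h5 := norm_unit_le x m
  rw [Real.norm_eq_abs] at h5
  calc |ang l x| * (|x m / ‖x‖| * |deriv (fun r => profile u r 2) ‖x‖|) +
        |pd m (ang l) x| * (1 + profile u ‖x‖ 2)
      ≤ ‖x‖⁻¹ * (1 * (2 * M ^ 2 * ‖x‖)) + 3 / ‖x‖ ^ 2 * (M ^ 2 * ‖x‖ ^ 2) := by
        gcongr
        · exact abs_ang_le x l
        · exact abs_pd_ang_le hx m l
    _ = 5 * (M : ℝ) ^ 2 := by field_simp; ring
    _ ≤ _ := by nlinarith [sq_nonneg (M : ℝ)]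

lemma inner_planeFrame {x : Plane} (hx : x ≠ 0) (X : Space) :
    inner ℝ (rotAt x X) (planeFrame u v 0 x) =
      x 0 / ‖x‖ * inner ℝ X (v ‖x‖) + x 1 / ‖x‖ * inner ℝ X (frameW u v ‖x‖) ∧
    inner ℝ (rotAt x X) (planeFrame u v 1 x) =
      x 0 / ‖x‖ * inner ℝ X (frameW u v ‖x‖) - x 1 / ‖x‖ * inner ℝ X (v ‖x‖) := by
  rw [planeFrame_zero_eq, planeFrame_one_eq, inner_rotAt hx, inner_rotAt hx, inner_add_right,
    inner_sub_right]
  simp only [inner_smul_right, and_self]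

lemma IsEquivariant.inner_grad_self (hu : Continuous u) (hn : ∀ x, ‖u x‖ = 1)
    (he : IsEquivariant u) (hG : ∀ k, WD univ k u (grad u k)) (k : Fin 2) :
    ∀ᵐ x, inner ℝ (grad u k x) (u x) = 0 := by
  filter_upwards [ae_comp_norm (P := fun r => inner ℝ (deriv (profile u) r) (profile u r) = 0)
    (he.ae_profile hu hn hG |>.mono fun r hr h => (hr h).2), ae_ne_zero] with x h1 hx
  have e1 : inner ℝ (cross vecK (profile u ‖x‖)) (profile u ‖x‖) = 0 := by
    rw [inner_space]; simp; ring
  rw [he.eq_rotAt hx, grad, inner_rotAt hx, inner_add_left, inner_smul_left, inner_smul_left, h1,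
    e1]
  simp

/-- The frame `planeFrame` is orthonormal and tangent, so that the gradient expands in it. -/
lemma IsCoulombFrame.grad_eq_sum (hv : IsCoulombFrame u v) (hu : Continuous u)
    (hn : ∀ x, ‖u x‖ = 1) (he : IsEquivariant u) (hG : ∀ k, WD univ k u (grad u k)) (k : Fin 2) :
    ∀ᵐ x, grad u k x = ∑ a, inner ℝ (grad u k x) (planeFrame u v a x) • planeFrame u v a x := by
  filter_upwards [he.inner_grad_self hu hn hG k, ae_ne_zero] with x t hx
  have ho := hv.orthoPair hn (norm_pos_iff.2 hx)
  have e := ho.expand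
  rw [he.eq_rotAt hx, grad, inner_rotAt hx] at t
  rw [grad]
  set X := (x k / ‖x‖) • deriv (profile u) ‖x‖ + ang k x • cross vecK (profile u ‖x‖)
  obtain ⟨i1, i2⟩ := inner_planeFrame (u := u) (v := v) hx X
  specialize e X
  rw [t, zero_smul, add_zero] at e
  rw [Fin.sum_univ_two, i1, i2, planeFrame_zero_eq, planeFrame_one_eq, ← rotAt_smul, ← rotAt_smul,
    ← rotAt_add]
  congr 1
  have hs := unit_sq hx
  refine e.trans ?_
  simp only [frameW]
  match_scalars
  · linear_combination -inner ℝ X (v ‖x‖) * hs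
  · linear_combination -inner ℝ X (cross (profile u ‖x‖) (v ‖x‖)) * hs

/-- An equivariant map with bounded gradient, together with `planeFrame`, is a moving frame. -/
lemma IsCoulombFrame.movingFrame (hv : IsCoulombFrame u v) (hu : Continuous u)
    (hn : ∀ x, ‖u x‖ = 1) (he : IsEquivariant u) (h0 : u 0 = -vecK)
    (hG : ∀ k, WD univ k u (grad u k)) (hM : ∀ k, ∀ᵐ x, ‖grad u k x‖ ≤ M) :
    MovingFrame u (grad u) (planeFrame u v) (conn u) (connDeriv u) M := by
  have hp := locAC_profile hu he hG
  refine ⟨hG, fun m a => ?_, fun l m => ?_, fun x => (hn x).le, norm_planeFrame_le hv hn,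
    he.inner_grad_self hu hn hG, hv.grad_eq_sum hu hn he hG, hM,
    fun l => .of_forall (norm_conn_le hu hn he h0 hG hM l), norm_connDeriv_le hu hn he h0 hG hM⟩
  · refine (wd_planeFrame hv hn he hp m a).of_punctured_of_bound (norm_planeFrame_le hv hn a)
      (K' := 3 * M) ?_
    filter_upwards [hM m] with x hx
    exact norm_frameDeriv_le_of hx (norm_conn_le hu hn he h0 hG hM m x)
      (fun a => norm_planeFrame_le hv hn a x) (hn x).le
  · exact (wd_conn hp l m).of_punctured_of_bound (norm_conn_le hu hn he h0 hG hM l)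
      (norm_connDeriv_le hu hn he h0 hG hM l m)

end Bounds

end Frame

/-! ### The fields `R_+ ψ⁺` and `R_- ψ⁻` as components of the gradient -/

section Fields

variable {u : Plane → Space} {v : ℝ → Space}

/-- The components of the gradient of `u` in the frame `planeFrame`. -/
def gradCoord (u : Plane → Space) (v : ℝ → Space) (k a : Fin 2) (x : Plane) : ℝ :=
  inner ℝ (grad u k x) (planeFrame u v a x)

lemma norm_reflect (x : Plane) : ‖reflect x‖ = ‖x‖ := reflect.norm_map x

/-- With `∂ₖ = ∑ₐ gradCoord k a • eₐ` and the frame read as a complex coordinate, `R_+ ψ⁺` is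
`(∂₀ + i ∂₁) u`. -/
lemma extPsiPlus_eq {x : Plane} (hx : x ≠ 0) : extPsiPlus u v x =
    ((gradCoord u v 0 0 x - gradCoord u v 1 1 x : ℝ) : ℂ) +
      Complex.I * ((gradCoord u v 0 1 x + gradCoord u v 1 0 x : ℝ) : ℂ) := by
  have hs := unit_sq hx
  have hang : ∀ l, x l / ‖x‖ ^ 2 = x l / ‖x‖ / ‖x‖ := fun l => by rw [div_div, pow_two]
  simp only [gradCoord, grad, (inner_planeFrame hx _).1, (inner_planeFrame hx _).2, inner_add_left,
    inner_smul_left, conj_trivial, ang_zero, ang_one]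
  simp only [extPsiPlus, ext2, psiPlus, psi1, psi2, frameCoord, zpow_zero, one_mul]
  generalize inner ℝ (deriv (profile u) ‖x‖) (v ‖x‖) = α₁
  generalize inner ℝ (deriv (profile u) ‖x‖) (frameW u v ‖x‖) = β₁
  generalize inner ℝ (cross vecK (profile u ‖x‖)) (v ‖x‖) = α₂
  generalize inner ℝ (cross vecK (profile u ‖x‖)) (frameW u v ‖x‖) = β₂
  have hsC : ((x 0 / ‖x‖ : ℝ) : ℂ) ^ 2 + ((x 1 / ‖x‖ : ℝ) : ℂ) ^ 2 = 1 := by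
    rw [← Complex.ofReal_pow, ← Complex.ofReal_pow, ← Complex.ofReal_add, hs, Complex.ofReal_one]
  rw [hang, hang]
  push_cast at hsC ⊢
  linear_combination -((α₁ : ℂ) + Complex.I * β₁ + (Complex.I * α₂ - β₂) / (‖x‖ : ℂ)) * hsC +
    (β₂ / (‖x‖ : ℂ) : ℂ) * Complex.I_sq

/-- Up to the reflection `θ ↦ -θ`, `R_- ψ⁻` is `(∂₀ - i ∂₁) u`. -/
lemma extPsiMinus_reflect_eq {x : Plane} (hx : x ≠ 0) : extPsiMinus u v (reflect x) =
    ((gradCoord u v 0 0 x + gradCoord u v 1 1 x : ℝ) : ℂ) +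
      Complex.I * ((gradCoord u v 0 1 x - gradCoord u v 1 0 x : ℝ) : ℂ) := by
  have hang : ∀ l, x l / ‖x‖ ^ 2 = x l / ‖x‖ / ‖x‖ := fun l => by rw [div_div, pow_two]
  have e : ((reflect x 0 : ℂ) + Complex.I * (reflect x 1 : ℂ)) / (‖x‖ : ℂ) =
      ((x 0 / ‖x‖ : ℝ) : ℂ) - Complex.I * ((x 1 / ‖x‖ : ℝ) : ℂ) := by
    simp only [reflect_zero, reflect_one]; push_cast; ring
  simp only [gradCoord, grad, (inner_planeFrame hx _).1, (inner_planeFrame hx _).2, inner_add_left,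
    inner_smul_left, conj_trivial, ang_zero, ang_one]
  simp only [extPsiMinus, ext2, psiMinus, psi1, psi2, frameCoord, norm_reflect, e]
  generalize inner ℝ (deriv (profile u) ‖x‖) (v ‖x‖) = α₁
  generalize inner ℝ (deriv (profile u) ‖x‖) (frameW u v ‖x‖) = β₁
  generalize inner ℝ (cross vecK (profile u ‖x‖)) (v ‖x‖) = α₂
  generalize inner ℝ (cross vecK (profile u ‖x‖)) (frameW u v ‖x‖) = β₂
  rw [show (2 : ℤ) = ((2 : ℕ) : ℤ) from rfl, zpow_natCast, pow_two]
  rw [hang, hang]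
  push_cast
  generalize (x 0 : ℂ) / (‖x‖ : ℂ) = c
  generalize (x 1 : ℂ) / (‖x‖ : ℂ) = s
  linear_combination ((-c ^ 2 * β₂ / ‖x‖ - 2 * c * s * (β₁ - α₂ / ‖x‖) + s ^ 2 * α₁) +
    (2 * c * s * β₂ / ‖x‖ + s ^ 2 * (β₁ - α₂ / ‖x‖)) * Complex.I -
    s ^ 2 * β₂ / ‖x‖ * (Complex.I ^ 2 - 1)) * Complex.I_sq

lemma H2Bd.clm_of_le {F G : Type*} [NormedAddCommGroup F] [NormedAddCommGroup G] [NormedSpace ℝ F]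
    [NormedSpace ℝ G] [CompleteSpace F] [CompleteSpace G] {f : Plane → F} {P K : ℝ≥0}
    (h : H2Bd f P K) (L : F →L[ℝ] G) (hL : ∀ y, ‖L y‖ ≤ ‖y‖) : H2Bd (fun x => L (f x)) P K := by
  have hL1 : ‖L‖₊ ≤ 1 := L.opNorm_le_bound zero_le_one fun y => by simpa using hL y
  exact (h.clm L).mono (mul_le_of_le_one_left' hL1) (mul_le_of_le_one_left' hL1)

/-- The fields `R_± ψ^±` are, up to a reflection, sums of components of the gradient. -/
lemma h2Bd_extPsi {P K : ℝ≥0} (h : ∀ k a, H2Bd (gradCoord u v k a) P K) :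
    H2Bd (extPsiPlus u v) (4 * P) (4 * K) ∧ H2Bd (extPsiMinus u v) (4 * P) (4 * K) := by
  set L : ℂ → ℝ →L[ℝ] ℂ := fun z => z • Complex.ofRealCLM with hL
  have hLa : ∀ z t, L z t = z * (t : ℂ) := fun z t => rfl
  have hLn : ∀ z : ℂ, ‖z‖ = 1 → ∀ t, ‖L z t‖ ≤ ‖t‖ := fun z hz t => by
    rw [hLa, norm_mul, hz, one_mul, Complex.norm_real]
  have key : ∀ z₁ z₂ z₃ z₄ : ℂ, ‖z₁‖ = 1 → ‖z₂‖ = 1 → ‖z₃‖ = 1 → ‖z₄‖ = 1 →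
      H2Bd (fun x => (L z₁ (gradCoord u v 0 0 x) + L z₂ (gradCoord u v 1 1 x)) +
        (L z₃ (gradCoord u v 0 1 x) + L z₄ (gradCoord u v 1 0 x))) (4 * P) (4 * K) := by
    intro z₁ z₂ z₃ z₄ h1 h2 h3 h4
    exact ((((h 0 0).clm_of_le _ (hLn z₁ h1)).add ((h 1 1).clm_of_le _ (hLn z₂ h2))).add
      (((h 0 1).clm_of_le _ (hLn z₃ h3)).add ((h 1 0).clm_of_le _ (hLn z₄ h4)))).mono
      (le_of_eq (by ring)) (le_of_eq (by ring))
  constructor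
  · refine (key 1 (-1) Complex.I Complex.I (by simp) (by simp) (by simp) (by simp)).congr ?_
    filter_upwards [ae_ne_zero] with x hx
    rw [extPsiPlus_eq hx]
    simp only [hLa]
    push_cast
    ring
  · have h1 : H2Bd (fun x => extPsiMinus u v (reflect x)) (4 * P) (4 * K) := by
      refine (key 1 1 Complex.I (-Complex.I) (by simp) (by simp) (by simp) (by simp)).congr ?_
      filter_upwards [ae_ne_zero] with x hx
      rw [extPsiMinus_reflect_eq hx]
      simp only [hLa]
      push_cast
      ring
    simpa only [reflect_reflect] using h1.comp_reflect

/-- Conversely, the components of the gradient are averages of the real and imaginary parts of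
`R_+ ψ⁺` and of the reflected `R_- ψ⁻`. -/
lemma H2Bd.gradCoord {P K P' K' : ℝ≥0} (h : H2Bd (extPsiPlus u v) P K)
    (h' : H2Bd (extPsiMinus u v) P' K') (k a : Fin 2) :
    H2Bd (gradCoord u v k a) (P + P') (K + K') := by
  have hr := h'.comp_reflect
  have key : ∀ (L : ℂ →L[ℝ] ℝ), (∀ z, ‖L z‖ ≤ ‖z‖) → ∀ (s s' : ℝ), ‖s‖ ≤ 1 → ‖s'‖ ≤ 1 →
      (∀ x, x ≠ 0 → s * L (extPsiPlus u v x) + s' * L (extPsiMinus u v (reflect x)) =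
        EquivMap.gradCoord u v k a x) →
      H2Bd (EquivMap.gradCoord u v k a) (P + P') (K + K') := by
    intro L hL s s' hs hs' he
    have hb : ∀ t : ℝ, ‖t‖ ≤ 1 → ∀ z, ‖(t • L) z‖ ≤ ‖z‖ := fun t ht z => by
      change ‖t • L z‖ ≤ _
      rw [norm_smul]
      exact (mul_le_of_le_one_left (norm_nonneg _) ht).trans (hL z)
    refine ((h.clm_of_le _ (hb s hs)).add (hr.clm_of_le _ (hb s' hs'))).congr ?_
    filter_upwards [ae_ne_zero] with x hx
    exact he x hx
  have hre : ∀ z : ℂ, ‖Complex.reCLM z‖ ≤ ‖z‖ := Complex.abs_re_le_norm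
  have him : ∀ z : ℂ, ‖Complex.imCLM z‖ ≤ ‖z‖ := Complex.abs_im_le_norm
  have e : ‖(1 / 2 : ℝ)‖ ≤ 1 := by norm_num
  have e' : ‖(-(1 / 2) : ℝ)‖ ≤ 1 := by norm_num
  fin_cases k <;> fin_cases a
  · refine key Complex.reCLM hre (1 / 2) (1 / 2) e e fun x hx => ?_
    rw [extPsiPlus_eq hx, extPsiMinus_reflect_eq hx]
    simp; ring
  · refine key Complex.imCLM him (1 / 2) (1 / 2) e e fun x hx => ?_
    rw [extPsiPlus_eq hx, extPsiMinus_reflect_eq hx]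
    simp; ring
  · refine key Complex.imCLM him (1 / 2) (-(1 / 2)) e e' fun x hx => ?_
    rw [extPsiPlus_eq hx, extPsiMinus_reflect_eq hx]
    simp; ring
  · refine key Complex.reCLM hre (-(1 / 2)) (1 / 2) e' e fun x hx => ?_
    rw [extPsiPlus_eq hx, extPsiMinus_reflect_eq hx]
    simp; ring

end Fields

/-! ### The two directions of the equivalence -/

section Equivalence

variable {u : Plane → Space} {v : ℝ → Space}

lemma norm_gradCoord_le (hv : IsCoulombFrame u v) (hn : ∀ x, ‖u x‖ = 1) (k a : Fin 2) (x : Plane) :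
    ‖gradCoord u v k a x‖ ≤ ‖grad u k x‖ :=
  (norm_inner_le_norm _ _).trans
    (mul_le_of_le_one_right (norm_nonneg _) (norm_planeFrame_le hv hn a x))

/-- `Ḣ³` bounds for `u` give `H²` bounds for `R_± ψ^±`. -/
lemma IsCoulombFrame.memH2_of_memHdot (hv : IsCoulombFrame u v) (hu : Continuous u)
    (hn : ∀ x, ‖u x‖ = 1) (he : IsEquivariant u) (h0 : u 0 = -vecK)
    (hG : ∀ k, WD univ k u (grad u k)) {P K : ℝ≥0} (hP : ∀ k, L2Bd (grad u k) P)
    (h3 : MemHdot 3 u) (hK : hdotNorm 3 u ≤ K) :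
    (MemH2 (extPsiPlus u v) ∧ MemH2 (extPsiMinus u v)) ∧
      h2Norm (extPsiPlus u v) + h2Norm (extPsiMinus u v) ≤
        ((96 * (1 + 10 * P + 56 * P ^ 2) * (P + K) : ℝ≥0) : ℝ≥0∞) := by
  set R := NNReal.sqrt (P * K) with hR
  choose G₁ G₂ hd hp hk using h3.h2Bd_of_wd hG hP hK
  have hi := fun k => (hd k).interp (hp k) (hk k)
  have hmf := hv.movingFrame hu hn he h0 hG (M := 2 * R) fun k => (hi k).2
  have hψ : ∀ k a, H2Bd (gradCoord u v k a) P (K * (1 + 10 * P + 56 * P ^ 2)) := fun k a => by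
    refine (hmf.h2Bd_inner hd hP (fun k => (hi k).1) hk k a).mono le_rfl (le_of_eq ?_)
    have e : R ^ 2 = P * K := NNReal.sq_sqrt _
    calc K + (5 * (2 * R) * R + 14 * (2 * R) ^ 2 * P) = K + (10 * R ^ 2 + 56 * R ^ 2 * P) := by ring
      _ = _ := by rw [e]; ring
  obtain ⟨h1, h2⟩ := h2Bd_extPsi hψ
  refine ⟨⟨h1.memH2_and_le.1, h2.memH2_and_le.1⟩, ?_⟩
  refine (add_le_add h1.memH2_and_le.2 h2.memH2_and_le.2).trans ?_
  rw [show (12 : ℝ≥0∞) = ((12 : ℝ≥0) : ℝ≥0∞) from rfl, ← ENNReal.coe_mul, ← ENNReal.coe_add,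
    ENNReal.coe_le_coe]
  calc 12 * (4 * P + 4 * (K * (1 + 10 * P + 56 * P ^ 2))) +
        12 * (4 * P + 4 * (K * (1 + 10 * P + 56 * P ^ 2)))
      ≤ 12 * (4 * P + 4 * (K * (1 + 10 * P + 56 * P ^ 2))) +
        12 * (4 * P + 4 * (K * (1 + 10 * P + 56 * P ^ 2))) + 96 * (10 * P + 56 * P ^ 2) * P :=
        le_self_add
    _ = _ := by ring

/-- `H²` bounds for `R_± ψ^±` give `Ḣ³` bounds for `u`. -/
lemma IsCoulombFrame.memHdot_of_memH2 (hv : IsCoulombFrame u v) (hu : Continuous u)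
    (hn : ∀ x, ‖u x‖ = 1) (he : IsEquivariant u) (h0 : u 0 = -vecK)
    (hG : ∀ k, WD univ k u (grad u k)) {P K K' : ℝ≥0} (hP : ∀ k, L2Bd (grad u k) P)
    (h1 : MemH2 (extPsiPlus u v)) (h2 : MemH2 (extPsiMinus u v)) (hK : h2Norm (extPsiPlus u v) ≤ K)
    (hK' : h2Norm (extPsiMinus u v) ≤ K') :
    MemHdot 3 u ∧
      hdot13Norm u ≤ ((20 * (1 + 28 * P + 272 * P ^ 2) * (K + K') : ℝ≥0) : ℝ≥0∞) := by
  set N := K + K' with hN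
  set R := NNReal.sqrt (P * N) with hR
  choose ψ₁ ψ₂ hd hp hk using (h1.h2Bd hK).gradCoord (h2.h2Bd hK')
  have hψ : ∀ k a, L2Bd (gradCoord u v k a) P := fun k a =>
    .of_le (hp k a).1 (hP k).norm (.of_forall (norm_gradCoord_le hv hn k a))
  have hi := fun k a => (hd k a).interp (hψ k a) (hk k a)
  have hsum : ∀ k, ∀ᵐ x, ‖grad u k x‖ ≤ ‖gradCoord u v k 0 x‖ + ‖gradCoord u v k 1 x‖ := by
    intro k
    filter_upwards [hv.grad_eq_sum hu hn he hG k] with x hx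
    rw [Fin.sum_univ_two] at hx
    rw [hx]
    refine (norm_add_le _ _).trans ?_
    rw [norm_smul, norm_smul]
    exact add_le_add (mul_le_of_le_one_right (norm_nonneg _) (norm_planeFrame_le hv hn 0 x))
      (mul_le_of_le_one_right (norm_nonneg _) (norm_planeFrame_le hv hn 1 x))
  have hM : ∀ k, ∀ᵐ x, ‖grad u k x‖ ≤ (4 * R : ℝ≥0) := fun k => by
    filter_upwards [hsum k, (hi k 0).2, (hi k 1).2] with x e e0 e1
    refine (e.trans (add_le_add e0 e1)).trans (le_of_eq ?_)
    rw [hR, hN]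
    push_cast
    ring
  have hmf := hv.movingFrame hu hn he h0 hG hM
  have hg : ∀ k, H2Bd (grad u k) P (2 * (N * (1 + 28 * P + 272 * P ^ 2))) := fun k => by
    refine (hmf.h2Bd_of_inner (fun k a x => rfl) hd hP hψ (fun k a => (hi k a).1) hk k).mono le_rfl
      (le_of_eq ?_)
    have e : R ^ 2 = P * N := NNReal.sq_sqrt _
    calc 2 * (N + (7 * (4 * R) * R + 17 * (4 * R) ^ 2 * P)) =
          2 * (N + (28 * R ^ 2 + 272 * R ^ 2 * P)) := by ring
      _ = _ := by rw [e]; ring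
  obtain ⟨m3, b3⟩ := memHdot_three_of_h2Bd hG hg
  refine ⟨m3, ?_⟩
  have b1 : hdotNorm 1 u ≤ 2 ^ 1 * ((N + N : ℝ≥0) : ℝ≥0∞) := hdotNorm_le fun w =>
    (HasWeakDeriv.weakDerivNorm_le (hasWeakDeriv_one_iff.2 (hG (w 0)))).trans
      (L2Bd.of_le (hP (w 0)).1 ((hp (w 0) 0).norm.add (hp (w 0) 1).norm) (hsum (w 0))).2
  refine (add_le_add b1 b3).trans ?_
  rw [show (2 : ℝ≥0∞) ^ 1 = ((2 : ℝ≥0) : ℝ≥0∞) by simp,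
    show (8 : ℝ≥0∞) = ((8 : ℝ≥0) : ℝ≥0∞) from rfl, ← ENNReal.coe_mul, ← ENNReal.coe_mul,
    ← ENNReal.coe_add, ENNReal.coe_le_coe]
  calc 2 * (N + N) + 8 * (2 * (N * (1 + 28 * P + 272 * P ^ 2)))
      ≤ 2 * (N + N) + 8 * (2 * (N * (1 + 28 * P + 272 * P ^ 2))) + 4 * (28 * P + 272 * P ^ 2) * N :=
        le_self_add
    _ = _ := by ring

lemma hdotNorm_one_le_of_energy {u : Plane → Space} {E₀ P : ℝ≥0} (hP : hdotNorm 1 u = P)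
    (hE : energy u ≤ E₀) : P ≤ 1 + 2 * E₀ := by
  have h1 : hdotNorm 1 u ^ 2 ≤ 2 * (E₀ : ℝ≥0∞) := by
    rw [mul_comm]
    exact (ENNReal.div_le_iff two_ne_zero (by simp)).1 hE
  rw [hP, show (2 : ℝ≥0∞) = ((2 : ℝ≥0) : ℝ≥0∞) from rfl, ← ENNReal.coe_pow, ← ENNReal.coe_mul,
    ENNReal.coe_le_coe] at h1
  rcases le_total P 1 with h | h
  · exact h.trans le_self_add
  · exact (le_self_pow h two_ne_zero).trans (h1.trans le_add_self)

/-- The gradient of an equivariant map in `Ḣ¹`. -/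
lemma IsEquivariant.grad_of_memHdot_one {u : Plane → Space} (he : IsEquivariant u)
    (hu : Continuous u) (h : MemHdot 1 u) :
    (∀ k, WD univ k u (grad u k)) ∧ ∀ k, L2Bd (grad u k) (hdotNorm 1 u).toNNReal := by
  choose G hG hG2 using fun k : Fin 2 => h fun _ => k
  have hw : ∀ k, WD univ k u (G k) := fun k => hasWeakDeriv_one_iff.1 (hG k)
  refine ⟨fun k => (wd_grad hu he hw k).1, fun k => ?_⟩
  refine L2Bd.congr ⟨(hG2 k).1, ?_⟩ (wd_grad hu he hw k).2
  rw [← (hG k).weakDerivNorm_eq, ENNReal.coe_toNNReal h.hdotNorm_ne_top]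
  exact weakDerivNorm_le_hdotNorm _ u

end Equivalence

end EquivMap

end

open EquivMap in
theorem proposition2p1 (E₀ : ℝ≥0) :
    ∃ C : ℝ≥0, ∀ u : Plane → Space,
      Continuous u → (∀ x, ‖u x‖ = 1) → IsEquivariant u →
      u 0 = -vecK → Tendsto u (cocompact Plane) (𝓝 (-vecK)) →
      MemHdot 1 u → energy u ≤ E₀ →
      (∃ v : ℝ → Space, IsCoulombFrame u v) ∧
      ∀ v : ℝ → Space, IsCoulombFrame u v →
        (MemHdot 3 u ↔ MemH2 (extPsiPlus u v) ∧ MemH2 (extPsiMinus u v)) ∧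
        (MemHdot 3 u →
          hdot13Norm u ≤ C * (h2Norm (extPsiPlus u v) + h2Norm (extPsiMinus u v)) ∧
          h2Norm (extPsiPlus u v) + h2Norm (extPsiMinus u v) ≤ C * hdot13Norm u) := by
  -- the `Ḣ¹` norm is at most `P₀`, since `P² ≤ 2 E₀` implies `P ≤ 1 + 2 E₀`
  set P₀ : ℝ≥0 := 1 + 2 * E₀ with hP₀
  refine ⟨96 * (1 + 28 * P₀ + 272 * P₀ ^ 2), fun u hu hn he h0 hlim h1 hE => ?_⟩
  obtain ⟨hG, hL⟩ := he.grad_of_memHdot_one hu h1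
  set P := (hdotNorm 1 u).toNNReal with hPdef
  have hP : hdotNorm 1 u = P := (ENNReal.coe_toNNReal h1.hdotNorm_ne_top).symm
  have hPP : P ≤ P₀ := hdotNorm_one_le_of_energy hP hE
  refine ⟨he.exists_isCoulombFrame hu hn hlim hG fun k => (hL k).memLp, fun v hv => ?_⟩
  have fwd : MemHdot 3 u → (MemH2 (extPsiPlus u v) ∧ MemH2 (extPsiMinus u v)) ∧
      h2Norm (extPsiPlus u v) + h2Norm (extPsiMinus u v) ≤
        (96 * (1 + 28 * P₀ + 272 * P₀ ^ 2) : ℝ≥0) * hdot13Norm u := by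
    intro h3
    have hK : hdotNorm 3 u = (hdotNorm 3 u).toNNReal :=
      (ENNReal.coe_toNNReal h3.hdotNorm_ne_top).symm
    obtain ⟨hm, hb⟩ := hv.memH2_of_memHdot hu hn he h0 hG hL h3 hK.le
    refine ⟨hm, hb.trans ?_⟩
    rw [hdot13Norm, hP, hK, ← ENNReal.coe_add, ← ENNReal.coe_mul, ENNReal.coe_le_coe]
    simp only [ENNReal.toNNReal_coe]
    gcongr <;> norm_num
  have bwd : MemH2 (extPsiPlus u v) → MemH2 (extPsiMinus u v) → MemHdot 3 u ∧ hdot13Norm u ≤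
      (96 * (1 + 28 * P₀ + 272 * P₀ ^ 2) : ℝ≥0) *
        (h2Norm (extPsiPlus u v) + h2Norm (extPsiMinus u v)) := by
    intro m1 m2
    have hK : h2Norm (extPsiPlus u v) = (h2Norm (extPsiPlus u v)).toNNReal :=
      (ENNReal.coe_toNNReal m1.h2Norm_ne_top).symm
    have hK' : h2Norm (extPsiMinus u v) = (h2Norm (extPsiMinus u v)).toNNReal :=
      (ENNReal.coe_toNNReal m2.h2Norm_ne_top).symm
    obtain ⟨hm, hb⟩ := hv.memHdot_of_memH2 hu hn he h0 hG hL m1 m2 hK.le hK'.le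
    refine ⟨hm, hb.trans ?_⟩
    rw [hK, hK', ← ENNReal.coe_add, ← ENNReal.coe_mul, ENNReal.coe_le_coe]
    simp only [ENNReal.toNNReal_coe]
    gcongr
    norm_num
  exact ⟨⟨fun h3 => (fwd h3).1, fun hm => (bwd hm.1 hm.2).1⟩, fun h3 =>
    ⟨(bwd (fwd h3).1.1 (fwd h3).1.2).2, (fwd h3).2⟩⟩
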